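/- Let $n\ge 2$, $a=(a_1,\dots,a_n)\in\mathbb C^n$, $|a|=a_1+\cdots+a_n$, and $\Gamma_{\mathbf R}(s)=\pi^{-s/2}\Gamma(s/2)$. Define $\widehat W_{n,a}(y_1,\dots,y_{n-1})$ for $y_j>0$ (the radial part of the class one Whittaker function on $GL_n(\mathbb R)$) by $$\widehat W_{2,(a_1,a_2)}(y_1)=2\,y_1^{(a_1+a_2)/2}K_{(a_1-a_2)/2}(2\pi y_1)$$ ($K$ the $K$-Bessel function) and, for $n\ge3$, with $\widetilde a=(\widetilde a_1,\dots,\widetilde a_{n-1})$, $\widetilde a_j=a_{j+1}+\frac{a_1}{n-1}$, $$\widehat W_{n,a}(y_1,\dots,y_{n-1})=\int_{(0,\infty)^{n-1}}\widehat W_{n-1,\widetilde a}\Bigl(y_2\sqrt{\tfrac{t_2}{t_1}},\dots,y_{n-1}\sqrt{\tfrac{t_{n-1}}{t_{n-2}}}\Bigr)\prod_{j=1}^{n-1}\Bigl(e^{-(\pi y_j)^2t_j-1/t_j}(\pi y_j)^{\frac{(n-j)a_1}{n-1}}t_j^{\frac{na_1}{2(n-1)}}\Bigr)(\pi t_{n-1})^{-|a|/2}\prod_{j=1}^{n-1}\frac{dt_j}{t_j}.$$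 Let $L_j=\{-\sum_{i\in I}a_i-2k : I\subset\{1,\dots,n\},\ |I|=j,\ k=0,1,2,\dots\}$ for $1\le j\le n-1$. The Mellin transform $$U_{n,a}(s_1,\dots,s_{n-1})=\int_{(0,\infty)^{n-1}}\widehat W_{n,a}(y)\prod_{j=1}^{n-1}y_j^{s_j}\frac{dy_j}{y_j}$$ converges absolutely if $\mathrm{Re}(s_j+\sum_{i\in I}a_i)>0$ for all $j$ and all $I$ with $|I|=j$, and it continues to a holomorphic function, again denoted $U_{n,a}$, on the set where $s_j\notin L_j$ for all $j$. For $R\subset\mathbb C$, say that a path separates $L_j$ from $R$ if it is an upward vertical line, indented if necessary within a bounded region (piecewise $C^1$), that avoids $L_j\cup R$ and has all points of $L_j$ on its left and all points of $R$ on its right. Let $\sigma\in\mathbb C$ and $p=(p_1,\dots,p_{n-1})\in\mathbb C^{n-1}$. (1) Put $p_0=0$. Suppose that $p_{n-1}+\sigma+|a|\notin\{0,-2,-4,\dots\}$ and that, for each $1\le j\le n-1$, $\mathcal C_j$ is a path separating $L_j$ from $\{p_j+2k,\ p_{j-1}+\sigma+2k: k\ge0\}$. Then $$U_{n,a}(p_1,\dots,p_{n-1})=\frac{\Gamma_{\mathbf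 R}(p_{n-1}+\sigma+|a|)}{\prod_{j=1}^n\Gamma_{\mathbf R}(\sigma+a_j)}\cdot\frac1{(4\pi i)^{n-1}}\int_{\mathcal C_1\times\cdots\times\mathcal C_{n-1}}U_{n,a}(q_1,\dots,q_{n-1})\prod_{j=1}^{n-1}\Gamma_{\mathbf R}(p_j-q_j)\,\Gamma_{\mathbf R}(p_{j-1}-q_j+\sigma)\;dq_1\cdots dq_{n-1},$$ the integral being absolutely convergent. (2) Put $p_n=-|a|$. Suppose that $p_1+\sigma\notin\{0,-2,-4,\dots\}$ and that, for each $1\le j\le n-1$, $\mathcal C_j$ is a path separating $L_j$ from $\{p_j+2k,\ p_{j+1}+\sigma+2k: k\ge0\}$. Then $$U_{n,a}(p_1,\dots,p_{n-1})=\frac{\Gamma_{\mathbf R}(p_1+\sigma)}{\prod_{j=1}^n\Gamma_{\mathbf R}(\sigma-a_j)}\cdot\frac1{(4\pi i)^{n-1}}\int_{\mathcal C_1\times\cdots\times\mathcal C_{n-1}}U_{n,a}(q_1,\dots,q_{n-1})\prod_{j=1}^{n-1}\Gamma_{\mathbf R}(p_j-q_j)\,\Gamma_{\mathbf R}(p_{j+1}-q_j+\sigma)\;dq_1\cdots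 dq_{n-1},$$ the integral being absolutely convergent. -/

import Mathlib

open MeasureTheory Filter Topology

noncomputable section

namespace GLWhittaker

/-- The `K`-Bessel function `K_ν(x)` for `x > 0`, through its integral
`K_ν(x) = (1/2) ∫_0^∞ exp(-(x/2)(t + 1/t)) t^ν dt/t`. -/
def besselK (ν : ℂ) (x : ℝ) : ℂ :=
  (1 / 2) * ∫ t in Set.Ioi (0 : ℝ),
    (Real.exp (-(x / 2) * (t + 1 / t)) : ℂ) * (t : ℂ) ^ ν / (t : ℂ)

/-- The positive orthant `(ℝ_+)^k`. -/
def posOrthant (k : ℕ) : Set (Fin k → ℝ) := {t | ∀ j, 0 < t j}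

/-- The parameter `ã = (ã_1, …, ã_{n-1})`, `ã_j = a_{j+1} + a_1/(n-1)`, for `n = m + 3`.
(Indices of vectors start from `0` in the code.) -/
def tildeParam {m : ℕ} (a : Fin (m + 3) → ℂ) : Fin (m + 2) → ℂ :=
  fun j => a j.succ + a 0 / ((m : ℂ) + 2)

/-- The radial part `Ŵ_{n,a}(α[y_1, …, y_{n-1}, 1])` of the class one Whittaker function on
`GL_n(ℝ)`, `n = m + 2`, through the `K`-Bessel function for `n = 2` and through the recursion
from `GL_{n-1}` to `GL_n` for `n ≥ 3`. -/
def whittakerRadial : (m : ℕ) → (Fin (m + 2) → ℂ) → (Fin (m + 1) → ℝ) → ℂ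
  | 0, a, y =>
      2 * (y 0 : ℂ) ^ ((a 0 + a 1) / 2) * besselK ((a 0 - a 1) / 2) (2 * Real.pi * y 0)
  | m + 1, a, y =>
      ∫ t in posOrthant (m + 2),
        whittakerRadial m (tildeParam a)
            (fun j : Fin (m + 1) => y j.succ * Real.sqrt (t j.succ / t j.castSucc))
          * (∏ j : Fin (m + 2),
              (Real.exp (-(Real.pi * y j) ^ 2 * t j - 1 / t j) : ℂ)
                * ((Real.pi * y j : ℝ) : ℂ)
                    ^ (((m : ℂ) + 2 - ((j : ℕ) : ℂ)) * a 0 / ((m : ℂ) + 2))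
                * (t j : ℂ) ^ (((m : ℂ) + 3) * a 0 / (2 * ((m : ℂ) + 2))))
          * ((Real.pi * t (Fin.last (m + 1)) : ℝ) : ℂ) ^ (-(∑ i, a i) / 2)
          * ∏ j : Fin (m + 2), (t j : ℂ)⁻¹

/-- The integrand `Ŵ_{n,a}(α[y_1, …, y_{n-1}, 1]) ∏_j y_j^{s_j} / y_j` of the Mellin transform. -/
def mellinIntegrand (m : ℕ) (a : Fin (m + 2) → ℂ) (s : Fin (m + 1) → ℂ)
    (y : Fin (m + 1) → ℝ) : ℂ :=
  whittakerRadial m a y * ∏ j, ((y j : ℂ) ^ (s j) / (y j : ℂ))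

/-- The possible poles in the `j`-th variable (`1`-based index `j + 1`) of the Mellin transform:
the points `-(a_{i_1} + ⋯ + a_{i_{j+1}}) - 2k` with `i_1 < ⋯ < i_{j+1}` and `k = 0, 1, 2, …`. -/
def leftPoles (m : ℕ) (a : Fin (m + 2) → ℂ) (j : Fin (m + 1)) : Set ℂ :=
  {w | ∃ I : Finset (Fin (m + 2)), I.card = (j : ℕ) + 1 ∧
    ∃ k : ℕ, w = -(∑ i ∈ I, a i) - 2 * (k : ℂ)}

/-- The poles `c, c + 2, c + 4, …` of `z ↦ Γ_ℝ(c - z)`. -/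
def rightPoles (c : ℂ) : Set ℂ := {w | ∃ k : ℕ, w = c + 2 * (k : ℂ)}

/-- `F` is the Mellin transform of `y ↦ Ŵ_{n,a}(α[y_1, …, y_{n-1}, 1])`, continued analytically:
the Mellin integral converges absolutely and equals `F s` on the tube where
`Re (s_j + a_{i_1} + ⋯ + a_{i_j}) > 0` for all `j` and all `i_1 < ⋯ < i_j`, and `F` is holomorphic
on the complement of the polar hyperplanes (which is connected, so that `F` is unique there). -/
structure IsMellinContinuation (m : ℕ) (a : Fin (m + 2) → ℂ)
    (F : (Fin (m + 1) → ℂ) → ℂ) : Prop where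
  differentiableOn : DifferentiableOn ℂ F {s | ∀ j, s j ∉ leftPoles m a j}
  integrableOn : ∀ s : Fin (m + 1) → ℂ,
    (∀ (j : Fin (m + 1)) (I : Finset (Fin (m + 2))), I.card = (j : ℕ) + 1 →
      0 < (s j + ∑ i ∈ I, a i).re) →
    IntegrableOn (mellinIntegrand m a s) (posOrthant (m + 1))
  eq_integral : ∀ s : Fin (m + 1) → ℂ,
    (∀ (j : Fin (m + 1)) (I : Finset (Fin (m + 2))), I.card = (j : ℕ) + 1 →
      0 < (s j + ∑ i ∈ I, a i).re) →
    F s = ∫ y in posOrthant (m + 1), mellinIntegrand m a s y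

/-- `U_{n,a}(s_1, …, s_{n-1})`, `n = m + 2`: the (analytically continued) Mellin transform of the
radial part of the class one Whittaker function on `GL_n(ℝ)`. -/
def U (m : ℕ) (a : Fin (m + 2) → ℂ) : (Fin (m + 1) → ℂ) → ℂ :=
  Classical.epsilon (IsMellinContinuation m a)

/-- The point `w` lies off the path `γ` and to the left of it, for a path `γ` that runs upwards along
one vertical line near both ends: the argument of `γ(t) - w` increases by `π` in total. -/
def LiesLeft (γ : ℝ → ℂ) (w : ℂ) : Prop :=
  w ∉ Set.range γ ∧
    Tendsto (fun T : ℝ => ∫ t in (-T)..T, deriv γ t / (γ t - w)) atTop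
      (𝓝 (Real.pi * Complex.I))

/-- The point `w` lies off the path `γ` and to the right of it: the argument of `γ(t) - w`
decreases by `π` in total. -/
def LiesRight (γ : ℝ → ℂ) (w : ℂ) : Prop :=
  w ∉ Set.range γ ∧
    Tendsto (fun T : ℝ => ∫ t in (-T)..T, deriv γ t / (γ t - w)) atTop
      (𝓝 (-(Real.pi * Complex.I)))

/-- `γ` is an upward vertical line, indented within a bounded region so as to separate the points
of `L` (which lie to its left) from those of `R` (which lie to its right): a continuous, piecewise
`C¹` path which is `t ↦ c + i t` for `|t|` large. -/
structure IsBarnesContour (γ : ℝ → ℂ) (L R : Set ℂ) : Prop where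
  continuous : Continuous γ
  piecewise : ∃ S : Finset ℝ, (∀ t, t ∉ S → DifferentiableAt ℝ γ t) ∧
    ContinuousOn (deriv γ) {t | t ∉ S}
  bounded_deriv : ∃ K : ℝ, ∀ t, ‖deriv γ t‖ ≤ K
  vertical : ∃ c T : ℝ, ∀ t : ℝ, T ≤ |t| → γ t = (c : ℂ) + (t : ℂ) * Complex.I
  left : ∀ w ∈ L, LiesLeft γ w
  right : ∀ w ∈ R, LiesRight γ w

/-- The pull-back to `ℝ^k` of `f(q_1, …, q_k) dq_1 ⋯ dq_k` along the paths `q_j = γ_j(t_j)`. -/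
def contourIntegrand {k : ℕ} (γ : Fin k → ℝ → ℂ) (f : (Fin k → ℂ) → ℂ) (t : Fin k → ℝ) : ℂ :=
  f (fun j => γ j (t j)) * ∏ j, deriv (γ j) (t j)

/-- `∫_{q_1, …, q_k} f(q_1, …, q_k) dq_1 ⋯ dq_k` with `q_j` on the path `γ_j`. -/
def contourIntegral {k : ℕ} (γ : Fin k → ℝ → ℂ) (f : (Fin k → ℂ) → ℂ) : ℂ :=
  ∫ t : Fin k → ℝ, contourIntegrand γ f t

/-- `p_{j-1}` for `j = 1, …, n - 1`, with `p_0 = 0`. -/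
def prevP {m : ℕ} (p : Fin (m + 1) → ℂ) (j : Fin (m + 1)) : ℂ :=
  (Fin.cons 0 p : Fin (m + 2) → ℂ) j.castSucc

/-- `p_{j+1}` for `j = 1, …, n - 1`, with `p_n = -|a|`. -/
def nextP {m : ℕ} (a : Fin (m + 2) → ℂ) (p : Fin (m + 1) → ℂ) (j : Fin (m + 1)) : ℂ :=
  (Fin.snoc p (-∑ i, a i) : Fin (m + 2) → ℂ) j.succ

/-- `U_{n,a}(q) ∏_{j=1}^{n-1} Γ_ℝ(p_j - q_j) Γ_ℝ(p'_j - q_j + σ)`. -/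
def barnesIntegrand (m : ℕ) (a : Fin (m + 2) → ℂ) (σ : ℂ) (p p' q : Fin (m + 1) → ℂ) : ℂ :=
  U m a q * ∏ j, (Complex.Gammaℝ (p j - q j) * Complex.Gammaℝ (p' j - q j + σ))

end GLWhittaker

end

/-! Write `V_a = 2^(n-1) U_{n,a}` and `a' = (a_2, …, a_n)`. Everything rests on a recursion in the
rank: `V_a(s) = Γ_ℝ(s_1 + a_1) Γ_ℝ(s_{n-1} + |a'|) (4πi)^(-(n-2)) ∫ V_{a'}(w) ∏_j Γ_ℝ(s_j - w_j)
Γ_ℝ(s_{j+1} + a_1 - w_j) dw`. It is taken as a definition in `mellinBarnes`. It computes the Mellin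
transform because, in logarithmic coordinates, a triangular translation separates the integrations
in the recursion for the Whittaker function. All but two of the resulting factors are inverse Mellin
transforms of products of two gamma factors, and the two left over give the gamma factors in front
(`integral_logWhittaker`).

Formula (2) is proved by induction on the rank. On its right side, expand `V_a(q)` by the recursion
and integrate out each `q_j` by Barnes' first lemma. On its left side, expand `V_a(p)` by the
recursion, replace `V_{a'}` by formula (2) in lower rank with the same `σ`, and integrate out the
intermediate variables by Barnes' first lemma again. Both sides are now integrals of the same
`V_{a'}(w)` against products of gamma factors, and these agree by telescoping (`kernels_agree`).
This works on vertical lines when `σ` and the `p_j` have large real part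
(`exists_barnesIdentity_of_large`). The general case follows by analytic continuation in `t` along
`(σ + t, p + t)`, the exceptional `t` forming a closed countable set (`barnesIdentity_succ`).

Formula (1) is formula (2) for `-a`, through the symmetry `V_{-a}(s_{n-1} + |a|, …, s_1 + |a|) =
V_a(s)` (`mellinBarnes_neg`).

The continuation needs integrals over separating contours to be independent of the contour and
holomorphic in the parameters. Instead of moving an indented line with the parameters, a fixed cycle
is used: a vertical line far to the left together with small circles about the finitely many points
of `L` to its right (`IsLeftSet.exists_separates`). The same cycle serves a whole region of
parameters, and the residue theorem identifies it with any separating path (`Separates.int_eq`). The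
induction carries along that `V_a` is bounded on vertical strips away from its poles, so the decay
`1/(1 + (Im z)²)` of a single gamma factor per variable ensures convergence. -/

noncomputable section

namespace GLWhittaker

/-! ### Gamma integrals in logarithmic coordinates, Fourier inversion -/

open Complex in
theorem cexp_smul_exp_cpow (u : ℝ) (z : ℂ) :
    |Real.exp u| • ((Real.exp (-Real.exp u) : ℂ) * (Real.exp u : ℂ) ^ (z - 1)) =
      exp (-(Real.exp u : ℂ) + z * u) := by
  rw [abs_of_pos (Real.exp_pos u), real_smul, cpow_def_of_ne_zero (by simp), ← ofReal_log
    (Real.exp_pos u).le, Real.log_exp, ofReal_exp, ofReal_exp, ← exp_add, ← exp_add]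
  push_cast
  ring_nf

theorem integrable_exp_gamma {z : ℂ} (hz : 0 < z.re) :
    Integrable (fun u : ℝ => Complex.exp (-(Real.exp u : ℂ) + z * u)) := by
  have h := Complex.GammaIntegral_convergent hz
  rw [← Real.range_exp, ← Set.image_univ, integrableOn_image_iff_integrableOn_abs_deriv_smul
    MeasurableSet.univ (fun x _ => (Real.hasDerivAt_exp x).hasDerivWithinAt)
    Real.exp_injective.injOn] at h
  simp only [cexp_smul_exp_cpow] at h
  simpa using h

theorem integral_exp_gamma {z : ℂ} (hz : 0 < z.re) :
    ∫ u : ℝ, Complex.exp (-(Real.exp u : ℂ) + z * u) = Complex.Gamma z := by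
  rw [Complex.Gamma_eq_integral hz, Complex.GammaIntegral, ← Real.range_exp, ← Set.image_univ,
    integral_image_eq_integral_abs_deriv_smul
    MeasurableSet.univ (fun x _ => (Real.hasDerivAt_exp x).hasDerivWithinAt)
    Real.exp_injective.injOn]
  simp only [cexp_smul_exp_cpow, Measure.restrict_univ]

theorem integrable_exp_gamma_shift {z : ℂ} (hz : 0 < z.re) (b : ℝ) :
    Integrable (fun u : ℝ => Complex.exp (-(Real.exp (u + b) : ℂ) + z * u)) := by
  have := ((integrable_exp_gamma hz).comp_add_right b).mul_const (Complex.exp (-(z * b)))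
  refine this.congr (Eventually.of_forall fun u => ?_)
  simp only
  rw [← Complex.exp_add]
  push_cast
  ring_nf

theorem integral_exp_gamma_shift {z : ℂ} (hz : 0 < z.re) (b : ℝ) :
    ∫ u : ℝ, Complex.exp (-(Real.exp (u + b) : ℂ) + z * u) =
      Complex.exp (-(z * b)) * Complex.Gamma z := by
  rw [← integral_exp_gamma hz, ← integral_add_right_eq_self
    (fun u : ℝ => Complex.exp (-(Real.exp u : ℂ) + z * u)) b, ← integral_const_mul]
  congr 1
  ext u
  rw [← Complex.exp_add]
  push_cast
  ring_nf

/-- Fourier inversion for a convolution. -/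
theorem convolution_eq_inverse_fourier {f g F G : ℝ → ℂ} (hf : Integrable f) (hg : Integrable g)
    (hgc : Continuous g) {C : ℝ} (hC : ∀ x, ‖g x‖ ≤ C)
    (hF : ∀ t : ℝ, ∫ x : ℝ, f x * Complex.exp (Complex.I * t * x) = F t)
    (hG : ∀ t : ℝ, ∫ x : ℝ, g x * Complex.exp (Complex.I * t * x) = G t)
    (hFG : Integrable (fun t => F t * G t)) (y : ℝ) :
    ∫ x, f x * g (y - x) =
      (1 / (2 * Real.pi : ℂ)) * ∫ t : ℝ, F t * G t * Complex.exp (-(Complex.I * t * y)) := by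
  set h := convolution f g (ContinuousLinearMap.mul ℂ ℂ) volume with hh
  have hcont : Continuous h := BddAbove.continuous_convolution_right_of_integrable _
    ⟨C, by rintro _ ⟨x, rfl⟩; exact hC x⟩ hf hgc
  have hint : Integrable h := hf.integrable_convolution _ hg
  -- The Fourier kernel here is `exp(-2πi x ξ)`, so the transform at `ξ` is the value of `F` at
  -- `-2πξ`; the factor `1/(2π)` in the conclusion comes from undoing this rescaling.
  have aux : ∀ (f F : ℝ → ℂ), (∀ t : ℝ, ∫ x : ℝ, f x * Complex.exp (Complex.I * t * x) = F t) →
      ∀ ξ : ℝ, FourierTransform.fourier f ξ = F ((-(2 * Real.pi)) * ξ) := by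
    intro f F hF ξ
    rw [← hF, Real.fourier_real_eq_integral_exp_smul]
    congr 1
    ext x
    rw [smul_eq_mul, mul_comm]
    push_cast
    ring_nf
  have hfour : FourierTransform.fourier h =
      fun ξ : ℝ => F ((-(2 * Real.pi)) * ξ) * G ((-(2 * Real.pi)) * ξ) := by
    ext ξ
    rw [hh, Real.fourier_mul_convolution_eq hf hg, aux f F hF, aux g G hG]
  have hpi : (-(2 * Real.pi)) ≠ 0 := by simp [Real.pi_ne_zero]
  have hfi : Integrable (FourierTransform.fourier h) := by
    rw [hfour]
    exact hFG.comp_mul_left' hpi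
  have key := congrFun (hcont.fourierInv_fourier_eq hint hfi) y
  have h1 : h y = ∫ x, f x * g (y - x) := rfl
  rw [← h1, ← key, Real.fourierInv_eq', hfour]
  have h2 := Measure.integral_comp_mul_left
    (fun t : ℝ => F t * G t * Complex.exp (-(Complex.I * t * y))) (-(2 * Real.pi))
  have h3 : |(-(2 * Real.pi))⁻¹| = 1 / (2 * Real.pi) := by
    rw [inv_neg, abs_neg, abs_of_pos (by positivity)]; simp
  rw [h3, Complex.real_smul] at h2
  push_cast at h2
  rw [← h2]
  congr 1
  ext v
  rw [smul_eq_mul, mul_comm]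
  congr 1
  simp only [RCLike.inner_apply, conj_trivial]
  push_cast
  ring_nf

/-! ### Decay of the gamma function on vertical strips -/

/-- The decay rate `1 / (1 + (Im z)²)`. -/
def decay (z : ℂ) : ℝ := (1 + z.im ^ 2)⁻¹

theorem decay_pos (z : ℂ) : 0 < decay z := by unfold decay; positivity

theorem decay_le_one (z : ℂ) : decay z ≤ 1 := by
  unfold decay
  exact inv_le_one_of_one_le₀ (by nlinarith [sq_nonneg z.im])

theorem continuous_decay : Continuous decay := by
  unfold decay
  exact Continuous.inv₀ (by fun_prop) fun z => by positivity

/-- The modulus of the integrand of Euler's integral at `z` is the integrand at `Re z`. -/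
theorem norm_Gamma_le_Gamma_re {z : ℂ} (hz : 0 < z.re) :
    ‖Complex.Gamma z‖ ≤ Real.Gamma z.re := by
  have h : (Real.Gamma z.re : ℂ) = Complex.Gamma (z.re : ℂ) := (Complex.Gamma_ofReal _).symm
  rw [← integral_exp_gamma (z := (z.re : ℂ)) (by simpa using hz)] at h
  have e : ∀ u : ℝ, Complex.exp (-(Real.exp u : ℂ) + (z.re : ℂ) * u) =
      ((‖Complex.exp (-(Real.exp u : ℂ) + z * u)‖ : ℝ) : ℂ) := by
    intro u
    rw [Complex.norm_exp, Complex.add_re, Complex.neg_re, Complex.ofReal_re,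
      Complex.re_mul_ofReal]
    push_cast
    rfl
  simp only [e] at h
  rw [integral_complex_ofReal] at h
  rw [Complex.ofReal_inj.mp h, ← integral_exp_gamma hz]
  exact norm_integral_le_integral_norm _

theorem Gamma_add_nat_eq_prod (N : ℕ) {z : ℂ} (hz : ∀ m : ℕ, z ≠ -m) :
    Complex.Gamma (z + N) = Complex.Gamma z * ∏ i ∈ Finset.range N, (z + i) := by
  induction N with
  | zero => simp
  | succ N ih =>
    rw [Finset.prod_range_succ, ← mul_assoc, ← ih]
    push_cast
    rw [← add_assoc, Complex.Gamma_add_one _ (fun h => hz N (eq_neg_of_add_eq_zero_left h)), mul_comm]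

/-- `Γ` decays on vertical strips, uniformly away from its poles. -/
theorem exists_norm_Gamma_le (x : ℝ) {ε : ℝ} (hε : 0 < ε) :
    ∃ C, 0 ≤ C ∧ ∀ z : ℂ, |z.re| ≤ x → (∀ m : ℕ, ε ≤ ‖z + m‖) → ‖Complex.Gamma z‖ ≤ C * decay z := by
  obtain ⟨N0, hN0⟩ := exists_nat_ge (x + 1)
  -- The strip is shifted to `Re ≥ 1`, where `Γ` is bounded, and the shift is undone by dividing by
  -- `N` linear factors. Each of them grows like `(1 + (Im z)²)^(1/2)`, so at least two are needed
  -- for the rate `1/(1 + (Im z)²)`; the growth of the others is discarded.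
  set N := N0 + 2 with hN
  have hNx : x + 1 ≤ N := by push_cast [hN]; linarith
  have hcomp : IsCompact (Set.Icc (1 : ℝ) (x + N)) := isCompact_Icc
  obtain ⟨C0, hC0⟩ := hcomp.exists_bound_of_continuousOn (f := Real.Gamma) (by
    intro t ht
    refine (Real.differentiableAt_Gamma fun m => ?_).continuousAt.continuousWithinAt
    have := ht.1
    have : (0 : ℝ) ≤ m := by positivity
    linarith)
  -- Averaging `‖z + m‖² ≥ ε²` and `‖z + m‖² ≥ (Im z)²` gives `‖z + m‖² ≥ δ (1 + (Im z)²)`.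
  set δ : ℝ := min 1 (ε ^ 2) / 2 with hδ
  have hδpos : 0 < δ := by positivity
  refine ⟨|C0| / (min δ 1) ^ N, by positivity, fun z hz hzp => ?_⟩
  have habs := abs_le.mp hz
  have hpole : ∀ m : ℕ, z ≠ -m := by
    intro m h
    have := hzp m
    rw [h] at this
    simp at this
    linarith
  have h1 := Gamma_add_nat_eq_prod N hpole
  have h2 : ‖Complex.Gamma (z + N)‖ ≤ |C0| := by
    have hre : (z + N).re = z.re + N := by simp
    have hpos : 1 ≤ (z + N).re := by rw [hre]; linarith
    refine (norm_Gamma_le_Gamma_re (by linarith)).trans ?_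
    refine (le_abs_self _).trans ((hC0 _ ⟨hpos, ?_⟩).trans (le_abs_self _))
    rw [hre]; linarith
  set D : ℝ := 1 + z.im ^ 2 with hD
  have hD1 : 1 ≤ D := by nlinarith [sq_nonneg z.im]
  have h3 : ∀ m : ℕ, min δ 1 * D ≤ ‖z + m‖ ^ 2 := by
    intro m
    have a1 : ε ^ 2 ≤ ‖z + m‖ ^ 2 := by have := hzp m; gcongr
    have a2 : z.im ^ 2 ≤ ‖z + m‖ ^ 2 := by
      rw [← Complex.normSq_eq_norm_sq, Complex.normSq_apply]
      have : (z + m).im = z.im := by simp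
      rw [this]; nlinarith [mul_self_nonneg (z + m).re]
    have a3 : min δ 1 ≤ δ := min_le_left _ _
    have a4 : min 1 (ε ^ 2) ≤ 1 := min_le_left _ _
    have a5 : min 1 (ε ^ 2) ≤ ε ^ 2 := min_le_right _ _
    have : δ * D ≤ ‖z + m‖ ^ 2 := by
      rw [hδ, hD]; nlinarith [sq_nonneg z.im]
    nlinarith
  have h4 : ((min δ 1) ^ N * D) ^ 2 ≤ ‖∏ i ∈ Finset.range N, (z + i)‖ ^ 2 := by
    rw [norm_prod, ← Finset.prod_pow]
    calc ((min δ 1) ^ N * D) ^ 2 = ((min δ 1) ^ N * D ^ 2) * (min δ 1) ^ N := by ring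
      _ ≤ ((min δ 1) ^ N * D ^ N) * 1 := by
          gcongr ?_ * ?_ * ?_
          · exact pow_le_pow_right₀ hD1 (by omega)
          · exact pow_le_one₀ (by positivity) (min_le_right _ _)
      _ = ∏ i ∈ Finset.range N, (min δ 1 * D) := by
          rw [Finset.prod_const, Finset.card_range, mul_pow, mul_one]
      _ ≤ _ := Finset.prod_le_prod (fun i _ => by positivity) fun i _ => h3 i
  have h5 : (min δ 1) ^ N * D ≤ ‖∏ i ∈ Finset.range N, (z + i)‖ :=
    (sq_le_sq₀ (by positivity) (norm_nonneg _)).mp h4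
  have h6 : ‖Complex.Gamma z‖ * ((min δ 1) ^ N * D) ≤ |C0| := by
    refine le_trans ?_ h2
    rw [h1, norm_mul]
    gcongr
  have h7 : 0 < (min δ 1) ^ N := by positivity
  unfold decay
  rw [← hD, ← div_eq_mul_inv, div_div, le_div_iff₀ (by positivity)]
  exact h6

theorem exists_norm_Gammaℝ_le (x : ℝ) {ε : ℝ} (hε : 0 < ε) :
    ∃ C, 0 ≤ C ∧ ∀ z : ℂ, |z.re| ≤ x → (∀ m : ℕ, ε ≤ ‖z + 2 * m‖) →
      ‖Complex.Gammaℝ z‖ ≤ C * decay z := by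
  obtain ⟨C, hC0, hC⟩ := exists_norm_Gamma_le (x / 2) (half_pos hε)
  refine ⟨Real.pi ^ (x / 2) * (C * 4), by positivity, fun z hz hzp => ?_⟩
  have h1 : ‖Complex.Gamma (z / 2)‖ ≤ C * decay (z / 2) := by
    refine hC _ ?_ fun m => ?_
    · simp only [Complex.div_ofNat_re, abs_div, abs_two]; linarith
    · have : z / 2 + m = (z + 2 * m) / 2 := by ring
      rw [this, norm_div, RCLike.norm_ofNat]
      have := hzp m
      linarith
  have h2 : decay (z / 2) ≤ 4 * decay z := by
    unfold decay
    rw [← div_eq_mul_inv, inv_eq_one_div, div_le_div_iff₀ (by positivity) (by positivity)]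
    simp only [Complex.div_ofNat_im]
    nlinarith [sq_nonneg z.im]
  have h3 : ‖(Real.pi : ℂ) ^ (-z / 2)‖ ≤ Real.pi ^ (x / 2) := by
    rw [Complex.norm_cpow_eq_rpow_re_of_pos Real.pi_pos]
    refine Real.rpow_le_rpow_of_exponent_le (by linarith [Real.pi_gt_three]) ?_
    simp only [Complex.div_ofNat_re, Complex.neg_re]
    linarith [abs_le.mp hz]
  rw [Complex.Gammaℝ_def, norm_mul]
  calc _ ≤ Real.pi ^ (x / 2) * (C * (4 * decay z)) := by gcongr; exact h1.trans (by gcongr)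
    _ = _ := by ring

/-- The reciprocal of `Γ_ℝ` is entire, and it is nonzero at the points considered. -/
theorem differentiableAt_Gammaℝ {z : ℂ} (hz : ∀ m : ℕ, z ≠ -(2 * m)) :
    DifferentiableAt ℂ Complex.Gammaℝ z := by
  have h : Complex.Gammaℝ z ≠ 0 := by
    rw [Ne, Complex.Gammaℝ_eq_zero_iff]
    rintro ⟨m, hm⟩
    exact hz m hm
  have := (Complex.differentiable_Gammaℝ_inv z).fun_inv (inv_ne_zero h)
  simpa only [inv_inv] using this

/-! ### The beta integral, Barnes' first lemma, the inverse Mellin kernel -/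

theorem exists_bound_exp_gamma {z : ℂ} (hz : 0 < z.re) (b : ℝ) :
    ∃ C, ∀ u : ℝ, ‖Complex.exp (-(Real.exp (u + b) : ℂ) + z * u)‖ ≤ C := by
  -- The real part `Re z · u - e^(u + b)` of the exponent is largest where `u + b = log (Re z)`.
  refine ⟨Real.exp (z.re * (Real.log z.re - b) - z.re), fun u => ?_⟩
  rw [Complex.norm_exp, Complex.add_re, Complex.neg_re, Complex.ofReal_re, Complex.re_mul_ofReal]
  refine Real.exp_le_exp.mpr ?_
  have h := Real.add_one_le_exp (u + b - Real.log z.re)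
  rw [Real.exp_sub, Real.exp_log hz, le_div_iff₀ hz] at h
  nlinarith

theorem continuous_exp_gamma (z : ℂ) (b : ℝ) :
    Continuous fun u : ℝ => Complex.exp (-(Real.exp (u + b) : ℂ) + z * u) := by
  fun_prop

/-- The integrand of the beta integral in logarithmic coordinates. -/
def betaExp (α γ : ℂ) (τ : ℝ) : ℂ :=
  Complex.exp (α * τ - (α + γ) * (Real.log (1 + Real.exp τ) : ℂ))

theorem continuous_betaExp (α γ : ℂ) : Continuous (betaExp α γ) := by
  have h : Continuous fun τ : ℝ => Real.log (1 + Real.exp τ) :=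
    Continuous.log (by fun_prop) fun τ => by positivity
  unfold betaExp
  fun_prop

/-- The power `(1 + e^τ)^(-α-γ)` times `Γ(α + γ)` is a gamma integral with a shifted variable, and
that integral is a convolution of two gamma densities. Integrability and the value of the beta
integral then follow from general facts on convolutions. -/
theorem Gamma_mul_betaExp {α γ : ℂ} (hα : 0 < α.re) (hγ : 0 < γ.re) :
    (fun τ => Complex.Gamma (α + γ) * betaExp α γ τ) =
      convolution (fun w : ℝ => Complex.exp (-(Real.exp (-w) : ℂ) + γ * (-w : ℝ)))
        (fun u : ℝ => Complex.exp (-(Real.exp u : ℂ) + α * u))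
        (ContinuousLinearMap.mul ℂ ℂ) volume := by
  ext τ
  have h : convolution (fun w : ℝ => Complex.exp (-(Real.exp (-w) : ℂ) + γ * (-w : ℝ)))
        (fun u : ℝ => Complex.exp (-(Real.exp u : ℂ) + α * u))
        (ContinuousLinearMap.mul ℂ ℂ) volume τ =
      ∫ w : ℝ, Complex.exp (-(Real.exp (-w) : ℂ) + γ * (-w : ℝ)) *
        Complex.exp (-(Real.exp (τ - w) : ℂ) + α * (τ - w : ℝ)) := rfl
  rw [h, ← integral_neg_eq_self]
  have e : ∀ w : ℝ, Complex.exp (-(Real.exp (- -w) : ℂ) + γ * (- -w : ℝ)) *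
        Complex.exp (-(Real.exp (τ - -w) : ℂ) + α * (τ - -w : ℝ)) = Complex.exp (α * τ) *
        Complex.exp (-(Real.exp (w + Real.log (1 + Real.exp τ)) : ℂ) + (α + γ) * w) := by
    intro w
    rw [← Complex.exp_add, ← Complex.exp_add, Real.exp_add w, Real.exp_log (by positivity), neg_neg,
      sub_neg_eq_add, Real.exp_add]
    push_cast
    ring_nf
  simp only [e]
  rw [integral_const_mul, integral_exp_gamma_shift (by simp; linarith), betaExp, sub_eq_add_neg,
    Complex.exp_add]
  ring

theorem Gamma_ne_zero_of_re_pos' {z : ℂ} (hz : 0 < z.re) : Complex.Gamma z ≠ 0 :=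
  Complex.Gamma_ne_zero_of_re_pos hz

theorem integrable_exp_gamma_neg {γ : ℂ} (hγ : 0 < γ.re) :
    Integrable (fun w : ℝ => Complex.exp (-(Real.exp (-w) : ℂ) + γ * (-w : ℝ))) :=
  (integrable_exp_gamma hγ).comp_neg

theorem integrable_betaExp {α γ : ℂ} (hα : 0 < α.re) (hγ : 0 < γ.re) :
    Integrable (betaExp α γ) := by
  have h := (integrable_exp_gamma_neg hγ).integrable_convolution (ContinuousLinearMap.mul ℂ ℂ)
    (integrable_exp_gamma hα)
  rw [← Gamma_mul_betaExp hα hγ] at h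
  have hne : Complex.Gamma (α + γ) ≠ 0 := Gamma_ne_zero_of_re_pos' (by simp; linarith)
  refine (h.const_mul (Complex.Gamma (α + γ))⁻¹).congr (Eventually.of_forall fun τ => ?_)
  simp only
  rw [inv_mul_cancel_left₀ hne]

theorem integral_betaExp {α γ : ℂ} (hα : 0 < α.re) (hγ : 0 < γ.re) :
    ∫ τ, betaExp α γ τ = Complex.Gamma α * Complex.Gamma γ / Complex.Gamma (α + γ) := by
  have hne : Complex.Gamma (α + γ) ≠ 0 := Gamma_ne_zero_of_re_pos' (by simp; linarith)
  rw [eq_div_iff hne, mul_comm, ← integral_const_mul, Gamma_mul_betaExp hα hγ,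
    integral_convolution _ (integrable_exp_gamma_neg hγ) (integrable_exp_gamma hα),
    integral_exp_gamma hα,
    integral_neg_eq_self (fun w : ℝ => Complex.exp (-(Real.exp w : ℂ) + γ * (w : ℝ))),
    integral_exp_gamma hγ, ContinuousLinearMap.mul_apply', mul_comm]

theorem norm_betaExp_le {α γ : ℂ} (hα : 0 < α.re) (hγ : 0 < γ.re) (τ : ℝ) :
    ‖betaExp α γ τ‖ ≤ 1 := by
  have hl : 0 ≤ Real.log (1 + Real.exp τ) :=
    Real.log_nonneg (by linarith [Real.exp_pos τ])
  have hl2 : τ ≤ Real.log (1 + Real.exp τ) := by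
    rw [Real.le_log_iff_exp_le (by positivity)]; linarith
  rw [betaExp, Complex.norm_exp, Real.exp_le_one_iff, Complex.sub_re, Complex.re_mul_ofReal,
    Complex.re_mul_ofReal, Complex.add_re]
  nlinarith

/-- Hence the Fourier transform of such a function is a beta integral with shifted parameters. -/
theorem betaExp_mul_exp (α γ : ℂ) (t τ : ℝ) :
    betaExp α γ τ * Complex.exp (Complex.I * t * τ) =
      betaExp (α + t * Complex.I) (γ - t * Complex.I) τ := by
  rw [betaExp, betaExp, ← Complex.exp_add]
  ring_nf

/-- Since `1 + e^(-τ) = (1 + e^τ) e^(-τ)`, the family is closed under this product. The convolution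
at `0` of two of its members is therefore again a beta integral, which is what makes Barnes'
integral computable. -/
theorem betaExp_mul_betaExp_neg (α β γ δ : ℂ) (τ : ℝ) :
    betaExp α γ τ * betaExp β δ (0 - τ) = betaExp (α + δ) (β + γ) τ := by
  have h : Real.log (1 + Real.exp (0 - τ)) = Real.log (1 + Real.exp τ) - τ := by
    have : 1 + Real.exp (0 - τ) = (1 + Real.exp τ) / Real.exp τ := by
      rw [zero_sub, Real.exp_neg]; field_simp; ring
    rw [this, Real.log_div (by positivity) (by positivity), Real.log_exp]
  rw [betaExp, betaExp, betaExp, ← Complex.exp_add, h]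
  push_cast
  ring_nf

theorem continuous_Gammaℝ_vertical {z : ℂ} (hz : 0 < z.re) :
    Continuous fun t : ℝ => Complex.Gammaℝ (z - t * Complex.I) := by
  rw [continuous_iff_continuousAt]
  intro t
  refine ContinuousAt.comp (f := fun t : ℝ => z - t * Complex.I) (g := Complex.Gammaℝ)
    (differentiableAt_Gammaℝ fun m h => ?_).continuousAt (by fun_prop)
  have := congrArg Complex.re h
  simp at this
  have : (0 : ℝ) ≤ m := by positivity
  linarith

theorem exists_norm_Gammaℝ_vertical_le {z : ℂ} (hz : 0 < z.re) :
    ∃ C, 0 ≤ C ∧ ∀ t : ℝ, ‖Complex.Gammaℝ (z - t * Complex.I)‖ ≤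
      C * decay (z - t * Complex.I) := by
  obtain ⟨C, hC0, hC⟩ := exists_norm_Gammaℝ_le z.re hz
  refine ⟨C, hC0, fun t => hC _ (by simp [abs_of_pos hz]) fun m => ?_⟩
  refine le_trans ?_ (Complex.re_le_norm _)
  simp

theorem integrable_decay_vertical (z : ℂ) :
    Integrable fun t : ℝ => decay (z - t * Complex.I) := by
  have := integrable_inv_one_add_sq.comp_sub_left z.im
  simpa [decay] using this

theorem integrable_Gammaℝ_vertical {z : ℂ} (hz : 0 < z.re) :
    Integrable fun t : ℝ => Complex.Gammaℝ (z - t * Complex.I) := by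
  obtain ⟨C, hC0, hC⟩ := exists_norm_Gammaℝ_vertical_le hz
  exact ((integrable_decay_vertical z).const_mul C).mono'
    (continuous_Gammaℝ_vertical hz).aestronglyMeasurable (Eventually.of_forall hC)

theorem exists_norm_Gammaℝ_vertical_le_const {z : ℂ} (hz : 0 < z.re) :
    ∃ C, 0 ≤ C ∧ ∀ t : ℝ, ‖Complex.Gammaℝ (z - t * Complex.I)‖ ≤ C := by
  obtain ⟨C, hC0, hC⟩ := exists_norm_Gammaℝ_vertical_le hz
  exact ⟨C, hC0, fun t => (hC t).trans (mul_le_of_le_one_right hC0 (decay_le_one _))⟩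

theorem integrable_Gammaℝ_mul_Gammaℝ_vertical {z w : ℂ} (hz : 0 < z.re) (hw : 0 < w.re) :
    Integrable fun t : ℝ =>
      Complex.Gammaℝ (z - t * Complex.I) * Complex.Gammaℝ (w - t * Complex.I) := by
  obtain ⟨C, hC0, hC⟩ := exists_norm_Gammaℝ_vertical_le_const hw
  exact (integrable_Gammaℝ_vertical hz).mul_bdd (c := C)
    (continuous_Gammaℝ_vertical hw).aestronglyMeasurable (Eventually.of_forall hC)

theorem pi_cpow_mul_Gammaℝ (z : ℂ) :
    (Real.pi : ℂ) ^ (z / 2) * Complex.Gammaℝ z = Complex.Gamma (z / 2) := by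
  rw [Complex.Gammaℝ_def, ← mul_assoc, ← Complex.cpow_add _ _ (by simp [Real.pi_ne_zero])]
  ring_nf
  simp

/-- Barnes' first lemma. -/
theorem barnes_first_lemma {α β γ δ : ℂ} (hα : 0 < α.re) (hβ : 0 < β.re) (hγ : 0 < γ.re)
    (hδ : 0 < δ.re) :
    ∫ t : ℝ, Complex.Gammaℝ (α + t * Complex.I) * Complex.Gammaℝ (β + t * Complex.I) *
        (Complex.Gammaℝ (γ - t * Complex.I) * Complex.Gammaℝ (δ - t * Complex.I)) =
      4 * Real.pi * (Complex.Gammaℝ (α + γ) * Complex.Gammaℝ (α + δ) * Complex.Gammaℝ (β + γ) *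
        Complex.Gammaℝ (β + δ) / Complex.Gammaℝ (α + β + γ + δ)) := by
  have h2 : ∀ z : ℂ, 0 < z.re → 0 < (z / 2).re := fun z hz => by
    simp only [Complex.div_ofNat_re]; linarith
  have hpi : (Real.pi : ℂ) ≠ 0 := by simp [Real.pi_ne_zero]
  have hpc : ∀ z : ℂ, (Real.pi : ℂ) ^ z ≠ 0 := fun z h => hpi ((Complex.cpow_eq_zero_iff _ _).mp h).1
  have hGne : ∀ z : ℂ, 0 < z.re → Complex.Gamma z ≠ 0 := fun z => Gamma_ne_zero_of_re_pos'
  have hα' := h2 _ hα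
  have hβ' := h2 _ hβ
  have hγ' := h2 _ hγ
  have hδ' := h2 _ hδ
  have hsum : ∀ {z w : ℂ}, 0 < z.re → 0 < w.re → 0 < (z + w).re := fun hz hw => by
    rw [Complex.add_re]; linarith
  -- The powers of `π` relating `Γ_ℝ(z)` to `Γ(z/2)` multiply to the constant `K`, because the
  -- imaginary shifts `± it` cancel among the four factors.
  set K : ℂ := (Real.pi : ℂ) ^ ((α + β + γ + δ) / 2) with hK
  set D : ℂ := Complex.Gamma (α / 2 + γ / 2) * Complex.Gamma (β / 2 + δ / 2) with hD
  have hDne : D ≠ 0 := mul_ne_zero (hGne _ (hsum hα' hγ')) (hGne _ (hsum hβ' hδ'))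
  have hFT : ∀ a c : ℂ, 0 < a.re → 0 < c.re → ∀ t : ℝ,
      ∫ x : ℝ, betaExp a c x * Complex.exp (Complex.I * t * x) =
        Complex.Gamma (a + t * Complex.I) * Complex.Gamma (c - t * Complex.I) /
          Complex.Gamma (a + c) := by
    intro a c ha hc t
    simp only [betaExp_mul_exp]
    rw [integral_betaExp (by simpa using ha) (by simpa using hc)]
    ring_nf
  have hprod : ∀ t : ℝ,
      Complex.Gamma (α / 2 + t * Complex.I) * Complex.Gamma (γ / 2 - t * Complex.I) /
        Complex.Gamma (α / 2 + γ / 2) *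
      (Complex.Gamma (β / 2 + t * Complex.I) * Complex.Gamma (δ / 2 - t * Complex.I) /
        Complex.Gamma (β / 2 + δ / 2)) = (K / D) *
      (Complex.Gammaℝ (α + (2 * t : ℝ) * Complex.I) * Complex.Gammaℝ (β + (2 * t : ℝ) * Complex.I) *
        (Complex.Gammaℝ (γ - (2 * t : ℝ) * Complex.I) *
          Complex.Gammaℝ (δ - (2 * t : ℝ) * Complex.I))) := by
    intro t
    have e1 : ∀ z : ℂ, z / 2 + t * Complex.I = (z + (2 * t : ℝ) * Complex.I) / 2 := fun z => by
      push_cast; ring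
    have e2 : ∀ z : ℂ, z / 2 - t * Complex.I = (z - (2 * t : ℝ) * Complex.I) / 2 := fun z => by
      push_cast; ring
    rw [e1, e1, e2, e2, ← pi_cpow_mul_Gammaℝ, ← pi_cpow_mul_Gammaℝ, ← pi_cpow_mul_Gammaℝ,
      ← pi_cpow_mul_Gammaℝ]
    have e3 : K = (Real.pi : ℂ) ^ ((α + (2 * t : ℝ) * Complex.I) / 2) *
        (Real.pi : ℂ) ^ ((γ - (2 * t : ℝ) * Complex.I) / 2) *
        (Real.pi : ℂ) ^ ((β + (2 * t : ℝ) * Complex.I) / 2) *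
        (Real.pi : ℂ) ^ ((δ - (2 * t : ℝ) * Complex.I) / 2) := by
      rw [← Complex.cpow_add _ _ hpi, ← Complex.cpow_add _ _ hpi, ← Complex.cpow_add _ _ hpi, hK]
      congr 1
      ring
    rw [e3, hD]
    field_simp
  have hint0 : Integrable fun t : ℝ =>
      Complex.Gammaℝ (α + t * Complex.I) * Complex.Gammaℝ (β + t * Complex.I) *
        (Complex.Gammaℝ (γ - t * Complex.I) * Complex.Gammaℝ (δ - t * Complex.I)) := by
    have hr : ∀ {z : ℂ}, 0 < z.re → ∃ C, 0 ≤ C ∧ ∀ t : ℝ,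
        ‖Complex.Gammaℝ (z + t * Complex.I)‖ ≤ C := fun {z} hz => by
      obtain ⟨C, hC0, hC⟩ := exists_norm_Gammaℝ_vertical_le_const hz
      refine ⟨C, hC0, fun t => ?_⟩
      have := hC (-t)
      simpa using this
    have hrc : ∀ {z : ℂ}, 0 < z.re → Continuous fun t : ℝ =>
        Complex.Gammaℝ (z + t * Complex.I) := fun {z} hz => by
      have := (continuous_Gammaℝ_vertical hz).comp continuous_neg
      simpa [Function.comp_def] using this
    obtain ⟨C1, hC10, hC1⟩ := hr hα
    obtain ⟨C2, hC20, hC2⟩ := hr hβ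
    refine (integrable_Gammaℝ_mul_Gammaℝ_vertical hγ hδ).bdd_mul (c := C1 * C2)
      ((hrc hα).mul (hrc hβ)).aestronglyMeasurable (Eventually.of_forall fun t => ?_)
    rw [norm_mul]
    gcongr
    · exact hC1 t
    · exact hC2 t
  have hint1 := (hint0.comp_mul_left' (two_ne_zero' ℝ)).const_mul (K / D)
  -- Inversion is evaluated at `y = 0`: the left side is a single beta integral, the right side is
  -- Barnes' integral in the variable `2t`.
  have key := convolution_eq_inverse_fourier (integrable_betaExp hα' hγ')
    (integrable_betaExp hβ' hδ') (continuous_betaExp _ _) (norm_betaExp_le hβ' hδ')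
    (hFT _ _ hα' hγ') (hFT _ _ hβ' hδ') (by simp only [hprod]; exact hint1) 0
  simp only [betaExp_mul_betaExp_neg, hprod, Complex.ofReal_zero, mul_zero, neg_zero,
    Complex.exp_zero, mul_one] at key
  rw [integral_betaExp (hsum hα' hδ') (hsum hβ' hγ'), integral_const_mul,
    Measure.integral_comp_mul_left (fun t : ℝ =>
      Complex.Gammaℝ (α + t * Complex.I) * Complex.Gammaℝ (β + t * Complex.I) *
        (Complex.Gammaℝ (γ - t * Complex.I) * Complex.Gammaℝ (δ - t * Complex.I))) 2] at key
  set J := ∫ t : ℝ, Complex.Gammaℝ (α + t * Complex.I) * Complex.Gammaℝ (β + t * Complex.I) *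
        (Complex.Gammaℝ (γ - t * Complex.I) * Complex.Gammaℝ (δ - t * Complex.I))
  have hS : 0 < ((α + β + γ + δ) / 2).re := by
    simp only [Complex.div_ofNat_re, Complex.add_re]; linarith
  have e4 : ∀ z w : ℂ, (Real.pi : ℂ) ^ ((z + w) / 2) * Complex.Gammaℝ (z + w) =
      Complex.Gamma (z / 2 + w / 2) := fun z w => by
    rw [pi_cpow_mul_Gammaℝ]; congr 1; ring
  have hR : Complex.Gamma (α / 2 + δ / 2) * Complex.Gamma (β / 2 + γ / 2) /
      Complex.Gamma (α / 2 + δ / 2 + (β / 2 + γ / 2)) * D = K * (Complex.Gammaℝ (α + γ) *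
        Complex.Gammaℝ (α + δ) * Complex.Gammaℝ (β + γ) *
        Complex.Gammaℝ (β + δ) / Complex.Gammaℝ (α + β + γ + δ)) := by
    have e5 : α / 2 + δ / 2 + (β / 2 + γ / 2) = (α + β + γ + δ) / 2 := by ring
    have e6 : K * K = (Real.pi : ℂ) ^ ((α + γ) / 2) * (Real.pi : ℂ) ^ ((α + δ) / 2) *
        (Real.pi : ℂ) ^ ((β + γ) / 2) * (Real.pi : ℂ) ^ ((β + δ) / 2) := by
      rw [hK]
      simp only [← Complex.cpow_add _ _ hpi]
      congr 1
      ring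
    have hne : Complex.Gammaℝ (α + β + γ + δ) ≠ 0 := Complex.Gammaℝ_ne_zero_of_re_pos (by
      simp only [Complex.add_re]; linarith)
    rw [hD, e5, ← e4, ← e4, ← e4, ← e4, ← pi_cpow_mul_Gammaℝ, ← hK]
    have hKne : K ≠ 0 := hpc _
    field_simp
    rw [pow_two, e6]
    ring
  rw [Complex.real_smul] at key
  have h3 : J = (4 * Real.pi) * (Complex.Gamma (α / 2 + δ / 2) * Complex.Gamma (β / 2 + γ / 2) /
      Complex.Gamma (α / 2 + δ / 2 + (β / 2 + γ / 2)) * D) / K := by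
    rw [key]
    have hKne : K ≠ 0 := hpc _
    have h4 : ((|(2 : ℝ)⁻¹| : ℝ) : ℂ) = 1 / 2 := by
      rw [abs_of_pos (by norm_num)]; push_cast; norm_num
    rw [h4]
    field_simp
    ring
  rw [h3, hR]
  have hKne : K ≠ 0 := hpc _
  field_simp

/-- The inverse Mellin transform of a product of two gamma factors. -/
theorem kernel_eq_inverse_mellin {β δ : ℂ} (hβ : 0 < β.re) (hδ : 0 < δ.re) (x : ℝ) :
    ∫ τ : ℝ, Complex.exp (-(Real.exp (-τ) : ℂ) - (Real.pi ^ 2 * Real.exp (2 * x + τ) : ℝ) +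
        β * (x + τ / 2 : ℝ) - δ * (τ / 2 : ℝ)) =
      (Real.pi : ℂ) ^ ((δ - β) / 2) * (1 / (4 * Real.pi)) *
        ∫ t : ℝ, Complex.Gammaℝ (δ - t * Complex.I) * Complex.Gammaℝ (β - t * Complex.I) *
          Complex.exp (t * Complex.I * x) := by
  have h2 : ∀ z : ℂ, 0 < z.re → 0 < (z / 2).re := fun z hz => by
    simp only [Complex.div_ofNat_re]; linarith
  have hpi : (Real.pi : ℂ) ≠ 0 := by simp [Real.pi_ne_zero]
  -- The shift by `b` produces the factor `π²` in the exponent.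
  set b : ℝ := 2 * Real.log Real.pi with hb
  have hbpi : ∀ u : ℝ, Real.exp (u + b) = Real.pi ^ 2 * Real.exp u := fun u => by
    rw [Real.exp_add, hb, two_mul (Real.log _), Real.exp_add, Real.exp_log Real.pi_pos]; ring
  set f : ℝ → ℂ := fun v => 2 * Complex.exp (-(Real.exp (2 * v + 0) : ℂ) + δ / 2 * (2 * v : ℝ))
  set g : ℝ → ℂ := fun v => Complex.exp (-(Real.exp (2 * v + b) : ℂ) + β / 2 * (2 * v : ℝ))
  have hf : Integrable f :=
    ((integrable_exp_gamma_shift (h2 _ hδ) 0).comp_mul_left' two_ne_zero).const_mul 2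
  have hg : Integrable g := (integrable_exp_gamma_shift (h2 _ hβ) b).comp_mul_left' two_ne_zero
  have hgc : Continuous g := (continuous_exp_gamma (β / 2) b).comp (continuous_const.mul continuous_id)
  obtain ⟨C, hC⟩ := exists_bound_exp_gamma (h2 _ hβ) b
  have hFT : ∀ z : ℂ, 0 < z.re → ∀ (c t : ℝ), ∫ v : ℝ, Complex.exp (-(Real.exp (2 * v + c) : ℂ) +
      z / 2 * (2 * v : ℝ)) * Complex.exp (Complex.I * t * v) =
      1 / 2 * (Complex.exp (-((z + t * Complex.I) / 2 * c)) *
        Complex.Gamma ((z + t * Complex.I) / 2)) := by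
    intro z hz c t
    have e : ∀ v : ℝ, Complex.exp (-(Real.exp (2 * v + c) : ℂ) +
      z / 2 * (2 * v : ℝ)) * Complex.exp (Complex.I * t * v) = Complex.exp (-(Real.exp (2 * v + c) : ℂ) +
      ((z + t * Complex.I) / 2) * (2 * v : ℝ)) := by
      intro v
      rw [← Complex.exp_add]
      push_cast
      ring_nf
    simp only [e]
    rw [Measure.integral_comp_mul_left (fun v : ℝ => Complex.exp (-(Real.exp (v + c) : ℂ) +
      ((z + t * Complex.I) / 2) * (v : ℝ))) 2, integral_exp_gamma_shift (h2 _ (by simpa using hz)),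
      Complex.real_smul, abs_of_pos (by norm_num)]
    push_cast
    norm_num
  set W : ℂ := (Real.pi : ℂ) ^ ((δ - β) / 2) with hW
  have hprod : ∀ t : ℝ, Complex.Gamma ((δ + t * Complex.I) / 2) *
      (1 / 2 * (Complex.exp (-((β + t * Complex.I) / 2 * b)) *
        Complex.Gamma ((β + t * Complex.I) / 2))) = (W / 2) *
      (Complex.Gammaℝ (δ - (-t : ℝ) * Complex.I) * Complex.Gammaℝ (β - (-t : ℝ) * Complex.I)) := by
    intro t
    have e1 : ∀ z : ℂ, z - (-t : ℝ) * Complex.I = z + t * Complex.I := fun z => by push_cast; ring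
    have e2 : Complex.exp (-((β + t * Complex.I) / 2 * b)) = (Real.pi : ℂ) ^ (-(β + t * Complex.I)) := by
      rw [Complex.cpow_def_of_ne_zero hpi, ← Complex.ofReal_log Real.pi_pos.le, hb]
      push_cast
      ring_nf
    have e3 : W = (Real.pi : ℂ) ^ ((δ + t * Complex.I) / 2) * ((Real.pi : ℂ) ^ (-(β + t * Complex.I)) *
        (Real.pi : ℂ) ^ ((β + t * Complex.I) / 2)) := by
      rw [← Complex.cpow_add _ _ hpi, ← Complex.cpow_add _ _ hpi, hW]
      congr 1
      ring
    rw [e1, e1, e2, ← pi_cpow_mul_Gammaℝ, ← pi_cpow_mul_Gammaℝ, e3]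
    ring
  have hint := (integrable_Gammaℝ_mul_Gammaℝ_vertical hδ hβ).comp_neg.const_mul (W / 2)
  have key := convolution_eq_inverse_fourier hf hg hgc (fun v => hC (2 * v))
    (F := fun t : ℝ => Complex.Gamma ((δ + t * Complex.I) / 2))
    (fun t => by
      simp only [f, mul_assoc (2 : ℂ)]
      rw [integral_const_mul, hFT δ hδ 0 t]
      simp) (hFT β hβ b) (by simp only [hprod]; exact hint) x
  simp only [hprod] at key
  -- The integrand in `τ` is the convolution integrand of `f` and `g` under `τ = -2v`, up to the
  -- factor `2` built into `f`.
  have hsub := Measure.integral_comp_mul_left (fun τ : ℝ => Complex.exp (-(Real.exp (-τ) : ℂ) -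
        (Real.pi ^ 2 * Real.exp (2 * x + τ) : ℝ) +
        β * (x + τ / 2 : ℝ) - δ * (τ / 2 : ℝ))) (-2)
  have e5 : ∀ v : ℝ, f v * g (x - v) = 2 * Complex.exp (-(Real.exp (-(-2 * v)) : ℂ) -
        (Real.pi ^ 2 * Real.exp (2 * x + (-2 * v)) : ℝ) +
        β * (x + (-2 * v) / 2 : ℝ) - δ * ((-2 * v) / 2 : ℝ)) := by
    intro v
    simp only [f, g]
    rw [mul_assoc, ← Complex.exp_add, hbpi]
    push_cast
    ring_nf
  simp only [e5] at key
  rw [integral_const_mul, hsub, ← integral_neg_eq_self (fun t : ℝ => W / 2 *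
    (Complex.Gammaℝ (δ - (-t : ℝ) * Complex.I) * Complex.Gammaℝ (β - (-t : ℝ) * Complex.I)) *
      Complex.exp (-(Complex.I * t * x)))] at key
  simp only [neg_neg, mul_assoc (W / 2), integral_const_mul] at key
  have h4 : ((|(-2 : ℝ)⁻¹| : ℝ) : ℂ) = 1 / 2 := by
    rw [inv_neg, abs_neg, abs_of_pos (by norm_num)]; push_cast; norm_num
  rw [Complex.real_smul, h4] at key
  have e6 : ∀ t : ℝ, Complex.exp (-(Complex.I * ((-t : ℝ) : ℂ) * x)) =
      Complex.exp (t * Complex.I * x) := fun t => by push_cast; ring_nf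
  simp only [e6] at key
  simp only [mul_assoc] at key ⊢
  rw [← mul_assoc, show (2 : ℂ) * (1 / 2) = 1 by norm_num, one_mul] at key
  rw [key]
  ring

/-! ### Holomorphic dependence of integrals on parameters -/

/-- Cauchy's estimate on the complex line through `p` in each direction `v`, with a disc of radius
`r/(2‖v‖)`, which that line maps into the ball. -/
theorem norm_fderiv_le_of_bound {E : Type*} [NormedAddCommGroup E] [NormedSpace ℂ E] {f : E → ℂ}
    {p : E} {r C : ℝ} (hr : 0 < r) (hf : DifferentiableOn ℂ f (Metric.ball p r))
    (hC : ∀ q ∈ Metric.ball p r, ‖f q‖ ≤ C) : ‖fderiv ℂ f p‖ ≤ C / (r / 2) := by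
  have hC0 : 0 ≤ C := (norm_nonneg _).trans (hC p (Metric.mem_ball_self hr))
  refine ContinuousLinearMap.opNorm_le_bound _ (by positivity) fun v => ?_
  rcases eq_or_ne v 0 with rfl | hv
  · simp
  have hvn : 0 < ‖v‖ := norm_pos_iff.mpr hv
  have hmem : ∀ ξ ∈ Metric.closedBall (0 : ℂ) (r / 2 / ‖v‖), p + ξ • v ∈ Metric.ball p r := by
    intro ξ hξ
    rw [mem_closedBall_zero_iff, le_div_iff₀ hvn] at hξ
    rw [mem_ball_iff_norm, add_sub_cancel_left, norm_smul]
    linarith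
  have hdiff : DifferentiableOn ℂ (fun ξ : ℂ => f (p + ξ • v))
      (Metric.closedBall (0 : ℂ) (r / 2 / ‖v‖)) :=
    hf.comp (f := fun ξ : ℂ => p + ξ • v) (by fun_prop) hmem
  have h1 := Complex.norm_deriv_le_of_forall_mem_sphere_norm_le (C := C) (by positivity)
    (hdiff.mono Metric.closure_ball_subset_closedBall).diffContOnCl
    (fun ξ hξ => hC _ (hmem ξ (Metric.sphere_subset_closedBall hξ)))
  have h2 : HasDerivAt (fun ξ : ℂ => f (p + ξ • v)) (fderiv ℂ f p v) 0 := by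
    have hd : DifferentiableAt ℂ f p := hf.differentiableAt (Metric.ball_mem_nhds p hr)
    have h3 : HasDerivAt (fun ξ : ℂ => p + ξ • v) v 0 := by
      simpa using ((hasDerivAt_id (0 : ℂ)).smul_const v).const_add p
    have h4 : HasFDerivAt f (fderiv ℂ f p) (p + (0 : ℂ) • v) := by simpa using hd.hasFDerivAt
    exact h4.comp_hasDerivAt 0 h3
  rw [h2.deriv] at h1
  calc _ ≤ _ := h1
    _ = _ := by field_simp

/-- Directional derivatives are limits of measurable difference quotients; finitely many of them,
along a basis, determine the derivative linearly. -/
theorem aestronglyMeasurable_fderiv {E α : Type*} [NormedAddCommGroup E] [NormedSpace ℂ E]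
    [FiniteDimensional ℂ E] [MeasurableSpace α] {μ : Measure α} {O : Set E} (hO : IsOpen O)
    {F : E → α → ℂ} (hd : ∀ a, DifferentiableOn ℂ (fun p => F p a) O)
    (hm : ∀ p ∈ O, AEStronglyMeasurable (F p) μ) {p : E} (hp : p ∈ O) :
    AEStronglyMeasurable (fun a => fderiv ℂ (fun p => F p a) p) μ := by
  have hv : ∀ v : E, AEStronglyMeasurable (fun a => fderiv ℂ (fun p => F p a) p v) μ := by
    intro v
    have hc : Tendsto (fun n : ℕ => p + ((n : ℂ) + 1)⁻¹ • v) atTop (𝓝 p) := by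
      have h0 : Tendsto (fun n : ℕ => ((n : ℂ) + 1)⁻¹) atTop (𝓝 0) := by
        simpa using tendsto_one_div_add_atTop_nhds_zero_nat (𝕜 := ℂ)
      simpa using (h0.smul_const v).const_add p
    obtain ⟨N, hN⟩ := eventually_atTop.mp (hc.eventually (hO.mem_nhds hp))
    refine aestronglyMeasurable_of_tendsto_ae (u := atTop)
      -- The index is shifted by `N` so that all the displaced points lie in `O`, where
      -- measurability is known.
      (f := fun n : ℕ => fun a => ((n + N : ℕ) + 1 : ℂ) *
        (F (p + (((n + N : ℕ) : ℂ) + 1)⁻¹ • v) a - F p a)) ?_ ?_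
    · intro n
      exact ((hm _ (hN _ (by omega))).sub (hm p hp)).const_mul _
    · refine Eventually.of_forall fun a => ?_
      have hdp : DifferentiableAt ℂ (fun p => F p a) p := (hd a).differentiableAt (hO.mem_nhds hp)
      have h3 : HasDerivAt (fun ξ : ℂ => p + ξ • v) v 0 := by
        simpa using ((hasDerivAt_id (0 : ℂ)).smul_const v).const_add p
      have h4 : HasFDerivAt (fun p => F p a) (fderiv ℂ (fun p => F p a) p) (p + (0 : ℂ) • v) := by
        simpa using hdp.hasFDerivAt
      have h5 := (h4.comp_hasDerivAt 0 h3).tendsto_slope_zero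
      have h6 : Tendsto (fun n : ℕ => (((n + N : ℕ) : ℂ) + 1)⁻¹) atTop (𝓝[≠] 0) := by
        rw [tendsto_nhdsWithin_iff]
        refine ⟨?_, Eventually.of_forall fun n => ?_⟩
        · have h0 : Tendsto (fun n : ℕ => ((n : ℂ) + 1)⁻¹) atTop (𝓝 0) := by
            simpa using tendsto_one_div_add_atTop_nhds_zero_nat (𝕜 := ℂ)
          exact h0.comp (tendsto_add_atTop_nat N)
        · exact inv_ne_zero (Nat.cast_add_one_ne_zero _)
      have h7 := h5.comp h6
      refine h7.congr fun n => ?_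
      simp
  set b := Module.finBasis ℂ E
  let Λ : (Fin (Module.finrank ℂ E) → ℂ) →ₗ[ℂ] (E →L[ℂ] ℂ) :=
    (LinearMap.toContinuousLinearMap (𝕜 := ℂ) (E := E) (F' := ℂ)).toLinearMap ∘ₗ
      (b.constr ℂ).toLinearMap
  have hΛ : Continuous Λ := Λ.continuous_of_finiteDimensional
  have he : (fun a => fderiv ℂ (fun p => F p a) p) =
      fun a => Λ fun i => fderiv ℂ (fun p => F p a) p (b i) := by
    ext1 a
    refine ContinuousLinearMap.coe_injective (b.ext fun i => ?_)
    simp [Λ]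
  rw [he]
  refine hΛ.comp_aestronglyMeasurable ?_
  exact (aemeasurable_pi_lambda _ fun i => (hv (b i)).aemeasurable).aestronglyMeasurable

/-- Holomorphic dependence of an integral on parameters. -/
theorem differentiableOn_integral {E α : Type*} [NormedAddCommGroup E] [NormedSpace ℂ E]
    [FiniteDimensional ℂ E] [MeasurableSpace α] {μ : Measure α} {O : Set E} (hO : IsOpen O)
    {F : E → α → ℂ} (hd : ∀ a, DifferentiableOn ℂ (fun p => F p a) O)
    (hm : ∀ p ∈ O, AEStronglyMeasurable (F p) μ) {B : α → ℝ} (hB : Integrable B μ)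
    (hFB : ∀ p ∈ O, ∀ a, ‖F p a‖ ≤ B a) :
    DifferentiableOn ℂ (fun p => ∫ a, F p a ∂μ) O := by
  intro p hp
  obtain ⟨r, hr, hrO⟩ := Metric.isOpen_iff.mp hO p hp
  have hsub : ∀ q ∈ Metric.ball p (r / 2), Metric.ball q (r / 2) ⊆ O := fun q hq =>
    (Metric.ball_subset_ball' (by rw [Metric.mem_ball] at hq; linarith)).trans hrO
  refine (hasFDerivAt_integral_of_dominated_of_fderiv_le (μ := μ)
    (F' := fun q a => fderiv ℂ (fun p => F p a) q) (bound := fun a => B a / (r / 2 / 2))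
    (Metric.ball_mem_nhds p (half_pos hr)) ?_ ?_ ?_ ?_ ?_ ?_).differentiableAt.differentiableWithinAt
  · filter_upwards [hO.mem_nhds hp] with q hq using hm q hq
  · exact hB.mono' (hm p hp) (Eventually.of_forall (hFB p hp))
  · exact aestronglyMeasurable_fderiv hO hd hm hp
  · refine Eventually.of_forall fun a q hq => ?_
    exact norm_fderiv_le_of_bound (half_pos hr) ((hd a).mono (hsub q hq))
      fun q' hq' => hFB q' (hsub q hq hq') a
  · exact hB.div_const _
  · refine Eventually.of_forall fun a q hq => ?_
    exact ((hd a).differentiableAt (hO.mem_nhds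
      (hsub q hq (Metric.mem_ball_self (half_pos hr))))).hasFDerivAt

/-! ### Primitives, Laurent splitting and residues -/

/-- The primitive is the integral of `f` along the segment from a base point, differentiated under
the integral sign. -/
theorem exists_primitive_of_convex {U : Set ℂ} (hU : IsOpen U) (hc : Convex ℝ U) {f : ℂ → ℂ}
    (hf : DifferentiableOn ℂ f U) : ∃ H : ℂ → ℂ, ∀ z ∈ U, HasDerivAt H (f z) z := by
  rcases U.eq_empty_or_nonempty with rfl | ⟨z₀, hz₀⟩
  · exact ⟨0, by simp⟩
  have hf' : DifferentiableOn ℂ (deriv f) U := hf.deriv hU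
  set P : ℂ → ℝ → ℂ := fun z t => z₀ + t * (z - z₀) with hP
  have hPU : ∀ z ∈ U, ∀ t ∈ Set.Icc (0 : ℝ) 1, P z t ∈ U := by
    intro z hz t ht
    have := hc.add_smul_sub_mem hz₀ hz ht
    simpa [hP] using this
  have hPc : Continuous fun q : ℂ × ℝ => P q.1 q.2 := by
    simp only [hP]; fun_prop
  refine ⟨fun z => (z - z₀) * ∫ t in (0 : ℝ)..1, f (P z t), fun z hz => ?_⟩
  obtain ⟨r, hr, hrU⟩ := Metric.nhds_basis_closedBall.mem_iff.mp (hU.mem_nhds hz)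
  have hKU : (fun q : ℂ × ℝ => P q.1 q.2) '' (Metric.closedBall z r ×ˢ Set.Icc 0 1) ⊆ U := by
    rintro _ ⟨q, ⟨hq1, hq2⟩, rfl⟩
    exact hPU _ (hrU hq1) _ hq2
  obtain ⟨C, hC⟩ := (((isCompact_closedBall z r).prod isCompact_Icc).image
    hPc).exists_bound_of_continuousOn (f := deriv f) (hf'.continuousOn.mono hKU)
  have hcont : ∀ (g : ℂ → ℂ), ContinuousOn g U → ∀ w ∈ U,
      ContinuousOn (fun t : ℝ => g (P w t)) (Set.uIcc 0 1) := by
    intro g hg w hw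
    rw [Set.uIcc_of_le zero_le_one]
    exact hg.comp (by simp only [hP]; fun_prop) fun t ht => hPU w hw t ht
  have hint : ∀ (g : ℂ → ℂ), ContinuousOn g U → ∀ w ∈ U,
      IntervalIntegrable (fun t : ℝ => g (P w t)) volume 0 1 := fun g hg w hw =>
    (hcont g hg w hw).intervalIntegrable
  have hint' : ∀ w ∈ U, IntervalIntegrable (fun t : ℝ => deriv f (P w t) * (t : ℂ)) volume 0 1 :=
    fun w hw => ((hcont _ hf'.continuousOn w hw).mul
      Complex.continuous_ofReal.continuousOn).intervalIntegrable
  have hF := intervalIntegral.hasDerivAt_integral_of_dominated_loc_of_deriv_le (μ := volume)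
    (F := fun w t => f (P w t)) (F' := fun w t => deriv f (P w t) * t) (x₀ := z)
    (s := Metric.ball z r) (a := 0) (b := 1) (bound := fun _ => C)
    (Metric.ball_mem_nhds z hr)
    (by
      filter_upwards [Metric.ball_mem_nhds z hr] with w hw
      exact (hint f hf.continuousOn w (hrU (Metric.ball_subset_closedBall hw))).def'.aestronglyMeasurable)
    (hint f hf.continuousOn z hz)
    (hint' z hz).def'.aestronglyMeasurable
    (by
      refine Eventually.of_forall fun t ht w hw => ?_
      rw [Set.uIoc_of_le zero_le_one] at ht
      rw [norm_mul]
      have h1 := hC (P w t) ⟨(w, t), ⟨Metric.ball_subset_closedBall hw, ht.1.le, ht.2⟩, rfl⟩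
      have h2 : ‖(t : ℂ)‖ ≤ 1 := by
        rw [Complex.norm_real, Real.norm_of_nonneg ht.1.le]; exact ht.2
      calc _ ≤ C * 1 := mul_le_mul h1 h2 (norm_nonneg _) ((norm_nonneg _).trans h1)
        _ = C := mul_one C)
    intervalIntegrable_const
    (by
      refine Eventually.of_forall fun t ht w hw => ?_
      rw [Set.uIoc_of_le zero_le_one] at ht
      have h1 : HasDerivAt f (deriv f (P w t)) (P w t) :=
        (hf.differentiableAt (hU.mem_nhds (hPU w (hrU (Metric.ball_subset_closedBall hw)) t
          ⟨ht.1.le, ht.2⟩))).hasDerivAt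
      have h2 : HasDerivAt (fun w => P w t) (t : ℂ) w := by
        simpa [hP] using (((hasDerivAt_id w).sub_const z₀).const_mul (t : ℂ)).const_add z₀
      exact h1.comp w h2)
  refine (((hasDerivAt_id z).sub_const z₀).fun_mul hF.2).congr_deriv ?_
  -- The two terms of the derivative of the candidate combine into `d/dt (t f(P z t))`.
  have hFTC : ∫ t in (0 : ℝ)..1, (f (P z t) + (z - z₀) * (deriv f (P z t) * t)) =
      (1 : ℝ) * f (P z 1) - (0 : ℝ) * f (P z 0) := by
    refine intervalIntegral.integral_eq_sub_of_hasDerivAt (f := fun t : ℝ => (t : ℂ) * f (P z t)) ?_ ?_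
    · intro t ht
      rw [Set.uIcc_of_le zero_le_one] at ht
      have h1 : HasDerivAt f (deriv f (P z t)) (P z t) :=
        (hf.differentiableAt (hU.mem_nhds (hPU z hz t ht))).hasDerivAt
      have h2 : HasDerivAt (fun t : ℝ => P z t) (z - z₀) t := by
        have h0 : HasDerivAt (fun t : ℝ => (t : ℂ)) 1 t := Complex.ofRealCLM.hasDerivAt
        simpa [hP] using (h0.mul_const (z - z₀)).const_add z₀
      have h0 : HasDerivAt (fun t : ℝ => (t : ℂ)) 1 t := Complex.ofRealCLM.hasDerivAt
      have h3 : HasDerivAt (fun t : ℝ => f (P z t)) (deriv f (P z t) * (z - z₀)) t :=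
        h1.comp_of_eq t h2 rfl
      exact (h0.fun_mul h3).congr_deriv (by ring)
    · exact (hint f hf.continuousOn z hz).add
        ((hint' z hz).const_mul _)
  rw [intervalIntegral.integral_add (hint f hf.continuousOn z hz)
    ((hint' z hz).const_mul _),
    intervalIntegral.integral_const_mul] at hFTC
  have hP1 : P z 1 = z := by simp [hP]
  rw [hP1] at hFTC
  simp only [Complex.ofReal_one, one_mul, Complex.ofReal_zero, zero_mul, sub_zero] at hFTC
  simp only [id, one_mul]
  exact hFTC

theorem circleIntegral_inv_sub_of_notMem {s w : ℂ} {R : ℝ} (hR : 0 ≤ R)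
    (hw : w ∉ Metric.closedBall s R) : (∮ z in C(s, R), (z - w)⁻¹) = 0 := by
  refine Complex.circleIntegral_eq_zero_of_differentiable_on_off_countable hR Set.countable_empty
    ?_ ?_
  · intro z hz
    have : z - w ≠ 0 := sub_ne_zero.mpr fun h => hw (h ▸ hz)
    exact ContinuousAt.continuousWithinAt (by fun_prop (disch := assumption))
  · rintro z ⟨hz, -⟩
    have : z - w ≠ 0 := sub_ne_zero.mpr fun h => hw (h ▸ Metric.ball_subset_closedBall hz)
    fun_prop (disch := assumption)

/-- Cauchy's formula on an annulus. -/
theorem cauchy_annulus {U : Set ℂ} (hU : IsOpen U) {s : ℂ} {f : ℂ → ℂ}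
    (hf : DifferentiableOn ℂ f (U \ {s})) {ρ R : ℝ} (hρ : 0 < ρ) (hR : Metric.closedBall s R ⊆ U)
    {z : ℂ} (h1 : ρ < dist z s) (h2 : dist z s < R) :
    2 * Real.pi * Complex.I * f z =
      (∮ ζ in C(s, R), (ζ - z)⁻¹ • f ζ) - ∮ ζ in C(s, ρ), (ζ - z)⁻¹ • f ζ := by
  have hopen : IsOpen (U \ {s}) := hU.sdiff isClosed_singleton
  have hzs : z ≠ s := by rintro rfl; simp at h1; linarith
  have hzU : z ∈ U \ {s} := ⟨hR (Metric.mem_closedBall.mpr h2.le), hzs⟩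
  -- The divided difference has no singularity at `z`, so its integrals over the two circles agree;
  -- of the subtracted terms `f(z)/(ζ - z)` only the one on the outer circle contributes.
  have hd : DifferentiableOn ℂ (dslope f z) (U \ {s}) :=
    (Complex.differentiableOn_dslope (hopen.mem_nhds hzU)).mpr hf
  have hcb : ∀ ζ ∈ Metric.closedBall s R \ Metric.ball s ρ, ζ ∈ U \ {s} := by
    rintro ζ ⟨ha, hb⟩
    refine ⟨hR ha, ?_⟩
    rintro rfl
    exact hb (Metric.mem_ball_self hρ)
  have hρR : ρ ≤ R := (h1.trans h2).le
  have hA := Complex.circleIntegral_eq_of_differentiable_on_annulus_off_countable hρ hρR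
    Set.countable_empty (hd.continuousOn.mono hcb) (fun ζ hζ => hd.differentiableAt (hopen.mem_nhds
      (hcb ζ ⟨Metric.ball_subset_closedBall hζ.1.1, fun h => hζ.1.2 (Metric.ball_subset_closedBall h)⟩)))
  have hcirc : ∀ r, ρ ≤ r → r ≤ R → r ≠ dist z s → (∮ ζ in C(s, r), dslope f z ζ) =
      (∮ ζ in C(s, r), (ζ - z)⁻¹ • f ζ) - (∮ ζ in C(s, r), (ζ - z)⁻¹) * f z := by
    intro r hr1 hr2 hr3
    have hsph : ∀ ζ ∈ Metric.sphere s r, ζ - z ≠ 0 := by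
      intro ζ hζ h
      rw [sub_eq_zero] at h
      rw [h, Metric.mem_sphere] at hζ
      exact hr3 hζ.symm
    have hr0 : 0 ≤ r := hρ.le.trans hr1
    have hsU : Metric.sphere s r ⊆ U \ {s} := fun ζ hζ => hcb ζ
      ⟨Metric.mem_closedBall.mpr (by rw [Metric.mem_sphere.mp hζ]; exact hr2), by
        rw [Metric.mem_ball, Metric.mem_sphere.mp hζ, not_lt]; exact hr1⟩
    have hci : ContinuousOn (fun ζ : ℂ => (ζ - z)⁻¹) (Metric.sphere s r) :=
      ContinuousOn.inv₀ (by fun_prop) hsph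
    have e : (∮ ζ in C(s, r), dslope f z ζ) =
        ∮ ζ in C(s, r), ((ζ - z)⁻¹ • f ζ - (ζ - z)⁻¹ * f z) := by
      refine circleIntegral.integral_congr hr0 fun ζ hζ => ?_
      rw [dslope_of_ne _ (sub_ne_zero.mp (hsph ζ hζ)), slope_def_module, smul_eq_mul, smul_eq_mul,
        mul_sub]
    rw [e, circleIntegral.integral_sub]
    · congr 1
      simp only [circleIntegral, smul_eq_mul, ← mul_assoc]
      rw [intervalIntegral.integral_mul_const]
    · exact (hci.smul (hf.continuousOn.mono hsU)).circleIntegrable hr0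
    · exact (hci.mul continuousOn_const).circleIntegrable hr0
  rw [hcirc R hρR le_rfl h2.ne', hcirc ρ le_rfl hρR h1.ne,
    circleIntegral.integral_sub_inv_of_mem_ball (Metric.mem_ball.mpr h2),
    circleIntegral_inv_sub_of_notMem hρ.le (by rw [Metric.mem_closedBall, not_le]; exact h1)] at hA
  linear_combination -hA

/-- An isolated singularity can be split off as a simple pole plus a derivative. -/
theorem exists_laurent_split {U : Set ℂ} (hU : IsOpen U) {s : ℂ} (hs : s ∈ U) {f : ℂ → ℂ}
    (hf : DifferentiableOn ℂ f (U \ {s})) :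
    ∃ (f₀ J J' : ℂ → ℂ) (r : ℂ), DifferentiableOn ℂ f₀ U ∧ (∀ z, z ≠ s → HasDerivAt J (J' z) z) ∧
      ∀ z ∈ U, z ≠ s → f z = f₀ z + r / (z - s) + J' z := by
  obtain ⟨R, hR, hRU⟩ := Metric.nhds_basis_closedBall.mem_iff.mp (hU.mem_nhds hs)
  set ρ := R / 2 with hρdef
  have hρ : 0 < ρ := by positivity
  have hρR : ρ < R := by rw [hρdef]; linarith
  have hopen : IsOpen (U \ {s}) := hU.sdiff isClosed_singleton
  have hsph : ∀ r, 0 < r → r ≤ R → Metric.sphere s r ⊆ U \ {s} := by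
    intro r hr0 hrR ζ hζ
    refine ⟨hRU (Metric.mem_closedBall.mpr ((Metric.mem_sphere.mp hζ).trans_le hrR)), ?_⟩
    rintro rfl
    rw [Metric.mem_sphere, dist_self] at hζ
    linarith
  set h : ℂ → ℂ := fun z => (2 * Real.pi * Complex.I)⁻¹ • ∮ ζ in C(s, R), (ζ - z)⁻¹ • f ζ with hh
  set g : ℂ → ℂ := fun z => -((2 * Real.pi * Complex.I)⁻¹ • ∮ ζ in C(s, ρ), (ζ - z)⁻¹ • f ζ) with hg
  have h2pi : (2 * Real.pi * Complex.I : ℂ) ≠ 0 := Complex.two_pi_I_ne_zero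
  have hdecomp : ∀ z, ρ < dist z s → dist z s < R → f z = h z + g z := by
    intro z h1 h2
    rw [← inv_mul_cancel_left₀ h2pi (f z), cauchy_annulus hU hf hρ hRU h1 h2]
    simp only [hh, hg, smul_eq_mul]
    ring
  have hhd : DifferentiableOn ℂ h (Metric.ball s R) := by
    have hci : CircleIntegrable f s R :=
      (hf.continuousOn.mono (hsph R hR le_rfl)).circleIntegrable hR.le
    lift R to NNReal using hR.le
    have h1 := (hasFPowerSeriesOn_cauchy_integral hci (by exact_mod_cast hR)).differentiableOn
    rwa [Metric.eball_coe] at h1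
  obtain ⟨M, hM⟩ := (isCompact_sphere s ρ).exists_bound_of_continuousOn
    (hf.continuousOn.mono (hsph ρ hρ hρR.le))
  have hgb : ∀ z, ρ < dist z s → ‖g z‖ ≤ ρ * (M / (dist z s - ρ)) := by
    intro z hz
    have h1 : ‖∮ ζ in C(s, ρ), (ζ - z)⁻¹ • f ζ‖ ≤ 2 * Real.pi * ρ * (M / (dist z s - ρ)) := by
      refine circleIntegral.norm_integral_le_of_norm_le_const hρ.le fun ζ hζ => ?_
      rw [norm_smul, norm_inv, inv_mul_eq_div]
      have h3 : dist z s - ρ ≤ ‖ζ - z‖ := by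
        have := dist_triangle z ζ s
        rw [Metric.mem_sphere.mp hζ, dist_comm z ζ, dist_eq_norm ζ z] at this
        linarith
      exact div_le_div₀ ((norm_nonneg _).trans (hM ζ hζ)) (hM ζ hζ) (by linarith) h3
    simp only [hg, norm_neg, norm_smul, norm_inv, norm_mul, Complex.norm_ofNat, Complex.norm_I,
      mul_one, Complex.norm_real, Real.norm_of_nonneg Real.pi_pos.le]
    rw [inv_mul_le_iff₀ (by positivity)]
    calc _ ≤ _ := h1
      _ = _ := by ring
  have hgd : ∀ z, ρ < dist z s → DifferentiableAt ℂ g z := by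
    intro z hz
    set ρ' := (ρ + dist z s) / 2 with hρ'
    have hO : IsOpen {w : ℂ | ρ' < dist w s} := isOpen_lt continuous_const (by fun_prop)
    have hne : ∀ w ∈ {w : ℂ | ρ' < dist w s}, ∀ θ : ℝ, ρ' - ρ ≤ ‖circleMap s ρ θ - w‖ := by
      intro w hw θ
      have h1 := dist_triangle w (circleMap s ρ θ) s
      rw [Metric.mem_sphere.mp (circleMap_mem_sphere s hρ.le θ), dist_comm w (circleMap s ρ θ), dist_eq_norm _ w] at h1
      have : ρ' < dist w s := hw
      linarith
    have hpos : 0 < ρ' - ρ := by rw [hρ']; linarith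
    have hne' : ∀ w ∈ {w : ℂ | ρ' < dist w s}, ∀ θ : ℝ, circleMap s ρ θ - w ≠ 0 := by
      intro w hw θ h0
      have := hne w hw θ
      rw [h0, norm_zero] at this
      linarith
    have hfc : Continuous fun θ : ℝ => f (circleMap s ρ θ) :=
      (hf.continuousOn.mono (hsph ρ hρ hρR.le)).comp_continuous (continuous_circleMap s ρ)
        fun θ => circleMap_mem_sphere s hρ.le θ
    have hdi := differentiableOn_integral (μ := volume.restrict (Set.Ioc 0 (2 * Real.pi))) hO
      (F := fun w (θ : ℝ) => deriv (circleMap s ρ) θ * ((circleMap s ρ θ - w)⁻¹ * f (circleMap s ρ θ)))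
      (fun θ w hw => by
        have := hne' w hw θ
        exact DifferentiableAt.differentiableWithinAt (by fun_prop (disch := assumption)))
      (fun w hw => by
        refine Continuous.aestronglyMeasurable ?_
        have h1 : Continuous fun θ : ℝ => (circleMap s ρ θ - w)⁻¹ :=
          Continuous.inv₀ (by fun_prop) (hne' w hw)
        simp only [deriv_circleMap]
        exact Continuous.mul (by fun_prop) (h1.mul hfc))
      (B := fun _ => ρ * ((ρ' - ρ)⁻¹ * M)) (integrable_const _)
      (fun w hw θ => by
        rw [norm_mul, norm_mul, norm_inv, deriv_circleMap, norm_mul, norm_circleMap_zero,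
          abs_of_pos hρ, Complex.norm_I, mul_one]
        have h1 := hM _ (circleMap_mem_sphere s hρ.le θ)
        have h2 := hne w hw θ
        have h3 := (norm_nonneg _).trans h1
        gcongr)
    have hz' : z ∈ {w : ℂ | ρ' < dist w s} := by
      show ρ' < dist z s
      rw [hρ']; linarith
    have h1 := (hdi.differentiableAt (hO.mem_nhds hz')).const_mul (-(2 * Real.pi * Complex.I)⁻¹)
    refine h1.congr_of_eventuallyEq (Eventually.of_forall fun w => ?_)
    simp only [hg, circleIntegral, smul_eq_mul]
    rw [intervalIntegral.integral_of_le (by positivity)]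
    ring
  -- `h + g` is the Laurent splitting on the annulus. The principal part `g` is continued inwards up
  -- to `s` as `f - h`, and below the regular part `h` is continued outwards to all of `U` as `f -
  -- g`.
  set G : ℂ → ℂ := fun z => if ρ < dist z s then g z else f z - h z with hG
  have hGd : ∀ z, z ≠ s → DifferentiableAt ℂ G z := by
    intro z hz
    by_cases h1 : ρ < dist z s
    · refine (hgd z h1).congr_of_eventuallyEq ?_
      have : IsOpen {w : ℂ | ρ < dist w s} := isOpen_lt continuous_const (by fun_prop)
      filter_upwards [this.mem_nhds h1] with w hw
      simp only [hG]
      exact if_pos hw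
    · have h2 : z ∈ Metric.ball s R := Metric.mem_ball.mpr (by linarith)
      have h3 : DifferentiableAt ℂ (fun w => f w - h w) z :=
        (hf.differentiableAt (hopen.mem_nhds ⟨hRU (Metric.ball_subset_closedBall h2), hz⟩)).sub
          (hhd.differentiableAt (Metric.isOpen_ball.mem_nhds h2))
      refine h3.congr_of_eventuallyEq ?_
      filter_upwards [Metric.isOpen_ball.mem_nhds h2] with w hw
      simp only [hG]
      split_ifs with h4
      · rw [hdecomp w h4 (Metric.mem_ball.mp hw)]; ring
      · rfl
  set f₀ : ℂ → ℂ := fun z => if dist z s < R then h z else f z - g z with hf₀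
  have hf₀d : DifferentiableOn ℂ f₀ U := by
    intro z hz
    refine DifferentiableAt.differentiableWithinAt ?_
    by_cases h1 : dist z s < R
    · refine (hhd.differentiableAt (Metric.isOpen_ball.mem_nhds h1)).congr_of_eventuallyEq ?_
      filter_upwards [Metric.isOpen_ball.mem_nhds (Metric.mem_ball.mpr h1)] with w hw
      simp only [hf₀]
      exact if_pos hw
    · have h2 : ρ < dist z s := by linarith
      have hzs : z ≠ s := by rintro rfl; simp at h2; linarith
      have h3 : DifferentiableAt ℂ (fun w => f w - g w) z :=
        (hf.differentiableAt (hopen.mem_nhds ⟨hz, hzs⟩)).sub (hgd z h2)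
      refine h3.congr_of_eventuallyEq ?_
      have : IsOpen {w : ℂ | ρ < dist w s} := isOpen_lt continuous_const (by fun_prop)
      filter_upwards [this.mem_nhds h2] with w hw
      simp only [hf₀]
      split_ifs with h4
      · rw [hdecomp w hw h4]; ring
      · rfl
  have hsum : ∀ z, z ≠ s → f z = f₀ z + G z := by
    intro z hz
    simp only [hf₀, hG]
    split_ifs with h1 h2 h3
    · exact hdecomp z h2 h1
    · ring
    · ring
    · exact absurd h1 (by push Not at h3; linarith)
  -- The principal part vanishes at infinity, so in the coordinate `u = 1/(z - s)` it becomes an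
  -- entire function with a zero at the origin. Nothing is assumed about the order of the
  -- singularity.
  set E : ℂ → ℂ := fun u => if u = 0 then 0 else G (s + u⁻¹) with hE
  have hEd' : ∀ u, u ≠ 0 → DifferentiableAt ℂ E u := by
    intro u hu
    have h1 : DifferentiableAt ℂ (fun u : ℂ => G (s + u⁻¹)) u :=
      DifferentiableAt.comp (g := G) (f := fun u : ℂ => s + u⁻¹) u (hGd _ (by simpa using hu))
        (by fun_prop (disch := assumption))
    refine h1.congr_of_eventuallyEq ?_
    filter_upwards [isOpen_ne.mem_nhds hu] with w hw
    simp only [hE]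
    exact if_neg hw
  have hEb : ∀ u : ℂ, ‖u‖ < 1 / (2 * ρ) → ‖E u‖ ≤ 2 * ρ * |M| * ‖u‖ := by
    intro u hu
    by_cases hu0 : u = 0
    · simp [hE, hu0]
    have hun : 0 < ‖u‖ := norm_pos_iff.mpr hu0
    have hdist : dist (s + u⁻¹) s = ‖u‖⁻¹ := by simp
    rw [lt_div_iff₀ (by positivity)] at hu
    have h1 : 2 * ρ < ‖u‖⁻¹ := by
      rw [← one_div, lt_div_iff₀ hun]; linarith
    have h2 : ρ < dist (s + u⁻¹) s := by rw [hdist]; linarith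
    have h3 := hgb _ h2
    simp only [hE, if_neg hu0, hG, if_pos h2]
    refine h3.trans ?_
    rw [hdist, ← mul_div_assoc, div_le_iff₀ (by linarith)]
    have h4 : 2 * ρ * |M| * ‖u‖ * (‖u‖⁻¹ - ρ) = ρ * |M| * (2 - 2 * ρ * ‖u‖) := by
      field_simp
    rw [h4]
    have h5 : M ≤ |M| := le_abs_self M
    have h6 : 0 ≤ |M| := abs_nonneg M
    nlinarith [mul_nonneg hρ.le h6]
  have hEc : ContinuousAt E 0 := by
    rw [Metric.continuousAt_iff']
    intro ε hε
    have h1 : Tendsto (fun u : ℂ => 2 * ρ * |M| * ‖u‖) (𝓝 0) (𝓝 0) := by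
      have : Continuous fun u : ℂ => 2 * ρ * |M| * ‖u‖ := by fun_prop
      simpa using this.tendsto 0
    filter_upwards [h1.eventually (gt_mem_nhds hε), Metric.ball_mem_nhds (0 : ℂ)
      (show 0 < 1 / (2 * ρ) by positivity)] with u hu1 hu2
    have : E 0 = 0 := by simp [hE]
    rw [this, dist_zero_right]
    exact (hEb u (by simpa using hu2)).trans_lt hu1
  have hEd : Differentiable ℂ E := by
    intro u
    by_cases hu : u = 0
    · subst hu
      refine (Complex.analyticAt_of_differentiable_on_punctured_nhds_of_continuousAt ?_
        hEc).differentiableAt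
      filter_upwards [self_mem_nhdsWithin] with w hw using hEd' w hw
    · exact hEd' u hu
  have hdsl : ∀ F : ℂ → ℂ, Differentiable ℂ F → Differentiable ℂ (dslope F 0) := fun F hF => by
    rw [← differentiableOn_univ] at hF ⊢
    exact (Complex.differentiableOn_dslope Filter.univ_mem).mpr hF
  set E₁ := dslope E 0
  set E₂ := dslope E₁ 0
  obtain ⟨K, hK⟩ := (hdsl E₁ (hdsl E hEd)).isExactOn_univ
  have hEeq : ∀ u, E u = E₁ 0 * u + E₂ u * u ^ 2 := by
    intro u
    have h1 : u * E₁ u = E u := by simpa [hE] using sub_smul_dslope E 0 u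
    have h2 : u * E₂ u = E₁ u - E₁ 0 := by simpa using sub_smul_dslope E₁ 0 u
    linear_combination -h1 - u * h2
  -- The linear term of `E` is the simple pole, with residue `E₁ 0`. The remainder `E₂(u) u²` is the
  -- derivative of `-K(1/(z - s))`, where `K` is a primitive of `E₂`.
  refine ⟨f₀, fun z => -K ((z - s)⁻¹), fun z => E₂ ((z - s)⁻¹) * ((z - s)⁻¹) ^ 2, E₁ 0, hf₀d, ?_, ?_⟩
  · intro z hz
    have hzs : z - s ≠ 0 := sub_ne_zero.mpr hz
    have h1 : HasDerivAt (fun z => (z - s)⁻¹) (-1 / (z - s) ^ 2) z :=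
      ((hasDerivAt_id z).sub_const s).fun_inv hzs
    exact ((hK _ (Set.mem_univ _)).comp z h1).neg.congr_deriv (by field_simp; rfl)
  · intro z hz hzs
    have hzs' : z - s ≠ 0 := sub_ne_zero.mpr hzs
    have h1 : G z = E ((z - s)⁻¹) := by
      simp only [hE, inv_eq_zero, if_neg hzs', inv_inv, add_sub_cancel]
    rw [hsum z hzs, h1, hEeq]
    ring

/-- Singularities are split off one at a time, each leaving a simple pole and an exact term; what
remains is holomorphic on a convex set. Points of `S` outside `U` get coefficient `0`. -/
theorem exists_primitive_sub_simple_poles {U : Set ℂ} (hU : IsOpen U) (hc : Convex ℝ U)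
    (S : Finset ℂ) {f : ℂ → ℂ} (hf : DifferentiableOn ℂ f (U \ S)) :
    ∃ (H r : ℂ → ℂ), ∀ z ∈ U, z ∉ S → HasDerivAt H (f z - ∑ s ∈ S, r s / (z - s)) z := by
  classical
  induction S using Finset.induction_on generalizing f with
  | empty =>
    obtain ⟨H, hH⟩ := exists_primitive_of_convex hU hc (by simpa using hf)
    exact ⟨H, 0, fun z hz _ => by simpa using hH z hz⟩
  | insert s S hs ih =>
    have hopen : IsOpen (U \ (S : Set ℂ)) := hU.sdiff S.finite_toSet.isClosed
    have hset : U \ ((insert s S : Finset ℂ) : Set ℂ) = (U \ (S : Set ℂ)) \ {s} := by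
      ext z
      simp only [Finset.coe_insert, Set.mem_sdiff, Set.mem_insert_iff, Set.mem_singleton_iff]
      tauto
    rw [hset] at hf
    by_cases hsU : s ∈ U
    · obtain ⟨f₀, J, J', r₁, hf₀, hJ, hdec⟩ := exists_laurent_split hopen ⟨hsU, hs⟩ hf
      obtain ⟨H, r, hH⟩ := ih hf₀
      refine ⟨fun z => H z + J z, Function.update r s r₁, fun z hz hzS => ?_⟩
      rw [Finset.mem_insert, not_or] at hzS
      refine ((hH z hz hzS.2).add (hJ z hzS.1)).congr_deriv ?_
      rw [hdec z ⟨hz, hzS.2⟩ hzS.1, Finset.sum_insert hs, Function.update_self]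
      have : ∑ x ∈ S, Function.update r s r₁ x / (z - x) = ∑ x ∈ S, r x / (z - x) :=
        Finset.sum_congr rfl fun x hx => by
          rw [Function.update_of_ne (ne_of_mem_of_not_mem hx hs)]
      rw [this]
      ring
    · have hf' : DifferentiableOn ℂ f (U \ (S : Set ℂ)) := hf.mono fun z hz =>
        ⟨hz, fun h => hsU (Set.mem_singleton_iff.mp h ▸ hz.1)⟩
      obtain ⟨H, r, hH⟩ := ih hf'
      refine ⟨H, Function.update r s 0, fun z hz hzS => ?_⟩
      rw [Finset.mem_insert, not_or] at hzS
      refine (hH z hz hzS.2).congr_deriv ?_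
      rw [Finset.sum_insert hs, Function.update_self]
      have : ∑ x ∈ S, Function.update r s 0 x / (z - x) = ∑ x ∈ S, r x / (z - x) :=
        Finset.sum_congr rfl fun x hx => by
          rw [Function.update_of_ne (ne_of_mem_of_not_mem hx hs)]
      rw [this]
      ring

/-- `f` minus its simple poles has a primitive along the circle, and of those poles only the one at
`s` is enclosed. -/
theorem circleIntegral_eq_residue {U : Set ℂ} {S : Finset ℂ} {f H r : ℂ → ℂ}
    (hf : ContinuousOn f (U \ S))
    (hH : ∀ z ∈ U, z ∉ S → HasDerivAt H (f z - ∑ s ∈ S, r s / (z - s)) z) {s : ℂ} (hs : s ∈ S)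
    {ρ : ℝ} (hρ : 0 < ρ) (hU : Metric.closedBall s ρ ⊆ U)
    (hS : ∀ s' ∈ S, s' ≠ s → ρ < dist s' s) :
    (∮ z in C(s, ρ), f z) = 2 * Real.pi * Complex.I * r s := by
  classical
  have hsph : Metric.sphere s ρ ⊆ U \ S := by
    intro z hz
    refine ⟨hU (Metric.sphere_subset_closedBall hz), fun hzS => ?_⟩
    have h1 := Metric.mem_sphere.mp hz
    by_cases h : z = s
    · rw [h, dist_self] at h1; linarith
    · have := hS z hzS h; linarith
  have hsum : (∮ z in C(s, ρ), ∑ s' ∈ S, r s' / (z - s')) = 2 * Real.pi * Complex.I * r s := by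
    have hint : ∀ s' ∈ S, CircleIntegrable (fun z => r s' / (z - s')) s ρ := by
      intro s' hs'
      refine ContinuousOn.circleIntegrable hρ.le fun z hz => ?_
      have : z - s' ≠ 0 := sub_ne_zero.mpr fun h => (hsph hz).2 (h ▸ hs')
      exact ContinuousAt.continuousWithinAt (by fun_prop (disch := assumption))
    rw [circleIntegral.integral_fun_sum hint]
    rw [Finset.sum_eq_single s]
    · have e : ∀ z, r s / (z - s) = r s * (z - s)⁻¹ := fun z => div_eq_mul_inv _ _
      simp only [e]
      rw [circleIntegral.integral_const_mul, circleIntegral.integral_sub_center_inv _ hρ.ne']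
      ring
    · intro s' hs' hne
      have e : ∀ z, r s' / (z - s') = r s' * (z - s')⁻¹ := fun z => div_eq_mul_inv _ _
      simp only [e]
      rw [circleIntegral.integral_const_mul, circleIntegral_inv_sub_of_notMem hρ.le, mul_zero]
      rw [Metric.mem_closedBall, not_le]
      exact hS s' hs' hne
    · exact fun h => absurd hs h
  have hzero : (∮ z in C(s, ρ), (f z - ∑ s' ∈ S, r s' / (z - s'))) = 0 := by
    refine circleIntegral.integral_eq_zero_of_hasDerivWithinAt (f := H) hρ.le fun z hz => ?_
    exact (hH z (hsph hz).1 (hsph hz).2).hasDerivWithinAt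
  have hfi : CircleIntegrable f s ρ := (hf.mono hsph).circleIntegrable hρ.le
  have hsi : CircleIntegrable (fun z => ∑ s' ∈ S, r s' / (z - s')) s ρ := by
    refine ContinuousOn.circleIntegrable hρ.le (continuousOn_finsetSum _ fun s' hs' z hz => ?_)
    have : z - s' ≠ 0 := sub_ne_zero.mpr fun h => (hsph hz).2 (h ▸ hs')
    exact ContinuousAt.continuousWithinAt (by fun_prop (disch := assumption))
  rw [circleIntegral.integral_sub hfi hsi, hsum, sub_eq_zero] at hzero
  exact hzero

/-! ### Vertical paths and change of contour -/

/-- A set with finitely many points in each vertical strip. -/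
def StripFinite (T : Set ℂ) : Prop := ∀ x : ℝ, {s ∈ T | |s.re| ≤ x}.Finite

/-- A continuous, piecewise `C¹` path that is an upward vertical line near both ends. -/
structure IsVerticalPath (γ : ℝ → ℂ) : Prop where
  continuous : Continuous γ
  differentiable : ∃ S : Finset ℝ, ∀ t, t ∉ S → DifferentiableAt ℝ γ t
  bounded_deriv : ∃ K : ℝ, ∀ t, ‖deriv γ t‖ ≤ K
  vertical : ∃ c T : ℝ, ∀ t : ℝ, T ≤ |t| → γ t = (c : ℂ) + (t : ℂ) * Complex.I

namespace IsVerticalPath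

variable {γ : ℝ → ℂ}

theorem exists_vertical (h : IsVerticalPath γ) :
    ∃ c T : ℝ, 0 ≤ T ∧ ∀ t : ℝ, T ≤ |t| → γ t = (c : ℂ) + (t : ℂ) * Complex.I := by
  obtain ⟨c, T, hT⟩ := h.vertical
  exact ⟨c, max T 0, le_max_right _ _, fun t ht => hT t ((le_max_left _ _).trans ht)⟩

theorem exists_abs_re_le (h : IsVerticalPath γ) : ∃ x : ℝ, ∀ t, |(γ t).re| ≤ x := by
  obtain ⟨c, T, hT0, hT⟩ := h.exists_vertical
  obtain ⟨M, hM⟩ := isCompact_Icc.exists_bound_of_continuousOn (s := Set.Icc (-T) T)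
    h.continuous.continuousOn
  refine ⟨max M |c|, fun t => ?_⟩
  by_cases ht : T ≤ |t|
  · rw [hT t ht]; simp
  · push Not at ht
    exact (Complex.abs_re_le_norm _).trans ((hM t (abs_le.mp ht.le)).trans (le_max_left _ _))

theorem isClosed_range (h : IsVerticalPath γ) : IsClosed (Set.range γ) := by
  obtain ⟨c, T, hT0, hT⟩ := h.exists_vertical
  have : Set.range γ = γ '' Set.Icc (-T) T ∪ {z | z.re = c ∧ T ≤ |z.im|} := by
    ext z
    constructor
    · rintro ⟨t, rfl⟩
      by_cases ht : T ≤ |t|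
      · right; rw [hT t ht]; simpa using ht
      · left
        push Not at ht
        exact ⟨t, abs_le.mp ht.le, rfl⟩
    · rintro (⟨t, -, rfl⟩ | ⟨h1, h2⟩)
      · exact ⟨t, rfl⟩
      · refine ⟨z.im, ?_⟩
        rw [hT _ h2, ← h1, Complex.re_add_im]
  rw [this]
  refine IsClosed.union (isCompact_Icc.image h.continuous).isClosed ?_
  exact (isClosed_eq Complex.continuous_re continuous_const).inter
    (isClosed_le continuous_const (Complex.continuous_im.abs))

theorem measurable_deriv (_ : IsVerticalPath γ) : Measurable (deriv γ) := _root_.measurable_deriv γ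

/-- On the vertical ends the integral is at most that of `1/(1 + (Im p - t)²)`, which does not
depend on `p`. This uniformity later gives bounds on Mellin-Barnes integrals that are independent of
the imaginary parts of the parameters. -/
theorem exists_integral_decay_le (h : IsVerticalPath γ) :
    ∃ K, ∀ p : ℂ, Integrable (fun t => decay (p - γ t) * ‖deriv γ t‖) ∧
      ∫ t, decay (p - γ t) * ‖deriv γ t‖ ≤ K := by
  obtain ⟨c, T, hT0, hT⟩ := h.exists_vertical
  obtain ⟨K, hK⟩ := h.bounded_deriv
  have hK0 : 0 ≤ K := (norm_nonneg _).trans (hK 0)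
  have hdom : ∀ (p : ℂ) (t : ℝ), decay (p - γ t) * ‖deriv γ t‖ ≤
      (Set.Icc (-T) T).indicator (fun _ => K) t + K * (1 + (p.im - t) ^ 2)⁻¹ := by
    intro p t
    by_cases ht : t ∈ Set.Icc (-T) T
    · rw [Set.indicator_of_mem ht]
      have h1 : 0 ≤ K * (1 + (p.im - t) ^ 2)⁻¹ := by positivity
      have h2 : decay (p - γ t) * ‖deriv γ t‖ ≤ 1 * K :=
        mul_le_mul (decay_le_one _) (hK t) (norm_nonneg _) zero_le_one
      linarith
    · rw [Set.indicator_of_notMem ht, zero_add]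
      have h1 : T ≤ |t| := by
        by_contra hlt
        push Not at hlt
        exact ht (abs_le.mp hlt.le)
      have h2 : decay (p - γ t) = (1 + (p.im - t) ^ 2)⁻¹ := by
        rw [decay, hT t h1]; simp
      rw [h2, mul_comm]
      exact mul_le_mul_of_nonneg_right (hK t) (by positivity)
  have hi1 : Integrable ((Set.Icc (-T) T).indicator fun _ : ℝ => K) :=
    (integrable_indicator_iff measurableSet_Icc).mpr (by simp)
  have hi2 : ∀ p : ℂ, Integrable fun t : ℝ => K * (1 + (p.im - t) ^ 2)⁻¹ := fun p =>
    (integrable_inv_one_add_sq.comp_sub_left p.im).const_mul K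
  have hint : ∀ p : ℂ, Integrable (fun t => decay (p - γ t) * ‖deriv γ t‖) := fun p => by
    refine (hi1.add (hi2 p)).mono' ?_ (Eventually.of_forall fun t => ?_)
    · exact ((continuous_decay.comp (continuous_const.sub h.continuous)).measurable.mul
        h.measurable_deriv.norm).aestronglyMeasurable
    · rw [Real.norm_of_nonneg (mul_nonneg (decay_pos _).le (norm_nonneg _))]
      exact hdom p t
  refine ⟨(∫ t, (Set.Icc (-T) T).indicator (fun _ => K) t) + K * Real.pi, fun p => ⟨hint p, ?_⟩⟩
  refine (integral_mono (hint p) (hi1.add (hi2 p)) (hdom p)).trans ?_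
  have e1 : ∫ t : ℝ, (1 + (p.im - t) ^ 2)⁻¹ = Real.pi := by
    rw [integral_sub_left_eq_self (fun t : ℝ => (1 + t ^ 2)⁻¹) volume p.im,
      integral_univ_inv_one_add_sq]
  simp only [Pi.add_apply]
  rw [integral_add hi1 (hi2 p), integral_const_mul, e1]

theorem intervalIntegrable_mul_deriv (h : IsVerticalPath γ) {g : ℝ → ℂ} (hg : Continuous g)
    (a b : ℝ) : IntervalIntegrable (fun t => g t * deriv γ t) volume a b := by
  obtain ⟨K, hK⟩ := h.bounded_deriv
  have h1 : IntervalIntegrable (deriv γ) volume a b :=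
    (intervalIntegrable_const (c := K)).mono_fun h.measurable_deriv.aestronglyMeasurable
      (Eventually.of_forall fun t => (hK t).trans (le_abs_self K))
  exact h1.continuousOn_mul hg.continuousOn

theorem intervalIntegral_eq_sub (h : IsVerticalPath γ) {F F' : ℂ → ℂ}
    (hF : ∀ t, HasDerivAt F (F' (γ t)) (γ t)) (hF' : Continuous fun t => F' (γ t)) (a b : ℝ) :
    ∫ t in a..b, F' (γ t) * deriv γ t = F (γ b) - F (γ a) := by
  obtain ⟨S, hS⟩ := h.differentiable
  refine integral_eq_of_hasDerivAt_off_countable (fun t => F (γ t)) _ S.countable_toSet ?_ ?_ ?_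
  · exact (continuous_iff_continuousAt.mpr fun t => ContinuousAt.comp (f := γ) (g := F)
      (hF t).continuousAt h.continuous.continuousAt).continuousOn
  · rintro t ⟨-, ht⟩
    exact (hF t).comp t (hS t ht).hasDerivAt
  · exact h.intervalIntegrable_mul_deriv hF' a b

end IsVerticalPath

/-- Only finitely many points of `T` have `|Re s| ≤ x + 1`, and each has positive distance from the
closed set `K`; all others are at distance at least `1`. -/
theorem StripFinite.exists_dist_le {T K : Set ℂ} (hT : StripFinite T) (hK : IsClosed K) {x : ℝ}
    (hKx : ∀ z ∈ K, |z.re| ≤ x) (hKT : ∀ s ∈ T, s ∉ K) :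
    ∃ ε, 0 < ε ∧ ∀ z ∈ K, ∀ s ∈ T, ε ≤ ‖z - s‖ := by
  rcases K.eq_empty_or_nonempty with rfl | hne
  · exact ⟨1, one_pos, by simp⟩
  have hfin := hT (x + 1)
  have key : ∃ ε, 0 < ε ∧ ∀ s ∈ hfin.toFinset, ε ≤ Metric.infDist s K := by
    by_cases h : hfin.toFinset.Nonempty
    · obtain ⟨s₀, hs₀, hmin⟩ := hfin.toFinset.exists_min_image (fun s => Metric.infDist s K) h
      refine ⟨_, (hK.notMem_iff_infDist_pos hne).mp (hKT s₀ ?_), hmin⟩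
      exact (hfin.mem_toFinset.mp hs₀).1
    · rw [Finset.not_nonempty_iff_eq_empty] at h
      exact ⟨1, one_pos, by simp [h]⟩
  obtain ⟨ε, hε, hmin⟩ := key
  refine ⟨min ε 1, lt_min hε one_pos, fun z hz s hs => ?_⟩
  by_cases hsx : |s.re| ≤ x + 1
  · refine (min_le_left _ _).trans ((hmin s (hfin.mem_toFinset.mpr ⟨hs, hsx⟩)).trans ?_)
    rw [← dist_eq_norm, dist_comm]
    exact Metric.infDist_le_dist_of_mem hz
  · push Not at hsx
    refine (min_le_right _ _).trans (le_trans ?_ (Complex.abs_re_le_norm _))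
    have := hKx z hz
    have h2 := abs_sub_abs_le_abs_sub s.re z.re
    rw [Complex.sub_re, abs_sub_comm]
    linarith

theorem StripFinite.isClosed {T : Set ℂ} (hT : StripFinite T) : IsClosed T := by
  rw [← isOpen_compl_iff, Metric.isOpen_iff]
  intro z hz
  obtain ⟨ε, hε, h⟩ := hT.exists_dist_le (K := {z}) isClosed_singleton (x := |z.re|)
    (by simp) (by rintro s hs rfl; exact hz hs)
  refine ⟨ε, hε, fun w hw hwT => ?_⟩
  have := h z rfl w hwT
  rw [mem_ball_iff_norm, norm_sub_rev] at hw
  linarith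

theorem StripFinite.union {T T' : Set ℂ} (h : StripFinite T) (h' : StripFinite T') :
    StripFinite (T ∪ T') := fun x =>
  ((h x).union (h' x)).subset fun _ hs => hs.1.imp (fun h => ⟨h, hs.2⟩) fun h => ⟨h, hs.2⟩

theorem StripFinite.countable {T : Set ℂ} (h : StripFinite T) : T.Countable := by
  have : T = ⋃ n : ℕ, {s ∈ T | |s.re| ≤ n} := by
    ext s
    simp only [Set.mem_iUnion, Set.mem_ofPred_eq]
    constructor
    · intro hs
      obtain ⟨n, hn⟩ := exists_nat_ge |s.re|
      exact ⟨n, hs, hn⟩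
    · rintro ⟨n, hs, -⟩
      exact hs
  rw [this]
  exact Set.countable_iUnion fun n => (h n).countable

/-- Functions holomorphic off `T` that decay along vertical strips, away from `T`. -/
structure DecayingOff (T : Set ℂ) (f : ℂ → ℂ) : Prop where
  differentiableOn : DifferentiableOn ℂ f Tᶜ
  bound : ∀ x ε : ℝ, 0 < ε → ∃ C, ∀ z : ℂ, |z.re| ≤ x → (∀ s ∈ T, ε ≤ ‖z - s‖) →
    ‖f z‖ ≤ C * decay z

theorem decay_neg (z : ℂ) : decay (-z) = decay z := by simp [decay]

theorem DecayingOff.integrable {T : Set ℂ} (hT : StripFinite T) {f : ℂ → ℂ}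
    (hf : DecayingOff T f) {γ : ℝ → ℂ} (hγ : IsVerticalPath γ) (hγT : ∀ s ∈ T, s ∉ Set.range γ) :
    Integrable (fun t => f (γ t) * deriv γ t) := by
  obtain ⟨x, hx⟩ := hγ.exists_abs_re_le
  obtain ⟨ε, hε, h⟩ := hT.exists_dist_le hγ.isClosed_range (x := x)
    (by rintro _ ⟨t, rfl⟩; exact hx t) hγT
  obtain ⟨C, hC⟩ := hf.bound x ε hε
  obtain ⟨K, hK⟩ := hγ.exists_integral_decay_le
  have hcont : Continuous fun t => f (γ t) :=
    hf.differentiableOn.continuousOn.comp_continuous hγ.continuous fun t ht => hγT _ ht ⟨t, rfl⟩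
  refine ((hK 0).1.const_mul C).mono' (hcont.measurable.mul
    hγ.measurable_deriv).aestronglyMeasurable (Eventually.of_forall fun t => ?_)
  rw [norm_mul, zero_sub, decay_neg, ← mul_assoc]
  exact mul_le_mul_of_nonneg_right (hC _ (hx t) fun s hs => h _ ⟨t, rfl⟩ s hs) (norm_nonneg _)

theorem tendsto_decay_atTop : Tendsto (fun T : ℝ => (1 + T ^ 2)⁻¹) atTop (𝓝 0) :=
  tendsto_inv_atTop_zero.comp (tendsto_atTop_add_const_left _ _ (tendsto_pow_atTop two_ne_zero))

/-- By the mean value inequality on the horizontal segment at height `± t`, where the derivative of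
`H` is `O(1/t)`. It closes up the ends of two vertical paths, `σ = ± 1` being the upper and the
lower end. -/
theorem tendsto_primitive_sub {H f r : ℂ → ℂ} {T : Set ℂ} (hT : StripFinite T)
    (hf : DecayingOff T f) {X : ℝ} {S : Finset ℂ} (hST : ∀ s ∈ S, s ∈ T ∧ |s.re| < X)
    (hH : ∀ z, |z.re| < X → z ∉ S → HasDerivAt H (f z - ∑ s ∈ S, r s / (z - s)) z)
    {c₁ c₂ : ℝ} (h₁ : |c₁| < X) (h₂ : |c₂| < X) (σ : ℝ) (hσ : σ = 1 ∨ σ = -1) :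
    Tendsto (fun t : ℝ => H ((c₁ : ℂ) + (σ * t : ℝ) * Complex.I) -
      H ((c₂ : ℂ) + (σ * t : ℝ) * Complex.I)) atTop (𝓝 0) := by
  obtain ⟨B, hB⟩ : ∃ B, ∀ s ∈ T, |s.re| ≤ X + 1 → |s.im| ≤ B := by
    obtain ⟨B, hB⟩ := ((hT (X + 1)).image fun s => |s.im|).bddAbove
    exact ⟨B, fun s hs hsx => hB ⟨s, ⟨hs, hsx⟩, rfl⟩⟩
  obtain ⟨C, hC⟩ := hf.bound X 1 one_pos
  have hlim : Tendsto (fun t : ℝ => (|C| * (1 + t ^ 2)⁻¹ + ∑ s ∈ S, ‖r s‖ / (t - B)) *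
      ‖(c₁ : ℂ) - c₂‖) atTop (𝓝 0) := by
    have h1 := (tendsto_decay_atTop.const_mul |C|)
    have h2 : Tendsto (fun t : ℝ => ∑ s ∈ S, ‖r s‖ / (t - B)) atTop (𝓝 (∑ s ∈ S, 0)) :=
      tendsto_finsetSum _ fun s _ => Tendsto.div_atTop tendsto_const_nhds
        (tendsto_atTop_add_const_right _ (-B) tendsto_id)
    have h3 := (h1.add h2).mul_const ‖(c₁ : ℂ) - c₂‖
    simpa using h3
  refine squeeze_zero_norm' ?_ hlim
  filter_upwards [eventually_gt_atTop (B + 1), eventually_gt_atTop 0] with t ht ht0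
  have hσ1 : |σ * t| = t := by
    rcases hσ with rfl | rfl <;> simp [abs_of_pos ht0]
  set A : Set ℂ := {z | |z.re| < X ∧ z.im = σ * t} with hA
  have hAc : Convex ℝ A := by
    have e : A = {z | -X < z.re} ∩ {z | z.re < X} ∩ {z | z.im = σ * t} := by
      ext z; simp only [hA, Set.mem_ofPred_eq, abs_lt, Set.mem_inter_iff]
    rw [e]
    exact ((convex_halfSpace_re_gt _).inter (convex_halfSpace_re_lt _)).inter
      (convex_hyperplane (Complex.imLm.isLinear) _)
  have hdist : ∀ z ∈ A, ∀ s ∈ T, |s.re| ≤ X + 1 → t - B ≤ ‖z - s‖ := by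
    rintro z ⟨-, hz⟩ s hs hsx
    have h1 := hB s hs hsx
    have h2 := Complex.abs_im_le_norm (z - s)
    rw [Complex.sub_im, hz] at h2
    have h3 := abs_sub_abs_le_abs_sub (σ * t) s.im
    rw [hσ1] at h3
    linarith
  have hTd : ∀ z ∈ A, ∀ s ∈ T, 1 ≤ ‖z - s‖ := by
    intro z hz s hs
    by_cases hsx : |s.re| ≤ X + 1
    · have := hdist z hz s hs hsx; linarith
    · push Not at hsx
      refine le_trans ?_ (Complex.abs_re_le_norm _)
      have h2 := abs_sub_abs_le_abs_sub s.re z.re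
      rw [Complex.sub_re, abs_sub_comm]
      have := hz.1
      linarith
  have hAS : ∀ z ∈ A, z ∉ S := by
    intro z hz hzS
    have := hTd z hz z (hST z hzS).1
    simp at this
    linarith
  have hmain := Convex.norm_image_sub_le_of_norm_hasDerivWithin_le (f := H)
    (f' := fun z => f z - ∑ s ∈ S, r s / (z - s)) (s := A)
    (C := |C| * (1 + t ^ 2)⁻¹ + ∑ s ∈ S, ‖r s‖ / (t - B))
    (fun z hz => (hH z hz.1 (hAS z hz)).hasDerivWithinAt)
    (fun z hz => by
      refine (norm_sub_le _ _).trans (add_le_add ?_ ((norm_sum_le _ _).trans ?_))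
      · refine (hC z hz.1.le (hTd z hz)).trans ?_
        rw [decay, hz.2, ← sq_abs, hσ1]
        exact mul_le_mul_of_nonneg_right (le_abs_self C) (by positivity)
      · refine Finset.sum_le_sum fun s hs => ?_
        rw [norm_div]
        have h1 := hdist z hz s (hST s hs).1 (by linarith [(hST s hs).2])
        exact div_le_div_of_nonneg_left (norm_nonneg _) (by linarith) h1)
    hAc (x := (c₂ : ℂ) + (σ * t : ℝ) * Complex.I) (y := (c₁ : ℂ) + (σ * t : ℝ) * Complex.I)
    (by simpa [hA] using h₂) (by simpa [hA] using h₁)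
  simpa using hmain

/-- The integral of `dz / (z - w)` over the part of `γ` with parameter in `[-T, T]`. -/
def windingIntegral (γ : ℝ → ℂ) (w : ℂ) (T : ℝ) : ℂ := ∫ t in (-T)..T, deriv γ t / (γ t - w)

/-- Two vertical paths: the integrals of a decaying function differ by residues. -/
theorem exists_residues {T : Set ℂ} (hT : StripFinite T) {f : ℂ → ℂ} (hf : DecayingOff T f) (X : ℝ) :
    ∃ (S : Finset ℂ) (r : ℂ → ℂ), (∀ s, s ∈ S ↔ s ∈ T ∧ |s.re| < X) ∧
      (∀ s ∈ S, ∀ ρ, 0 < ρ → |s.re| + ρ < X → (∀ s' ∈ T, s' ≠ s → ρ < dist s' s) →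
        (∮ z in C(s, ρ), f z) = 2 * Real.pi * Complex.I * r s) ∧
      ∀ γ₁ γ₂ : ℝ → ℂ, IsVerticalPath γ₁ → IsVerticalPath γ₂ →
        (∀ t, |(γ₁ t).re| < X) → (∀ t, |(γ₂ t).re| < X) →
        (∀ s ∈ T, s ∉ Set.range γ₁) → (∀ s ∈ T, s ∉ Set.range γ₂) →
        ∀ i₁ i₂ : ℂ → ℂ, (∀ s ∈ T, Tendsto (windingIntegral γ₁ s) atTop (𝓝 (i₁ s))) →
          (∀ s ∈ T, Tendsto (windingIntegral γ₂ s) atTop (𝓝 (i₂ s))) →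
          (∫ t, f (γ₁ t) * deriv γ₁ t) - ∑ s ∈ S, r s * i₁ s =
            (∫ t, f (γ₂ t) * deriv γ₂ t) - ∑ s ∈ S, r s * i₂ s := by
  classical
  set S : Finset ℂ := (hT X).toFinset.filter fun s => |s.re| < X with hS
  have hSmem : ∀ s, s ∈ S ↔ s ∈ T ∧ |s.re| < X := fun s => by
    simp only [hS, Finset.mem_filter, Set.Finite.mem_toFinset, Set.mem_ofPred_eq]
    exact ⟨fun h => ⟨h.1.1, h.2⟩, fun h => ⟨⟨h.1, h.2.le⟩, h.2⟩⟩
  set U : Set ℂ := {z | |z.re| < X} with hUdef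
  have hU : IsOpen U := isOpen_lt (Complex.continuous_re.abs) continuous_const
  have hUc : Convex ℝ U := by
    have e : U = {z | -X < z.re} ∩ {z | z.re < X} := by
      ext z; simp only [hUdef, Set.mem_ofPred_eq, abs_lt, Set.mem_inter_iff]
    rw [e]
    exact (convex_halfSpace_re_gt _).inter (convex_halfSpace_re_lt _)
  have hUS : U \ S ⊆ Tᶜ := fun z hz hzT => hz.2 ((hSmem z).mpr ⟨hzT, hz.1⟩)
  obtain ⟨H, r, hH⟩ := exists_primitive_sub_simple_poles hU hUc S (hf.differentiableOn.mono hUS)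
  refine ⟨S, r, hSmem, ?_, ?_⟩
  · intro s hs ρ hρ hρX hiso
    refine circleIntegral_eq_residue (hf.differentiableOn.continuousOn.mono hUS) hH hs hρ ?_
      fun s' hs' hne => hiso s' ((hSmem s').mp hs').1 hne
    intro z hz
    rw [mem_closedBall_iff_norm] at hz
    have h1 := Complex.abs_re_le_norm (z - s)
    rw [Complex.sub_re] at h1
    have h2 := abs_sub_abs_le_abs_sub z.re s.re
    show |z.re| < X
    linarith
  · intro γ₁ γ₂ hγ₁ hγ₂ hX₁ hX₂ hT₁ hT₂ i₁ i₂ hi₁ hi₂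
    -- The truncated integral, corrected by residues times winding integrals, depends only on the
    -- two end points; for two paths these differ by amounts that tend to `0`.
    have hD : ∀ (γ : ℝ → ℂ), IsVerticalPath γ → (∀ t, |(γ t).re| < X) →
        (∀ s ∈ T, s ∉ Set.range γ) → ∀ t : ℝ,
        (∫ u in (-t)..t, f (γ u) * deriv γ u) - ∑ s ∈ S, r s * windingIntegral γ s t =
          H (γ t) - H (γ (-t)) := by
      intro γ hγ hX hTγ t
      have hne : ∀ s ∈ S, ∀ u, γ u - s ≠ 0 := fun s hs u h =>
        hTγ s ((hSmem s).mp hs).1 ⟨u, sub_eq_zero.mp h⟩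
      have hγS : ∀ u, γ u ∉ S := fun u hu => hTγ _ ((hSmem _).mp hu).1 ⟨u, rfl⟩
      have hfc : Continuous fun u => f (γ u) :=
        hf.differentiableOn.continuousOn.comp_continuous hγ.continuous
          fun u hu => hTγ _ hu ⟨u, rfl⟩
      have hgc : ∀ s ∈ S, Continuous fun u => r s / (γ u - s) := fun s hs =>
        continuous_const.div (hγ.continuous.sub continuous_const) (hne s hs)
      have h1 := hγ.intervalIntegral_eq_sub (F := H) (F' := fun z => f z - ∑ s ∈ S, r s / (z - s))
        (fun u => hH _ (hX u) (hγS u)) (hfc.sub (continuous_finsetSum _ hgc)) (-t) t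
      rw [← h1]
      simp only [sub_mul, Finset.sum_mul]
      rw [intervalIntegral.integral_sub (hγ.intervalIntegrable_mul_deriv hfc _ _),
        intervalIntegral.integral_finsetSum]
      · congr 1
        refine Finset.sum_congr rfl fun s _ => ?_
        rw [windingIntegral, ← intervalIntegral.integral_const_mul]
        congr 1
        ext u
        ring
      · exact fun s hs => hγ.intervalIntegrable_mul_deriv (hgc s hs) _ _
      · simp only [← Finset.sum_mul]
        exact hγ.intervalIntegrable_mul_deriv (continuous_finsetSum _ hgc) _ _
    have hlim : ∀ (γ : ℝ → ℂ) (i : ℂ → ℂ), IsVerticalPath γ →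
        (∀ s ∈ T, s ∉ Set.range γ) → (∀ s ∈ T, Tendsto (windingIntegral γ s) atTop (𝓝 (i s))) →
        Tendsto (fun t : ℝ => (∫ u in (-t)..t, f (γ u) * deriv γ u) -
          ∑ s ∈ S, r s * windingIntegral γ s t) atTop
          (𝓝 ((∫ t, f (γ t) * deriv γ t) - ∑ s ∈ S, r s * i s)) := by
      intro γ i hγ hTγ hi
      refine (intervalIntegral_tendsto_integral (hf.integrable hT hγ hTγ) tendsto_neg_atTop_atBot
        tendsto_id).sub (tendsto_finsetSum _ fun s hs => (hi s ((hSmem s).mp hs).1).const_mul _)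
    obtain ⟨c₁, T₁, hT₁0, hv₁⟩ := hγ₁.exists_vertical
    obtain ⟨c₂, T₂, hT₂0, hv₂⟩ := hγ₂.exists_vertical
    have hc₁ : |c₁| < X := by
      have := hX₁ T₁; rw [hv₁ T₁ (le_abs_self _)] at this; simpa using this
    have hc₂ : |c₂| < X := by
      have := hX₂ T₂; rw [hv₂ T₂ (le_abs_self _)] at this; simpa using this
    have hp := tendsto_primitive_sub hT hf (fun s hs => (hSmem s).mp hs) hH hc₁ hc₂ 1 (Or.inl rfl)
    have hm := tendsto_primitive_sub hT hf (fun s hs => (hSmem s).mp hs) hH hc₁ hc₂ (-1) (Or.inr rfl)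
    have h0 := hp.sub hm
    have h1 := (hlim γ₁ i₁ hγ₁ hT₁ hi₁).sub (hlim γ₂ i₂ hγ₂ hT₂ hi₂)
    rw [← sub_eq_zero]
    refine tendsto_nhds_unique h1 ?_
    rw [sub_zero] at h0
    refine h0.congr' ?_
    filter_upwards [eventually_ge_atTop T₁, eventually_ge_atTop T₂] with t ht₁ ht₂
    rw [hD γ₁ hγ₁ hX₁ hT₁, hD γ₂ hγ₂ hX₂ hT₂, hv₁ t (ht₁.trans (le_abs_self t)),
      hv₁ (-t) (by rw [abs_neg]; exact ht₁.trans (le_abs_self t)),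
      hv₂ t (ht₂.trans (le_abs_self t)),
      hv₂ (-t) (by rw [abs_neg]; exact ht₂.trans (le_abs_self t))]
    simp only [one_mul, neg_mul]
    push_cast
    ring

/-! ### Winding of vertical lines -/

/-- The upward vertical line with real part `c`. -/
def vline (c : ℝ) (t : ℝ) : ℂ := (c : ℂ) + (t : ℂ) * Complex.I

theorem hasDerivAt_vline (c t : ℝ) : HasDerivAt (vline c) Complex.I t := by
  have h0 : HasDerivAt (fun t : ℝ => (t : ℂ)) 1 t := Complex.ofRealCLM.hasDerivAt
  exact ((h0.mul_const Complex.I).const_add (c : ℂ)).congr_deriv (one_mul _)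

@[simp] theorem deriv_vline (c t : ℝ) : deriv (vline c) t = Complex.I := (hasDerivAt_vline c t).deriv

@[simp] theorem vline_re (c t : ℝ) : (vline c t).re = c := by simp [vline]

@[simp] theorem vline_im (c t : ℝ) : (vline c t).im = t := by simp [vline]

theorem continuous_vline (c : ℝ) : Continuous (vline c) := by unfold vline; fun_prop

theorem isVerticalPath_vline (c : ℝ) : IsVerticalPath (vline c) where
  continuous := continuous_vline c
  differentiable := ⟨∅, fun t _ => (hasDerivAt_vline c t).differentiableAt⟩
  bounded_deriv := ⟨1, fun t => by simp⟩
  vertical := ⟨c, 0, fun _ _ => rfl⟩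

/-- The two ends of a vertical line are asymptotically equally far from a given point, so the
modulus part of the winding integral disappears in the limit. -/
theorem tendsto_log_ratio (a b : ℝ) (ha : a ≠ 0) :
    Tendsto (fun T : ℝ => Real.log (a ^ 2 + (T - b) ^ 2) - Real.log (a ^ 2 + (-T - b) ^ 2)) atTop
      (𝓝 0) := by
  have hpos : ∀ u : ℝ, 0 < a ^ 2 + u ^ 2 := fun u => by positivity
  have h1 : Tendsto (fun T : ℝ => (a ^ 2 + (T - b) ^ 2) / (a ^ 2 + (-T - b) ^ 2)) atTop (𝓝 1) := by
    have h2 : Tendsto (fun T : ℝ => -(4 * b * T) / (a ^ 2 + (-T - b) ^ 2)) atTop (𝓝 0) := by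
      have h3 : Tendsto (fun T : ℝ => 16 * |b| / T) atTop (𝓝 0) :=
        tendsto_const_nhds.div_atTop tendsto_id
      refine squeeze_zero_norm' ?_ h3
      filter_upwards [eventually_gt_atTop (2 * |b|), eventually_gt_atTop 0] with T hT hT0
      rw [norm_div, norm_neg, Real.norm_of_nonneg (hpos _).le, Real.norm_eq_abs, abs_mul, abs_mul,
        abs_of_pos hT0, div_le_div_iff₀ (hpos _) hT0]
      have h4 : T / 2 ≤ T + b := by have := neg_abs_le b; linarith
      have h5 : T ^ 2 / 4 ≤ (-T - b) ^ 2 := by nlinarith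
      rw [abs_of_pos (by norm_num : (0 : ℝ) < 4)]
      have h6 := mul_le_mul_of_nonneg_left h5 (abs_nonneg b)
      nlinarith [abs_nonneg b, sq_nonneg a, mul_nonneg (abs_nonneg b) (sq_nonneg a)]
    have h7 := h2.add_const 1
    rw [zero_add] at h7
    refine h7.congr fun T => ?_
    have := (hpos (-T - b)).ne'
    field_simp
    ring
  have h8 := (Real.continuousAt_log one_ne_zero).tendsto.comp h1
  rw [Real.log_one] at h8
  refine h8.congr fun T => ?_
  rw [Function.comp, Real.log_div (hpos _).ne' (hpos _).ne']

/-- A branch of `log (vline c t - w)` is written, up to a constant, through `arctan ((t - Im w)/(c -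
Re w))`, which is smooth in `t` on either side of the line. -/
theorem windingIntegral_vline {c : ℝ} {w : ℂ} (hw : w.re ≠ c) (T : ℝ) :
    windingIntegral (vline c) w T =
      ((Real.log ((c - w.re) ^ 2 + (T - w.im) ^ 2) -
        Real.log ((c - w.re) ^ 2 + (-T - w.im) ^ 2)) / 2 : ℝ) +
      ((Real.arctan ((T - w.im) / (c - w.re)) - Real.arctan ((-T - w.im) / (c - w.re)) : ℝ) : ℂ) *
        Complex.I := by
  set a := c - w.re with ha
  have ha0 : a ≠ 0 := sub_ne_zero.mpr (Ne.symm hw)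
  have hpos : ∀ u : ℝ, 0 < a ^ 2 + u ^ 2 := fun u => by positivity
  have hne : ∀ t, vline c t - w ≠ 0 := fun t h => by
    have := congrArg Complex.re h
    simp at this
    exact ha0 this
  have hderiv : ∀ t : ℝ, HasDerivAt (fun t : ℝ => ((Real.log (a ^ 2 + (t - w.im) ^ 2) / 2 : ℝ) : ℂ) +
      ((Real.arctan ((t - w.im) / a) : ℝ) : ℂ) * Complex.I) (deriv (vline c) t / (vline c t - w)) t := by
    intro t
    have h0 : HasDerivAt (fun t : ℝ => t - w.im) 1 t := (hasDerivAt_id t).sub_const _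
    have h1 : HasDerivAt (fun t : ℝ => Real.log (a ^ 2 + (t - w.im) ^ 2) / 2)
        ((2 * (t - w.im)) / (a ^ 2 + (t - w.im) ^ 2) / 2) t := by
      have := (((h0.fun_pow 2).const_add (a ^ 2)).log (hpos _).ne').div_const 2
      simpa using this
    have h2 : HasDerivAt (fun t : ℝ => Real.arctan ((t - w.im) / a))
        (1 / (1 + ((t - w.im) / a) ^ 2) * (1 / a)) t := (h0.div_const a).arctan
    refine (h1.ofReal_comp.add (h2.ofReal_comp.mul_const Complex.I)).congr_deriv ?_
    rw [deriv_vline, eq_div_iff (hne t)]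
    have e : vline c t - w = (a : ℂ) + ((t - w.im : ℝ) : ℂ) * Complex.I := by
      apply Complex.ext <;> simp [ha]
    rw [e]
    have hp := (hpos (t - w.im)).ne'
    have e2 : 1 / (1 + ((t - w.im) / a) ^ 2) * (1 / a) = a / (a ^ 2 + (t - w.im) ^ 2) := by
      field_simp
    have e1 : 2 * (t - w.im) / (a ^ 2 + (t - w.im) ^ 2) / 2 =
        (t - w.im) / (a ^ 2 + (t - w.im) ^ 2) := by field_simp
    rw [e1, e2]
    have hpC : ((a : ℂ) ^ 2 + ((t - w.im : ℝ) : ℂ) ^ 2) ≠ 0 := by exact_mod_cast hp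
    rw [Complex.ofReal_div, Complex.ofReal_div]
    generalize t - w.im = u at *
    push_cast at hpC ⊢
    field_simp
    linear_combination (a * u) * Complex.I_sq
  rw [windingIntegral, intervalIntegral.integral_eq_sub_of_hasDerivAt (fun t _ => hderiv t)]
  · push_cast
    ring
  · refine Continuous.intervalIntegrable ?_ _ _
    simp only [deriv_vline]
    exact continuous_const.div ((continuous_vline c).sub continuous_const) hne

theorem tendsto_windingIntegral_vline_of_lt {c : ℝ} {w : ℂ} (hw : w.re < c) :
    Tendsto (windingIntegral (vline c) w) atTop (𝓝 (Real.pi * Complex.I)) := by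
  have ha : 0 < c - w.re := sub_pos.mpr hw
  have h1 := (tendsto_log_ratio (c - w.re) w.im ha.ne').div_const 2
  have h2 : Tendsto (fun T : ℝ => Real.arctan ((T - w.im) / (c - w.re))) atTop (𝓝 (Real.pi / 2)) :=
    (Real.tendsto_arctan_atTop.mono_right nhdsWithin_le_nhds).comp
      ((tendsto_atTop_add_const_right _ (-w.im) tendsto_id).atTop_div_const ha)
  have h3 : Tendsto (fun T : ℝ => Real.arctan ((-T - w.im) / (c - w.re))) atTop
      (𝓝 (-(Real.pi / 2))) :=
    (Real.tendsto_arctan_atBot.mono_right nhdsWithin_le_nhds).comp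
      ((tendsto_atBot_add_const_right _ (-w.im) tendsto_neg_atTop_atBot).atBot_div_const ha)
  have h4 := (Complex.continuous_ofReal.tendsto _).comp h1
  have h5 := ((Complex.continuous_ofReal.tendsto _).comp (h2.sub h3)).mul_const Complex.I
  have h6 := h4.add h5
  rw [zero_div, Complex.ofReal_zero, zero_add, sub_neg_eq_add, add_halves] at h6
  exact h6.congr fun T => (windingIntegral_vline hw.ne T).symm

theorem tendsto_windingIntegral_vline_of_gt {c : ℝ} {w : ℂ} (hw : c < w.re) :
    Tendsto (windingIntegral (vline c) w) atTop (𝓝 (-(Real.pi * Complex.I))) := by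
  have ha : c - w.re < 0 := sub_neg.mpr hw
  have h1 := (tendsto_log_ratio (c - w.re) w.im ha.ne).div_const 2
  have h2 : Tendsto (fun T : ℝ => Real.arctan ((T - w.im) / (c - w.re))) atTop
      (𝓝 (-(Real.pi / 2))) :=
    (Real.tendsto_arctan_atBot.mono_right nhdsWithin_le_nhds).comp
      ((tendsto_atTop_add_const_right _ (-w.im) tendsto_id).atTop_div_const_of_neg ha)
  have h3 : Tendsto (fun T : ℝ => Real.arctan ((-T - w.im) / (c - w.re))) atTop
      (𝓝 (Real.pi / 2)) :=
    (Real.tendsto_arctan_atTop.mono_right nhdsWithin_le_nhds).comp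
      ((tendsto_div_const_atTop_of_neg ha).mpr
        (tendsto_atBot_add_const_right _ (-w.im) tendsto_neg_atTop_atBot))
  have h4 := (Complex.continuous_ofReal.tendsto _).comp h1
  have h5 := ((Complex.continuous_ofReal.tendsto _).comp (h2.sub h3)).mul_const Complex.I
  have h6 := h4.add h5
  rw [zero_div, Complex.ofReal_zero, zero_add, ← neg_add', add_halves, Complex.ofReal_neg,
    neg_mul] at h6
  exact h6.congr fun T => (windingIntegral_vline hw.ne' T).symm

/-! ### Cycles made of a path and circles -/

/-- A cycle of integration: a path together with finitely many circles of a common radius. -/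
structure Chain where
  path : ℝ → ℂ
  centers : Finset ℂ
  radius : ℝ

namespace Chain

def int (C : Chain) (f : ℂ → ℂ) : ℂ :=
  (∫ t, f (C.path t) * deriv C.path t) + ∑ l ∈ C.centers, ∮ z in C(l, C.radius), f z

def supp (C : Chain) : Set ℂ := Set.range C.path ∪ ⋃ l ∈ C.centers, Metric.sphere l C.radius

structure IsRegular (C : Chain) : Prop where
  path : IsVerticalPath C.path
  radius_pos : 0 < C.radius

variable {C : Chain}

theorem path_mem_supp (C : Chain) (t : ℝ) : C.path t ∈ C.supp := Or.inl ⟨t, rfl⟩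

theorem sphere_subset_supp {l : ℂ} (hl : l ∈ C.centers) : Metric.sphere l C.radius ⊆ C.supp :=
  fun _ hz => Or.inr (Set.mem_biUnion hl hz)

/-- The constant belongs to the cycle alone; the centre `p` of the decay is free, by the uniformity
in `exists_integral_decay_le`. -/
theorem IsRegular.exists_norm_int_le (h : C.IsRegular) : ∃ K, 0 ≤ K ∧ ∀ (p : ℂ) (f : ℂ → ℂ) (M : ℝ),
    0 ≤ M → (∀ z ∈ C.supp, ‖f z‖ ≤ M * decay (p - z)) → ‖C.int f‖ ≤ M * K := by
  obtain ⟨K, hK⟩ := h.path.exists_integral_decay_le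
  have hK0 : 0 ≤ K := (integral_nonneg fun t =>
    mul_nonneg (decay_pos (0 - C.path t)).le (norm_nonneg (deriv C.path t))).trans (hK 0).2
  have hr := h.radius_pos
  refine ⟨K + ∑ l ∈ C.centers, 2 * Real.pi * C.radius, by positivity, fun p f M hM hf => ?_⟩
  rw [Chain.int, mul_add, Finset.mul_sum]
  refine (norm_add_le _ _).trans (add_le_add ?_ ((norm_sum_le _ _).trans
    (Finset.sum_le_sum fun l hl => ?_)))
  · refine (norm_integral_le_of_norm_le ((hK p).1.const_mul M)
      (Eventually.of_forall fun t => ?_)).trans ?_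
    · rw [norm_mul, ← mul_assoc]
      exact mul_le_mul_of_nonneg_right (hf _ (C.path_mem_supp t)) (norm_nonneg _)
    · rw [integral_const_mul]
      exact mul_le_mul_of_nonneg_left (hK p).2 hM
  · refine (circleIntegral.norm_integral_le_of_norm_le_const hr.le (C := M) fun z hz => ?_).trans
      (le_of_eq (by ring))
    exact (hf z (sphere_subset_supp hl hz)).trans (mul_le_of_le_one_right hM (decay_le_one _))

theorem IsRegular.differentiableOn_int (h : C.IsRegular) {E : Type*} [NormedAddCommGroup E]
    [NormedSpace ℂ E] [FiniteDimensional ℂ E] {O : Set E} (hO : IsOpen O) {F : E → ℂ → ℂ} {M : ℝ}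
    (hM : 0 ≤ M)
    (hd : ∀ z ∈ C.supp, DifferentiableOn ℂ (fun p => F p z) O)
    (hc : ∀ p ∈ O, ContinuousOn (F p) C.supp)
    (hb : ∀ p ∈ O, ∀ z ∈ C.supp, ‖F p z‖ ≤ M * decay z) :
    DifferentiableOn ℂ (fun p => C.int (F p)) O := by
  obtain ⟨K, hK⟩ := h.path.exists_integral_decay_le
  refine DifferentiableOn.add ?_ (DifferentiableOn.fun_sum fun l hl => ?_)
  · refine differentiableOn_integral hO (fun t => (hd _ (C.path_mem_supp t)).mul_const _) ?_
      ((hK 0).1.const_mul M) fun p hp t => ?_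
    · intro p hp
      have : Continuous fun t => F p (C.path t) :=
        (hc p hp).comp_continuous h.path.continuous C.path_mem_supp
      exact (this.measurable.mul h.path.measurable_deriv).aestronglyMeasurable
    · rw [norm_mul, zero_sub, decay_neg, ← mul_assoc]
      exact mul_le_mul_of_nonneg_right (hb p hp _ (C.path_mem_supp t)) (norm_nonneg _)
  · have hmem : ∀ θ, circleMap l C.radius θ ∈ C.supp := fun θ =>
      sphere_subset_supp hl (circleMap_mem_sphere l h.radius_pos.le θ)
    have := differentiableOn_integral (μ := volume.restrict (Set.Ioc 0 (2 * Real.pi))) hO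
      (F := fun p θ => deriv (circleMap l C.radius) θ • F p (circleMap l C.radius θ))
      (fun θ => (hd _ (hmem θ)).fun_const_smul _)
      (fun p hp => by
        have : Continuous fun θ => F p (circleMap l C.radius θ) :=
          (hc p hp).comp_continuous (continuous_circleMap _ _) hmem
        simp only [deriv_circleMap]
        exact (((continuous_circleMap 0 C.radius).mul continuous_const).smul this).aestronglyMeasurable)
      (B := fun _ => C.radius * M) (integrable_const _)
      (fun p hp θ => by
        rw [norm_smul, deriv_circleMap, norm_mul, norm_circleMap_zero, abs_of_pos h.radius_pos,
          Complex.norm_I, mul_one]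
        exact mul_le_mul_of_nonneg_left ((hb p hp _ (hmem θ)).trans
          (mul_le_of_le_one_right hM (decay_le_one _))) h.radius_pos.le)
    refine this.congr fun p _ => ?_
    rw [circleIntegral, intervalIntegral.integral_of_le (by positivity)]

theorem int_congr (h : C.IsRegular) {f g : ℂ → ℂ} (hfg : ∀ z ∈ C.supp, f z = g z) :
    C.int f = C.int g := by
  rw [Chain.int, Chain.int]
  congr 1
  · congr 1
    ext t
    rw [hfg _ (C.path_mem_supp t)]
  · refine Finset.sum_congr rfl fun l hl => ?_
    exact circleIntegral.integral_congr h.radius_pos.le fun z hz => hfg z (sphere_subset_supp hl hz)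

theorem IsRegular.isClosed_supp (h : C.IsRegular) : IsClosed C.supp :=
  h.path.isClosed_range.union
    (C.centers.finite_toSet.isClosed_biUnion fun _ _ => Metric.isClosed_sphere)

theorem IsRegular.exists_abs_re_le (h : C.IsRegular) : ∃ x, ∀ z ∈ C.supp, |z.re| ≤ x := by
  obtain ⟨x, hx⟩ := h.path.exists_abs_re_le
  refine ⟨max x (∑ l ∈ C.centers, |l.re| + C.radius), ?_⟩
  rintro z (⟨t, rfl⟩ | hz)
  · exact (hx t).trans (le_max_left _ _)
  · refine le_trans ?_ (le_max_right _ _)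
    obtain ⟨l, hl, hz⟩ := Set.mem_iUnion₂.mp hz
    have h1 := Finset.single_le_sum (f := fun l : ℂ => |l.re|) (fun _ _ => abs_nonneg _) hl
    have h2 := Complex.abs_re_le_norm (z - l)
    rw [mem_sphere_iff_norm.mp hz, Complex.sub_re] at h2
    have h3 := abs_sub_abs_le_abs_sub z.re l.re
    linarith

end Chain

/-- The cycle `C` has the points of `L` on its left and the points of `R` on its right; points of
`L` to the right of the path of `C` are encircled. -/
structure Separates (C : Chain) (L R : Set ℂ) : Prop extends C.IsRegular where
  avoid : ∀ s ∈ L ∪ R, s ∉ Set.range C.path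
  centers_subset : ∀ l ∈ C.centers, l ∈ L
  isolated : ∀ l ∈ C.centers, ∀ s ∈ L ∪ R, s ≠ l → C.radius < dist s l
  left : ∀ w ∈ L, w ∉ C.centers →
    Tendsto (windingIntegral C.path w) atTop (𝓝 (Real.pi * Complex.I))
  left_center : ∀ w ∈ C.centers,
    Tendsto (windingIntegral C.path w) atTop (𝓝 (-(Real.pi * Complex.I)))
  right : ∀ w ∈ R, Tendsto (windingIntegral C.path w) atTop (𝓝 (-(Real.pi * Complex.I)))

namespace Separates

variable {C C' : Chain} {L R : Set ℂ}

theorem notMem_supp (h : Separates C L R) {s : ℂ} (hs : s ∈ L ∪ R) : s ∉ C.supp := by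
  rintro (hz | hz)
  · exact h.avoid s hs hz
  · obtain ⟨l, hl, hz⟩ := Set.mem_iUnion₂.mp hz
    rw [Metric.mem_sphere] at hz
    have hr := h.radius_pos
    by_cases hsl : s = l
    · rw [hsl, dist_self] at hz; linarith
    · have := h.isolated l hl s hs hsl; linarith

theorem exists_dist_le (h : Separates C L R) (hT : StripFinite (L ∪ R)) :
    ∃ x ε, 0 < ε ∧ ∀ z ∈ C.supp, |z.re| ≤ x ∧ ∀ s ∈ L ∪ R, ε ≤ ‖z - s‖ := by
  obtain ⟨x, hx⟩ := h.toIsRegular.exists_abs_re_le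
  obtain ⟨ε, hε, h1⟩ := hT.exists_dist_le h.toIsRegular.isClosed_supp hx fun s hs => h.notMem_supp hs
  exact ⟨x, ε, hε, fun z hz => ⟨hx z hz, h1 z hz⟩⟩

/-- Counting the circles, every point of `L` has total index `πi` and every other singularity has
`-πi`, for any separating cycle. By `exists_residues` the integral is determined by these indices.
-/
theorem int_eq (h : Separates C L R) (h' : Separates C' L R) (hT : StripFinite (L ∪ R)) {f : ℂ → ℂ}
    (hf : DecayingOff (L ∪ R) f) : C.int f = C'.int f := by
  classical
  have hX : ∀ {C : Chain}, Separates C L R → ∃ X, (∀ t, |(C.path t).re| ≤ X) ∧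
      ∀ l ∈ C.centers, |l.re| + C.radius ≤ X := by
    intro C h
    obtain ⟨x, hx⟩ := h.path.exists_abs_re_le
    refine ⟨max x (∑ l ∈ C.centers, |l.re| + C.radius), fun t => (hx t).trans (le_max_left _ _),
      fun l hl => le_trans ?_ (le_max_right _ _)⟩
    have h1 := Finset.single_le_sum (f := fun l : ℂ => |l.re|) (fun _ _ => abs_nonneg _) hl
    simpa using h1
  obtain ⟨X₁, hX₁, hX₁'⟩ := hX h
  obtain ⟨X₂, hX₂, hX₂'⟩ := hX h'
  set X := max X₁ X₂ + 1
  have hlt₁ : ∀ y, y ≤ X₁ → y < X := fun y hy =>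
    (hy.trans (le_max_left X₁ X₂)).trans_lt (lt_add_one _)
  have hlt₂ : ∀ y, y ≤ X₂ → y < X := fun y hy =>
    (hy.trans (le_max_right X₁ X₂)).trans_lt (lt_add_one _)
  obtain ⟨S, r, hS, hres, hmain⟩ := exists_residues hT hf X
  -- A centre lies to the right of the path; its defect of `2πi` is exactly what its circle
  -- supplies.
  have hw : ∀ {C : Chain}, Separates C L R → ∀ s ∈ L ∪ R, Tendsto (windingIntegral C.path s) atTop
      (𝓝 (((if s ∈ L then 1 else -1) - (if s ∈ C.centers then 2 else 0)) *
        (Real.pi * Complex.I))) := by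
    intro C h s hs
    by_cases h1 : s ∈ C.centers
    · rw [if_pos h1, if_pos (h.centers_subset s h1)]
      convert h.left_center s h1 using 2
      ring
    · rw [if_neg h1]
      by_cases h2 : s ∈ L
      · rw [if_pos h2]
        convert h.left s h2 h1 using 2
        ring
      · rw [if_neg h2]
        convert h.right s (hs.resolve_left h2) using 2
        ring
  have key := hmain _ _ h.path h'.path (fun t => hlt₁ _ (hX₁ t)) (fun t => hlt₂ _ (hX₂ t))
    h.avoid h'.avoid _ _ (hw h) (hw h')
  have hsum : ∀ {C : Chain}, Separates C L R → (∀ l ∈ C.centers, |l.re| + C.radius < X) →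
      C.int f - ∑ s ∈ S, r s * ((if s ∈ L then 1 else -1) * (Real.pi * Complex.I)) =
      (∫ t, f (C.path t) * deriv C.path t) - ∑ s ∈ S, r s *
        (((if s ∈ L then 1 else -1) - (if s ∈ C.centers then 2 else 0)) *
        (Real.pi * Complex.I)) := by
    intro C h hlt
    have hcS : C.centers ⊆ S := fun l hl => (hS l).mpr ⟨Or.inl (h.centers_subset l hl), by
      have := hlt l hl; have := h.radius_pos; linarith⟩
    have h1 : ∑ l ∈ C.centers, (∮ z in C(l, C.radius), f z) =
        ∑ s ∈ S, r s * ((if s ∈ C.centers then 2 else 0) * (Real.pi * Complex.I)) := by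
      rw [← Finset.sum_subset hcS fun s _ hs => by rw [if_neg hs]; ring]
      refine Finset.sum_congr rfl fun l hl => ?_
      rw [hres l (hcS hl) _ h.radius_pos (hlt l hl) (h.isolated l hl), if_pos hl]
      ring
    rw [Chain.int, h1]
    simp only [sub_mul, mul_sub, Finset.sum_sub_distrib]
    ring
  rw [← hsum h fun l hl => hlt₁ _ (hX₁' l hl), ← hsum h' fun l hl => hlt₂ _ (hX₂' l hl)] at key
  exact sub_left_injective key

end Separates

/-! ### Iterated integrals over products of cycles -/

/-- Iterated integral over a product of cycles. -/
def iteratedInt : (k : ℕ) → (Fin k → Chain) → ((Fin k → ℂ) → ℂ) → ℂ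
  | 0, _, f => f Fin.elim0
  | k + 1, C, f => (C 0).int fun z => iteratedInt k (Fin.tail C) fun w => f (Fin.cons z w)

theorem exists_norm_iteratedInt_le : ∀ {k : ℕ} {C : Fin k → Chain}, (∀ j, (C j).IsRegular) →
    ∃ K, 0 ≤ K ∧ ∀ (p : Fin k → ℂ) (f : (Fin k → ℂ) → ℂ) (M : ℝ), 0 ≤ M →
      (∀ w, (∀ j, w j ∈ (C j).supp) → ‖f w‖ ≤ M * ∏ j, decay (p j - w j)) →
      ‖iteratedInt k C f‖ ≤ M * K
  | 0, _, _ => ⟨1, zero_le_one, fun p f M _ hf => by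
      simpa [iteratedInt] using hf Fin.elim0 (fun j => j.elim0)⟩
  | k + 1, C, h => by
      obtain ⟨K₁, hK₁0, hK₁⟩ := (h 0).exists_norm_int_le
      obtain ⟨K₂, hK₂0, hK₂⟩ := exists_norm_iteratedInt_le (C := Fin.tail C) fun j => h j.succ
      refine ⟨K₂ * K₁, by positivity, fun p f M hM hf => ?_⟩
      rw [iteratedInt, ← mul_assoc]
      refine hK₁ (p 0) _ (M * K₂) (by positivity) fun z hz => ?_
      rw [mul_right_comm]
      refine hK₂ (Fin.tail p) _ (M * decay (p 0 - z)) (mul_nonneg hM (decay_pos _).le)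
        fun w hw => ?_
      refine (hf _ (Fin.cases hz hw)).trans (le_of_eq ?_)
      rw [Fin.prod_univ_succ, ← mul_assoc]
      rfl

/-- The induction integrates the last variables first, with the first one added to the parameter
space. Hence holomorphy is assumed on open neighbourhoods `V j` of the supports and not merely on
the supports. -/
theorem differentiableOn_iteratedInt : ∀ {k : ℕ} {C : Fin k → Chain}, (∀ j, (C j).IsRegular) →
    ∀ {E : Type} [NormedAddCommGroup E] [NormedSpace ℂ E] [FiniteDimensional ℂ E] {O : Set E},
    IsOpen O → ∀ {V : Fin k → Set ℂ}, (∀ j, IsOpen (V j)) → (∀ j, (C j).supp ⊆ V j) →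
    ∀ {F : E × (Fin k → ℂ) → ℂ} {M : ℝ}, 0 ≤ M →
    DifferentiableOn ℂ F (O ×ˢ {w | ∀ j, w j ∈ V j}) →
    (∀ p ∈ O, ∀ w, (∀ j, w j ∈ V j) → ‖F (p, w)‖ ≤ M * ∏ j, decay (w j)) →
    DifferentiableOn ℂ (fun p => iteratedInt k C fun w => F (p, w)) O
  | 0, C, _, E, _, _, _, O, _, V, _, _, F, M, _, hd, _ => by
      simp only [iteratedInt]
      exact hd.comp (f := fun p : E => (p, (Fin.elim0 : Fin 0 → ℂ))) (by fun_prop)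
        fun p hp => ⟨hp, fun j => j.elim0⟩
  | k + 1, C, h, E, _, _, _, O, hO, V, hV, hCV, F, M, hM, hd, hb => by
      simp only [iteratedInt]
      set F' : (E × ℂ) × (Fin k → ℂ) → ℂ := fun q => F (q.1.1, Fin.cons q.1.2 q.2) with hF'
      obtain ⟨K, hK0, hK⟩ := exists_norm_iteratedInt_le (C := Fin.tail C) fun j => h j.succ
      have hbF : ∀ p ∈ O, ∀ z ∈ V 0, ∀ w, (∀ j, w j ∈ Fin.tail V j) →
          ‖F (p, Fin.cons z w)‖ ≤ M * decay z * ∏ j, decay (w j) := by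
        intro p hp z hz w hw
        refine (hb p hp (Fin.cons z w) (Fin.cases hz hw)).trans (le_of_eq ?_)
        rw [Fin.prod_univ_succ, ← mul_assoc]
        rfl
      have hcons : Differentiable ℂ fun q : (E × ℂ) × (Fin k → ℂ) =>
          (q.1.1, (Fin.cons q.1.2 q.2 : Fin (k + 1) → ℂ)) := by
        refine Differentiable.prodMk (by fun_prop) (differentiable_pi.mpr fun j => ?_)
        refine Fin.cases ?_ (fun j => ?_) j
        · simp only [Fin.cons_zero]; fun_prop
        · simp only [Fin.cons_succ]; fun_prop
      have hd' : DifferentiableOn ℂ F' ((O ×ˢ V 0) ×ˢ {w | ∀ j, w j ∈ Fin.tail V j}) :=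
        hd.comp hcons.differentiableOn fun q hq => ⟨hq.1.1, Fin.cases hq.1.2 hq.2⟩
      have hG : DifferentiableOn ℂ (fun q : E × ℂ => iteratedInt k (Fin.tail C)
          fun w => F (q.1, Fin.cons q.2 w)) (O ×ˢ V 0) :=
        differentiableOn_iteratedInt (C := Fin.tail C) (fun j => h j.succ) (hO.prod (hV 0))
          (V := Fin.tail V) (fun j => hV j.succ) (fun j => hCV j.succ) (F := F') hM hd'
          fun q hq w hw => (hbF q.1 hq.1 q.2 hq.2 w hw).trans (by
            have := decay_le_one q.2
            have : 0 ≤ ∏ j, decay (w j) := Finset.prod_nonneg fun j _ => (decay_pos _).le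
            gcongr
            exact mul_le_of_le_one_right hM (decay_le_one q.2))
      refine (h 0).differentiableOn_int hO (M := M * K) (by positivity) ?_ ?_ ?_
      · intro z hz
        exact hG.comp (f := fun p : E => (p, z)) (by fun_prop) fun p hp => ⟨hp, hCV 0 hz⟩
      · intro p hp
        exact hG.continuousOn.comp (f := fun z : ℂ => (p, z)) (by fun_prop)
          fun z hz => ⟨hp, hCV 0 hz⟩
      · intro p hp z hz
        rw [mul_right_comm]
        refine hK 0 _ (M * decay z) (mul_nonneg hM (decay_pos _).le) fun w hw => ?_
        simp only [Pi.zero_apply, zero_sub, decay_neg]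
        exact hbF p hp z (hCV 0 hz) w fun j => hCV j.succ (hw j)

/-- Functions of several variables, holomorphic where no coordinate lies in the corresponding
`T j`, and decaying along vertical strips away from these sets. -/
structure DecayingOffPi {k : ℕ} (T : Fin k → Set ℂ) (F : (Fin k → ℂ) → ℂ) : Prop where
  differentiableOn : DifferentiableOn ℂ F {w | ∀ j, w j ∉ T j}
  bound : ∀ x ε : ℝ, 0 < ε → ∃ C, 0 ≤ C ∧ ∀ w : Fin k → ℂ, (∀ j, |(w j).re| ≤ x) →
    (∀ j, ∀ s ∈ T j, ε ≤ ‖w j - s‖) → ‖F w‖ ≤ C * ∏ j, decay (w j)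

theorem dist_ge_of_mem_ball {T : Set ℂ} {z z₀ : ℂ} {δ : ℝ} (h : ∀ s ∈ T, 2 * δ ≤ ‖z₀ - s‖)
    (hz : z ∈ Metric.ball z₀ δ) : ∀ s ∈ T, δ ≤ ‖z - s‖ := by
  intro s hs
  rw [mem_ball_iff_norm] at hz
  have h1 := norm_sub_le_norm_sub_add_norm_sub z₀ z s
  rw [norm_sub_rev] at hz
  have := h s hs
  linarith

/-- It supplies the open neighbourhoods of supports required by `differentiableOn_iteratedInt`: a
union of balls of radius `ε/2`, on which the estimates survive with half the margin. -/
theorem isOpen_dist_gt {T : Set ℂ} {ε : ℝ} (x : ℝ) (hε : 0 < ε) :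
    ∃ V : Set ℂ, IsOpen V ∧ (∀ z, |z.re| ≤ x → (∀ s ∈ T, ε ≤ ‖z - s‖) → z ∈ V) ∧
      ∀ z ∈ V, |z.re| ≤ x + ε / 2 ∧ ∀ s ∈ T, ε / 2 ≤ ‖z - s‖ := by
  refine ⟨⋃ z₀ ∈ {z₀ : ℂ | |z₀.re| ≤ x ∧ ∀ s ∈ T, ε ≤ ‖z₀ - s‖}, Metric.ball z₀ (ε / 2),
    isOpen_biUnion fun _ _ => Metric.isOpen_ball, ?_, ?_⟩
  · intro z hz hs
    exact Set.mem_biUnion (show z ∈ {z₀ : ℂ | |z₀.re| ≤ x ∧ ∀ s ∈ T, ε ≤ ‖z₀ - s‖} from ⟨hz, hs⟩)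
      (Metric.mem_ball_self (half_pos hε))
  · intro z hz
    obtain ⟨z₀, ⟨h1, h2⟩, hz⟩ := Set.mem_iUnion₂.mp hz
    refine ⟨?_, dist_ge_of_mem_ball (fun s hs => by have := h2 s hs; linarith) hz⟩
    rw [mem_ball_iff_norm] at hz
    have h3 := Complex.abs_re_le_norm (z - z₀)
    rw [Complex.sub_re] at h3
    have h4 := abs_sub_abs_le_abs_sub z.re z₀.re
    linarith

theorem DecayingOffPi.slice {k : ℕ} {T : Fin (k + 1) → Set ℂ} {F : (Fin (k + 1) → ℂ) → ℂ}
    (hF : DecayingOffPi T F) (hT : StripFinite (T 0)) {z : ℂ} (hz : z ∉ T 0) :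
    DecayingOffPi (Fin.tail T) fun w => F (Fin.cons z w) where
  differentiableOn := by
    refine hF.differentiableOn.comp (f := fun w : Fin k → ℂ => (Fin.cons z w : Fin (k + 1) → ℂ)) ?_
      fun w hw => Fin.cases hz hw
    refine (differentiable_pi.mpr fun j => ?_).differentiableOn
    refine Fin.cases ?_ (fun j => ?_) j
    · simp only [Fin.cons_zero]; fun_prop
    · simp only [Fin.cons_succ]; fun_prop
  bound := by
    intro x ε hε
    obtain ⟨ε', hε', h⟩ := hT.exists_dist_le (K := {z}) isClosed_singleton (x := |z.re|)
      (by simp) (by rintro s hs rfl; exact hz hs)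
    obtain ⟨C, hC0, hC⟩ := hF.bound (max x |z.re|) (min ε ε') (lt_min hε hε')
    refine ⟨C * decay z, mul_nonneg hC0 (decay_pos _).le, fun w hw hs => ?_⟩
    refine (hC (Fin.cons z w) (Fin.cases (le_max_right _ _) fun j => (hw j).trans (le_max_left _ _))
      (Fin.cases (fun s hs => (min_le_right _ _).trans (h z rfl s hs))
        fun j s hsj => (min_le_left _ _).trans (hs j s hsj))).trans (le_of_eq ?_)
    rw [Fin.prod_univ_succ, ← mul_assoc]
    rfl

theorem exists_dist_le_pi {k : ℕ} {C : Fin k → Chain} {L R : Fin k → Set ℂ}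
    (h : ∀ j, Separates (C j) (L j) (R j)) (hT : ∀ j, StripFinite (L j ∪ R j)) :
    ∃ x ε, 0 < ε ∧ ∀ j, ∀ z ∈ (C j).supp, |z.re| ≤ x ∧ ∀ s ∈ L j ∪ R j, ε ≤ ‖z - s‖ := by
  choose x ε hε h using fun j => (h j).exists_dist_le (hT j)
  obtain ⟨X, hX⟩ := (Set.finite_range x).bddAbove
  by_cases hk : Nonempty (Fin k)
  · obtain ⟨j₀, hj₀⟩ := Finite.exists_min ε
    exact ⟨X, ε j₀, hε j₀, fun j z hz => ⟨((h j z hz).1).trans (hX ⟨j, rfl⟩),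
      fun s hs => (hj₀ j).trans ((h j z hz).2 s hs)⟩⟩
  · exact ⟨0, 1, one_pos, fun j => (hk ⟨j⟩).elim⟩

/-- Integrating out all variables but the first leaves a function of one variable to which the
change of cycle in one variable applies. -/
theorem DecayingOffPi.decayingOff_iteratedInt {k : ℕ} {C : Fin k → Chain} {L R : Fin (k + 1) → Set ℂ}
    (h : ∀ j, Separates (C j) (L j.succ) (R j.succ)) (hT : ∀ j, StripFinite (L j ∪ R j))
    {F : (Fin (k + 1) → ℂ) → ℂ} (hF : DecayingOffPi (fun j => L j ∪ R j) F) :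
    DecayingOff (L 0 ∪ R 0) fun z => iteratedInt k C fun w => F (Fin.cons z w) := by
  obtain ⟨x', ε', hε', hC⟩ := exists_dist_le_pi h fun j => hT j.succ
  constructor
  · intro z₀ hz₀
    obtain ⟨ε, hε, hz⟩ := (hT 0).exists_dist_le (K := {z₀}) isClosed_singleton (x := |z₀.re|)
      (by simp) (by rintro s hs rfl; exact hz₀ hs)
    have hb : ∀ z ∈ Metric.ball z₀ (ε / 2), ∀ s ∈ L 0 ∪ R 0, ε / 2 ≤ ‖z - s‖ := fun z hz' =>
      dist_ge_of_mem_ball (fun s hs => by have := hz z₀ rfl s hs; linarith) hz'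
    choose V hV hV1 hV2 using fun j : Fin k =>
      isOpen_dist_gt (T := L j.succ ∪ R j.succ) x' hε'
    obtain ⟨M, hM0, hM⟩ := hF.bound (max (|z₀.re| + ε / 2) (x' + ε' / 2)) (min (ε / 2) (ε' / 2))
      (lt_min (half_pos hε) (half_pos hε'))
    have key := differentiableOn_iteratedInt (C := C) (fun j => (h j).toIsRegular) (E := ℂ)
      (O := Metric.ball z₀ (ε / 2)) Metric.isOpen_ball hV
      (fun j z hz => hV1 j z (hC j z hz).1 (hC j z hz).2)
      (F := fun q => F (Fin.cons q.1 q.2)) hM0 ?_ ?_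
    · exact (key.differentiableAt (Metric.ball_mem_nhds _ (half_pos hε))).differentiableWithinAt
    · refine hF.differentiableOn.comp
        (f := fun q : ℂ × (Fin k → ℂ) => (Fin.cons q.1 q.2 : Fin (k + 1) → ℂ)) ?_ ?_
      · refine (differentiable_pi.mpr fun j => ?_).differentiableOn
        refine Fin.cases ?_ (fun j => ?_) j
        · simp only [Fin.cons_zero]; fun_prop
        · simp only [Fin.cons_succ]; fun_prop
      · rintro q ⟨hq1, hq2⟩
        refine Fin.cases (fun hq => ?_) fun j hq => ?_
        · have := hb _ hq1 _ hq
          simp at this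
          linarith
        · have := (hV2 j _ (hq2 j)).2 _ hq
          simp at this
          linarith
    · intro z hz' w hw
      refine (hM (Fin.cons z w) ?_ ?_).trans ?_
      · refine Fin.cases ?_ fun j => (hV2 j _ (hw j)).1.trans (le_max_right _ _)
        refine le_trans ?_ (le_max_left _ _)
        rw [mem_ball_iff_norm] at hz'
        have h3 := Complex.abs_re_le_norm (z - z₀)
        rw [Complex.sub_re] at h3
        have h4 := abs_sub_abs_le_abs_sub z.re z₀.re
        simp only [Fin.cons_zero]
        linarith
      · exact Fin.cases (fun s hs => (min_le_left _ _).trans (hb z hz' s hs))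
          fun j s hs => (min_le_right _ _).trans ((hV2 j _ (hw j)).2 s hs)
      · rw [Fin.prod_univ_succ]
        refine mul_le_mul_of_nonneg_left ?_ hM0
        exact mul_le_of_le_one_left (Finset.prod_nonneg fun j _ => (decay_pos _).le)
          (decay_le_one _)
  · intro x ε hε
    obtain ⟨M, hM0, hM⟩ := hF.bound (max x x') (min ε ε') (lt_min hε hε')
    obtain ⟨K, hK0, hK⟩ := exists_norm_iteratedInt_le (C := C) fun j => (h j).toIsRegular
    refine ⟨M * K, fun z hz hs => ?_⟩
    rw [mul_right_comm]
    refine hK 0 _ (M * decay z) (mul_nonneg hM0 (decay_pos _).le) fun w hw => ?_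
    simp only [Pi.zero_apply, zero_sub, decay_neg]
    refine (hM (Fin.cons z w) (Fin.cases (hz.trans (le_max_left _ _))
      fun j => (hC j _ (hw j)).1.trans (le_max_right _ _)) (Fin.cases
        (fun s hs' => (min_le_left _ _).trans (hs s hs'))
        fun j s hs' => (min_le_right _ _).trans ((hC j _ (hw j)).2 s hs'))).trans (le_of_eq ?_)
    rw [Fin.prod_univ_succ, ← mul_assoc]
    rfl

/-- The cycles are exchanged one variable at a time: the inner ones by induction for each fixed
first variable, then the outer one. -/
theorem iteratedInt_eq_of_separates : ∀ {k : ℕ} {C C' : Fin k → Chain} {L R : Fin k → Set ℂ},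
    (∀ j, Separates (C j) (L j) (R j)) → (∀ j, Separates (C' j) (L j) (R j)) →
    (∀ j, StripFinite (L j ∪ R j)) → ∀ {F : (Fin k → ℂ) → ℂ},
    DecayingOffPi (fun j => L j ∪ R j) F → iteratedInt k C F = iteratedInt k C' F
  | 0, _, _, _, _, _, _, _, _, _ => rfl
  | k + 1, C, C', L, R, h, h', hT, F, hF => by
      rw [iteratedInt, iteratedInt]
      rw [Chain.int_congr (h 0).toIsRegular (g := fun z => iteratedInt k (Fin.tail C') fun w =>
        F (Fin.cons z w)) fun z hz => ?_]
      · exact (h 0).int_eq (h' 0) (hT 0)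
          (DecayingOffPi.decayingOff_iteratedInt (fun j => h' j.succ) hT hF)
      · exact iteratedInt_eq_of_separates (L := Fin.tail L) (R := Fin.tail R) (fun j => h j.succ)
          (fun j => h' j.succ) (fun j => hT j.succ)
          (hF.slice (hT 0) fun hz' => (h 0).notMem_supp hz' hz)

/-- The cycle consisting of a single path. -/
def pathChain (γ : ℝ → ℂ) : Chain := ⟨γ, ∅, 1⟩

@[simp] theorem pathChain_int (γ : ℝ → ℂ) (f : ℂ → ℂ) :
    (pathChain γ).int f = ∫ t, f (γ t) * deriv γ t := by
  simp [pathChain, Chain.int]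

@[simp] theorem pathChain_supp (γ : ℝ → ℂ) : (pathChain γ).supp = Set.range γ := by
  simp [pathChain, Chain.supp]

theorem integrable_contourIntegrand {k : ℕ} {γ : Fin k → ℝ → ℂ} (hγ : ∀ j, IsVerticalPath (γ j))
    {F : (Fin k → ℂ) → ℂ} (hc : ContinuousOn F {w | ∀ j, w j ∈ Set.range (γ j)}) {M : ℝ}
    (hb : ∀ w, (∀ j, w j ∈ Set.range (γ j)) → ‖F w‖ ≤ M * ∏ j, decay (w j)) :
    Integrable (contourIntegrand γ F) := by
  have h1 : ∀ j, Integrable fun t => decay (γ j t) * ‖deriv (γ j) t‖ := fun j => by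
    obtain ⟨K, hK⟩ := (hγ j).exists_integral_decay_le
    refine (hK 0).1.congr (Eventually.of_forall fun t => ?_)
    simp only [zero_sub, decay_neg]
  have h2 := (Integrable.fintype_prod (f := fun j t => decay (γ j t) * ‖deriv (γ j) t‖) h1).const_mul
    M
  refine h2.mono' (Measurable.aestronglyMeasurable ?_) (Eventually.of_forall fun t => ?_)
  · refine Measurable.mul ?_ (Finset.measurable_prod _ fun j _ =>
      (hγ j).measurable_deriv.comp (measurable_pi_apply j))
    refine Continuous.measurable ?_
    exact hc.comp_continuous (f := fun t : Fin k → ℝ => fun j => γ j (t j))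
      (continuous_pi fun j => (hγ j).continuous.comp (continuous_apply j))
      fun t j => ⟨t j, rfl⟩
  · rw [contourIntegrand, norm_mul, norm_prod, Finset.prod_mul_distrib, ← mul_assoc]
    exact mul_le_mul_of_nonneg_right (hb _ fun j => ⟨t j, rfl⟩)
      (Finset.prod_nonneg fun _ _ => norm_nonneg _)

/-- Fubini, splitting off the first coordinate; the domination by `∏ decay` gives absolute
convergence. -/
theorem contourIntegral_eq_iteratedInt : ∀ {k : ℕ} {γ : Fin k → ℝ → ℂ},
    (∀ j, IsVerticalPath (γ j)) → ∀ {F : (Fin k → ℂ) → ℂ},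
    ContinuousOn F {w | ∀ j, w j ∈ Set.range (γ j)} → ∀ {M : ℝ},
    (∀ w, (∀ j, w j ∈ Set.range (γ j)) → ‖F w‖ ≤ M * ∏ j, decay (w j)) →
    contourIntegral γ F = iteratedInt k (fun j => pathChain (γ j)) F
  | 0, γ, _, F, _, M, _ => by
      rw [contourIntegral, iteratedInt]
      simp only [contourIntegrand, Finset.univ_eq_empty, Finset.prod_empty, mul_one]
      rw [integral_unique]
      rw [measureReal_def, volume_pi, Measure.pi_univ, Finset.univ_eq_empty, Finset.prod_empty,
        ENNReal.toReal_one, one_smul]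
      exact congrArg F (Subsingleton.elim _ _)
  | k + 1, γ, hγ, F, hc, M, hb => by
      have hint := integrable_contourIntegrand hγ hc hb
      have hmp := (volume_preserving_piFinSuccAbove (fun _ : Fin (k + 1) => ℝ) 0).symm
      rw [contourIntegral, ← hmp.integral_comp']
      have hint' := (hmp.integrable_comp_emb (MeasurableEquiv.measurableEmbedding _)).mpr hint
      rw [Measure.volume_eq_prod] at hint' ⊢
      refine (integral_prod _ hint').trans ?_
      rw [iteratedInt, pathChain_int]
      congr 1
      ext z
      have := contourIntegral_eq_iteratedInt (γ := Fin.tail γ) (fun j => hγ j.succ)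
        (F := fun w => F (Fin.cons (γ 0 z) w)) ?_ (M := M * decay (γ 0 z)) ?_
      · have e : (Fin.tail fun j => pathChain (γ j)) = fun j => pathChain (Fin.tail γ j) := rfl
        rw [e, ← this, contourIntegral, ← integral_mul_const]
        congr 1
        ext t
        simp only [contourIntegrand, Function.comp, Fin.prod_univ_succ]
        have e1 : (fun j => γ j ((MeasurableEquiv.piFinSuccAbove (fun _ : Fin (k + 1) => ℝ) 0).symm
            (z, t) j)) = (Fin.cons (γ 0 z) fun j => Fin.tail γ j (t j) : Fin (k + 1) → ℂ) := by
          ext j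
          refine Fin.cases ?_ (fun j => ?_) j <;> rfl
        rw [e1]
        have e2 : deriv (γ 0) ((MeasurableEquiv.piFinSuccAbove (fun _ : Fin (k + 1) => ℝ) 0).symm
            (z, t) 0) = deriv (γ 0) z := rfl
        have e3 : ∀ j : Fin k, deriv (γ j.succ) ((MeasurableEquiv.piFinSuccAbove
            (fun _ : Fin (k + 1) => ℝ) 0).symm (z, t) j.succ) = deriv (Fin.tail γ j) (t j) :=
          fun j => rfl
        simp only [e2, e3]
        ring
      · refine hc.comp (f := fun w : Fin k → ℂ => (Fin.cons (γ 0 z) w : Fin (k + 1) → ℂ)) ?_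
          fun w hw => Fin.cases ⟨z, rfl⟩ hw
        refine (continuous_pi fun j => ?_).continuousOn
        refine Fin.cases ?_ (fun j => ?_) j
        · simp only [Fin.cons_zero]; fun_prop
        · simp only [Fin.cons_succ]; fun_prop
      · intro w hw
        refine (hb (Fin.cons (γ 0 z) w) (Fin.cases ⟨z, rfl⟩ hw)).trans (le_of_eq ?_)
        rw [Fin.prod_univ_succ, ← mul_assoc]
        rfl

theorem IsBarnesContour.separates {γ : ℝ → ℂ} {L R : Set ℂ} (h : IsBarnesContour γ L R) :
    Separates (pathChain γ) L R where
  path := ⟨h.continuous, h.piecewise.imp fun _ hS => hS.1, h.bounded_deriv, h.vertical⟩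
  radius_pos := one_pos
  avoid s hs := hs.elim (fun hs => (h.left s hs).1) fun hs => (h.right s hs).1
  centers_subset l hl := absurd hl (Finset.notMem_empty l)
  isolated l hl := absurd hl (Finset.notMem_empty l)
  left w hw _ := (h.left w hw).2
  left_center w hw := absurd hw (Finset.notMem_empty w)
  right w hw := (h.right w hw).2

theorem separates_vline {c : ℝ} {L R : Set ℂ} (hL : ∀ w ∈ L, w.re < c) (hR : ∀ w ∈ R, c < w.re) :
    Separates (pathChain (vline c)) L R where
  path := isVerticalPath_vline c
  radius_pos := one_pos
  avoid s hs := by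
    rintro ⟨t, rfl⟩
    rcases hs with hs | hs
    · exact (hL _ hs).ne (vline_re c t)
    · exact (hR _ hs).ne' (vline_re c t)
  centers_subset l hl := absurd hl (Finset.notMem_empty l)
  isolated l hl := absurd hl (Finset.notMem_empty l)
  left w hw _ := tendsto_windingIntegral_vline_of_lt (hL w hw)
  left_center w hw := absurd hw (Finset.notMem_empty w)
  right w hw := tendsto_windingIntegral_vline_of_gt (hR w hw)

/-! ### Cycles that serve a whole region of parameters -/

/-- Sets of poles that extend to the left by steps of `2`. -/
structure IsLeftSet (L : Set ℂ) : Prop where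
  finite : ∀ x : ℝ, {s ∈ L | x ≤ s.re}.Finite
  sub_mem : ∀ s ∈ L, ∀ m : ℕ, s - 2 * m ∈ L

theorem IsLeftSet.stripFinite {L : Set ℂ} (h : IsLeftSet L) : StripFinite L := fun x =>
  (h.finite (-x)).subset fun _ hs => ⟨hs.1, (abs_le.mp hs.2).1⟩

theorem stripFinite_rightPoles (P : ℂ) : StripFinite (rightPoles P) := by
  intro x
  obtain ⟨N, hN⟩ := exists_nat_ge (x + |P.re|)
  refine ((Set.finite_le_nat N).image fun m : ℕ => P + 2 * (m : ℂ)).subset ?_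
  rintro _ ⟨⟨m, rfl⟩, hm⟩
  refine ⟨m, ?_, rfl⟩
  have h1 : (P + 2 * (m : ℂ)).re = P.re + 2 * m := by simp
  rw [h1] at hm
  have h2 := (abs_le.mp hm).2
  have h3 := neg_abs_le P.re
  have : (m : ℝ) ≤ N := by
    have : (0 : ℝ) ≤ m := m.cast_nonneg
    linarith
  exact_mod_cast this

/-- `(P + 2m) - s = P - (s - 2m)`, and `s - 2m` again belongs to `L`. So the distance of `P` from
`L` controls the whole half-lattice. -/
theorem IsLeftSet.dist_le_of_rightPoles {L : Set ℂ} (h : IsLeftSet L) {P : ℂ} {ε : ℝ}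
    (hP : ∀ s ∈ L, ε ≤ ‖P - s‖) : ∀ w ∈ rightPoles P, ∀ s ∈ L, ε ≤ ‖w - s‖ := by
  rintro _ ⟨m, rfl⟩ s hs
  refine (hP _ (h.sub_mem s hs m)).trans (le_of_eq ?_)
  congr 1
  ring

theorem re_le_of_mem_rightPoles {P w : ℂ} (hw : w ∈ rightPoles P) : P.re ≤ w.re := by
  obtain ⟨m, rfl⟩ := hw
  simp

/-- A cycle separating `L` from all right half-lattices starting at points in a strip that keep a
given distance from `L`. -/
theorem IsLeftSet.exists_separates {L : Set ℂ} (h : IsLeftSet L) (x : ℝ) {ε : ℝ} (hε : 0 < ε) :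
    ∃ (C : Chain) (x' δ : ℝ), 0 < δ ∧ C.IsRegular ∧
      (∀ z ∈ C.supp, |z.re| ≤ x' ∧ ∀ s ∈ L, δ ≤ ‖z - s‖) ∧
      ∀ R : Set ℂ, (∀ w ∈ R, -x ≤ w.re ∧ ∀ s ∈ L, ε ≤ ‖w - s‖) →
        Separates C L R ∧ ∀ z ∈ C.supp, ∀ s ∈ R, δ ≤ ‖z - s‖ := by
  -- The line is put at distance more than `1` to the left of every admissible `R`, at an abscissa
  -- that misses the finitely many real parts of `L` nearby.
  obtain ⟨c, ⟨hc1, hc2⟩, hcL⟩ : (Set.Ioo (-x - 2) (-x - 1) \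
      (Complex.re '' {s ∈ L | -x - 2 ≤ s.re})).Nonempty :=
    ((Set.Ioo_infinite (by linarith)).sdiff ((h.finite _).image _)).nonempty
  have hcL' : ∀ s ∈ L, s.re ≠ c := fun s hs hsc =>
    hcL ⟨s, ⟨hs, by rw [hsc]; exact hc1.le⟩, hsc⟩
  set S : Finset ℂ := (h.finite c).toFinset with hS
  have hSmem : ∀ s, s ∈ S ↔ s ∈ L ∧ c ≤ s.re := fun s => by simp [hS]
  have hrange : ∀ s ∈ L, s ∉ Set.range (vline c) := by
    rintro s hs ⟨t, rfl⟩
    exact hcL' _ hs (by simp)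
  obtain ⟨δ₀, hδ₀, hline⟩ := h.stripFinite.exists_dist_le (isVerticalPath_vline c).isClosed_range
    (x := |c|) (by rintro _ ⟨t, rfl⟩; simp) hrange
  have hsep : ∀ l : ℂ, ∃ η, 0 < η ∧ ∀ s ∈ L, s ≠ l → η ≤ ‖l - s‖ := fun l => by
    obtain ⟨η, hη, h1⟩ := StripFinite.exists_dist_le (T := L \ {l}) (K := {l})
      (fun x => (h.stripFinite x).subset fun s hs => ⟨hs.1.1, hs.2⟩) isClosed_singleton
      (x := |l.re|) (by simp) (by rintro s hs rfl; exact hs.2 rfl)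
    exact ⟨η, hη, fun s hs hsl => h1 l rfl s ⟨hs, hsl⟩⟩
  choose η hη hηL using hsep
  obtain ⟨η₀, hη₀, hη₀S⟩ : ∃ η₀, 0 < η₀ ∧ ∀ l ∈ S, η₀ ≤ η l := by
    by_cases hne : S.Nonempty
    · obtain ⟨l, _, hl⟩ := S.exists_min_image η hne
      exact ⟨η l, hη l, hl⟩
    · rw [Finset.not_nonempty_iff_eq_empty] at hne
      exact ⟨1, one_pos, by simp [hne]⟩
  -- With this radius a circle stays at distance at least `r` from the other points of `L`, from its
  -- own centre, and from every point at distance at least `ε` from `L`.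
  set r := min (ε / 2) (η₀ / 2) with hr
  have hr0 : 0 < r := lt_min (half_pos hε) (half_pos hη₀)
  have hrε : r ≤ ε / 2 := min_le_left _ _
  have hrη : ∀ l ∈ S, ∀ s ∈ L, s ≠ l → 2 * r ≤ ‖l - s‖ := fun l hl s hs hsl => by
    have h1 := hηL l s hs hsl
    have h2 := hη₀S l hl
    have h3 : r ≤ η₀ / 2 := min_le_right _ _
    linarith
  set C : Chain := ⟨vline c, S, r⟩ with hC
  have hreg : C.IsRegular := ⟨isVerticalPath_vline c, hr0⟩
  obtain ⟨x', hx'⟩ := hreg.exists_abs_re_le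
  refine ⟨C, x', min r (min δ₀ 1), lt_min hr0 (lt_min hδ₀ one_pos), hreg,
    fun z hz => ⟨hx' z hz, fun s hs => ?_⟩, fun R hR => ⟨⟨hreg, ?_, ?_, ?_, ?_, ?_, ?_⟩, ?_⟩⟩
  · rcases hz with hz | hz
    · exact (min_le_right _ _).trans ((min_le_left _ _).trans (hline z hz s hs))
    · refine (min_le_left _ _).trans ?_
      obtain ⟨l, hl, hz⟩ := Set.mem_iUnion₂.mp hz
      rw [mem_sphere_iff_norm] at hz
      by_cases hsl : s = l
      · rw [hsl, hz]
      · have h1 := hrη l hl s hs hsl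
        have h2 := norm_sub_le_norm_sub_add_norm_sub l z s
        rw [norm_sub_rev l z, hz] at h2
        change _ ≤ r + _ at h2
        linarith
  · rintro s (hs | hs)
    · exact hrange s hs
    · rintro ⟨t, rfl⟩
      have := (hR _ hs).1
      simp [hC] at this
      linarith
  · exact fun l hl => ((hSmem l).mp hl).1
  · rintro l hl s (hs | hs) hsl
    · have h1 := hrη l hl s hs hsl
      rw [dist_comm, dist_eq_norm]
      change r < _
      linarith
    · have h1 := (hR s hs).2 l ((hSmem l).mp hl).1
      rw [dist_eq_norm]
      change r < _
      linarith
  · intro w hw hwS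
    refine tendsto_windingIntegral_vline_of_lt (lt_of_not_ge fun hcw => hwS ?_)
    exact (hSmem w).mpr ⟨hw, hcw⟩
  · intro w hw
    have := (hSmem w).mp hw
    exact tendsto_windingIntegral_vline_of_gt (lt_of_le_of_ne this.2 (hcL' w this.1).symm)
  · intro w hw
    have := (hR w hw).1
    exact tendsto_windingIntegral_vline_of_gt (by linarith)
  · rintro z (⟨t, rfl⟩ | hz) s hs
    · refine (min_le_right _ _).trans ((min_le_right _ _).trans ?_)
      have h1 := (hR s hs).1
      have h2 := Complex.abs_re_le_norm (vline c t - s)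
      rw [Complex.sub_re, vline_re] at h2
      have h3 := neg_abs_le (c - s.re)
      change _ ≤ ‖vline c t - s‖
      linarith
    · refine (min_le_left _ _).trans ?_
      obtain ⟨l, hl, hz⟩ := Set.mem_iUnion₂.mp hz
      rw [mem_sphere_iff_norm] at hz
      have h1 := (hR s hs).2 l ((hSmem l).mp hl).1
      have h2 := norm_sub_le_norm_sub_add_norm_sub s z l
      rw [hz, norm_sub_rev s z] at h2
      change _ ≤ _ + r at h2
      linarith

/-! ### Mellin-Barnes integrals as functions of their parameters -/

/-- Functions of several variables, holomorphic where no coordinate lies in the corresponding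
`L j`, and bounded on vertical strips away from these sets. -/
structure BoundedOff {k : ℕ} (L : Fin k → Set ℂ) (V : (Fin k → ℂ) → ℂ) : Prop where
  differentiableOn : DifferentiableOn ℂ V {w | ∀ j, w j ∉ L j}
  bound : ∀ x ε : ℝ, 0 < ε → ∃ C, 0 ≤ C ∧ ∀ w : Fin k → ℂ, (∀ j, |(w j).re| ≤ x) →
    (∀ j, ∀ s ∈ L j, ε ≤ ‖w j - s‖) → ‖V w‖ ≤ C

/-- The kernel `∏_j Γ_ℝ(P_j - w_j) Γ_ℝ(Q_j - w_j)`. -/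
def barnesKernel {k : ℕ} (P Q w : Fin k → ℂ) : ℂ :=
  ∏ j, (Complex.Gammaℝ (P j - w j) * Complex.Gammaℝ (Q j - w j))

/-- Recentring the decay costs a factor depending on `Im p`, harmless when `p` is fixed or stays in
a bounded set. -/
theorem decay_sub_le (p w : ℂ) : decay (p - w) ≤ 2 * (1 + p.im ^ 2) * decay w := by
  rw [decay, decay, Complex.sub_im, ← div_eq_mul_inv, inv_eq_one_div,
    div_le_div_iff₀ (by positivity) (by positivity)]
  nlinarith [sq_nonneg (p.im + (p.im - w.im)), sq_nonneg (p.im * (p.im - w.im)), sq_nonneg p.im,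
    sq_nonneg (p.im - w.im)]

/-- The factors in `P` supply the decay, those in `Q` are merely bounded. Keeping the decay centred
at `P` makes `C` independent of imaginary parts. -/
theorem exists_norm_barnesKernel_le (k : ℕ) (x : ℝ) {ε : ℝ} (hε : 0 < ε) :
    ∃ C, 0 ≤ C ∧ ∀ P Q w : Fin k → ℂ, (∀ j, |(P j).re| ≤ x) → (∀ j, |(Q j).re| ≤ x) →
      (∀ j, |(w j).re| ≤ x) →
      (∀ j, ∀ s ∈ rightPoles (P j) ∪ rightPoles (Q j), ε ≤ ‖w j - s‖) →
      ‖barnesKernel P Q w‖ ≤ C * ∏ j, decay (P j - w j) := by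
  obtain ⟨C, hC0, hC⟩ := exists_norm_Gammaℝ_le (2 * x) hε
  have hΓ : ∀ P w : ℂ, |P.re| ≤ x → |w.re| ≤ x → (∀ s ∈ rightPoles P, ε ≤ ‖w - s‖) →
      ‖Complex.Gammaℝ (P - w)‖ ≤ C * decay (P - w) := fun P w hP hw h => by
    refine hC _ ?_ fun m => ?_
    · rw [Complex.sub_re]
      have := abs_sub P.re w.re
      linarith
    · refine (h _ ⟨m, rfl⟩).trans (le_of_eq ?_)
      rw [norm_sub_rev]
      congr 1
      ring
  refine ⟨(C * C) ^ k, by positivity, fun P Q w hP hQ hw h => ?_⟩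
  rw [barnesKernel, norm_prod]
  calc _ ≤ ∏ j, (C * C * decay (P j - w j)) := by
        refine Finset.prod_le_prod (fun _ _ => norm_nonneg _) fun j _ => ?_
        have h1 := hΓ (P j) (w j) (hP j) (hw j) fun s hs => h j s (Or.inl hs)
        have h2 := hΓ (Q j) (w j) (hQ j) (hw j) fun s hs => h j s (Or.inr hs)
        have h3 := decay_le_one (Q j - w j)
        rw [norm_mul]
        calc _ ≤ (C * decay (P j - w j)) * (C * decay (Q j - w j)) :=
              mul_le_mul h1 h2 (norm_nonneg _) (mul_nonneg hC0 (decay_pos _).le)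
          _ ≤ (C * decay (P j - w j)) * (C * 1) := by
              have := mul_nonneg hC0 (decay_pos (P j - w j)).le
              gcongr
          _ = _ := by ring
    _ = _ := by simp [Finset.prod_mul_distrib]

theorem decay_prod_sub_le {k : ℕ} {P : Fin k → ℂ} {B : ℝ} (hP : ∀ j, |(P j).im| ≤ B)
    (w : Fin k → ℂ) : ∏ j, decay (P j - w j) ≤ (2 * (1 + B ^ 2)) ^ k * ∏ j, decay (w j) := by
  calc _ ≤ ∏ j, (2 * (1 + B ^ 2) * decay (w j)) := by
        refine Finset.prod_le_prod (fun _ _ => (decay_pos _).le) fun j _ => ?_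
        refine (decay_sub_le _ _).trans (mul_le_mul_of_nonneg_right ?_ (decay_pos _).le)
        have : (P j).im ^ 2 ≤ B ^ 2 := sq_le_sq' (abs_le.mp (hP j)).1 (abs_le.mp (hP j)).2
        linarith
    _ = _ := by simp [Finset.prod_mul_distrib]

theorem exists_bound_re_im {k : ℕ} (P : Fin k → ℂ) : ∃ B, ∀ j, |(P j).re| ≤ B ∧ |(P j).im| ≤ B := by
  obtain ⟨B, hB⟩ := (Set.finite_range fun j => ‖P j‖).bddAbove
  exact ⟨B, fun j => ⟨(Complex.abs_re_le_norm _).trans (hB ⟨j, rfl⟩),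
    (Complex.abs_im_le_norm _).trans (hB ⟨j, rfl⟩)⟩⟩

theorem differentiableAt_Gammaℝ_sub {P w : ℂ} (h : w ∉ rightPoles P) :
    DifferentiableAt ℂ Complex.Gammaℝ (P - w) := by
  refine differentiableAt_Gammaℝ fun m hm => h ⟨m, ?_⟩
  linear_combination -hm

/-- The kernel is holomorphic in all its variables off the poles. -/
theorem differentiableAt_barnesKernel {k : ℕ} {P Q w : Fin k → ℂ}
    (hP : ∀ j, w j ∉ rightPoles (P j)) (hQ : ∀ j, w j ∉ rightPoles (Q j)) :
    DifferentiableAt ℂ (fun q : ((Fin k → ℂ) × (Fin k → ℂ)) × (Fin k → ℂ) =>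
      barnesKernel q.1.1 q.1.2 q.2) ((P, Q), w) := by
  classical
  refine (HasFDerivAt.finsetProd fun j _ => DifferentiableAt.hasFDerivAt ?_).differentiableAt
  exact ((differentiableAt_Gammaℝ_sub (hP j)).comp ((P, Q), w)
    (f := fun q : ((Fin k → ℂ) × (Fin k → ℂ)) × (Fin k → ℂ) => q.1.1 j - q.2 j)
    (by fun_prop)).mul ((differentiableAt_Gammaℝ_sub (hQ j)).comp ((P, Q), w)
    (f := fun q : ((Fin k → ℂ) × (Fin k → ℂ)) × (Fin k → ℂ) => q.1.2 j - q.2 j) (by fun_prop))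

theorem BoundedOff.decayingOffPi {k : ℕ} {L : Fin k → Set ℂ} {V : (Fin k → ℂ) → ℂ}
    (hV : BoundedOff L V) (P Q : Fin k → ℂ) :
    DecayingOffPi (fun j => L j ∪ (rightPoles (P j) ∪ rightPoles (Q j)))
      fun w => V w * barnesKernel P Q w where
  differentiableOn := by
    refine DifferentiableOn.mul (hV.differentiableOn.mono
      (s := {w | ∀ j, w j ∉ L j ∪ (rightPoles (P j) ∪ rightPoles (Q j))})
      fun w hw j hj => hw j (Or.inl hj)) fun w hw => ?_
    exact ((differentiableAt_barnesKernel (fun j hj => hw j (Or.inr (Or.inl hj)))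
      fun j hj => hw j (Or.inr (Or.inr hj))).comp w
      (f := fun w : Fin k → ℂ => ((P, Q), w)) (by fun_prop)).differentiableWithinAt
  bound x ε hε := by
    obtain ⟨B₁, hB₁⟩ := exists_bound_re_im P
    obtain ⟨B₂, hB₂⟩ := exists_bound_re_im Q
    obtain ⟨C₁, hC₁0, hC₁⟩ := hV.bound x ε hε
    obtain ⟨C₂, hC₂0, hC₂⟩ := exists_norm_barnesKernel_le k (max x (max B₁ B₂)) hε
    refine ⟨C₁ * (C₂ * (2 * (1 + B₁ ^ 2)) ^ k), by positivity, fun w hw hs => ?_⟩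
    rw [norm_mul, mul_assoc, mul_assoc]
    refine mul_le_mul (hC₁ w hw fun j s hj => hs j s (Or.inl hj)) ?_ (norm_nonneg _) hC₁0
    refine (hC₂ P Q w (fun j => (hB₁ j).1.trans ((le_max_left _ _).trans (le_max_right _ _)))
      (fun j => (hB₂ j).1.trans ((le_max_right _ _).trans (le_max_right _ _)))
      (fun j => (hw j).trans (le_max_left _ _)) fun j s hj => hs j s (Or.inr hj)).trans ?_
    exact mul_le_mul_of_nonneg_left (decay_prod_sub_le (fun j => (hB₁ j).2) w) hC₂0

/-- A cycle separating `L` from `R`, if there is one. -/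
def separatingChain (L R : Set ℂ) : Chain :=
  haveI : Nonempty Chain := ⟨pathChain (vline 0)⟩
  Classical.epsilon fun C => Separates C L R

theorem separates_separatingChain {L R : Set ℂ} {C : Chain} (h : Separates C L R) :
    Separates (separatingChain L R) L R :=
  Classical.epsilon_spec (p := fun C => Separates C L R) ⟨C, h⟩

/-- The iterated integral of `V(w) ∏_j Γ_ℝ(P_j - w_j) Γ_ℝ(Q_j - w_j)` over cycles that separate the
poles of `V` from those of the kernel. -/
def barnesInt {k : ℕ} (L : Fin k → Set ℂ) (V : (Fin k → ℂ) → ℂ) (P Q : Fin k → ℂ) : ℂ :=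
  iteratedInt k (fun j => separatingChain (L j) (rightPoles (P j) ∪ rightPoles (Q j)))
    fun w => V w * barnesKernel P Q w

section

variable {k : ℕ} {L : Fin k → Set ℂ} {V : (Fin k → ℂ) → ℂ}

/-- The cycle chosen inside `barnesInt` is immaterial as soon as some separating cycle exists. -/
theorem BoundedOff.barnesInt_eq (hV : BoundedOff L V) (hL : ∀ j, IsLeftSet (L j)) {P Q : Fin k → ℂ}
    {C : Fin k → Chain} (hC : ∀ j, Separates (C j) (L j) (rightPoles (P j) ∪ rightPoles (Q j))) :
    barnesInt L V P Q = iteratedInt k C fun w => V w * barnesKernel P Q w :=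
  iteratedInt_eq_of_separates (fun j => separates_separatingChain (hC j)) hC
    (fun j => (hL j).stripFinite.union ((stripFinite_rightPoles _).union (stripFinite_rightPoles _)))
    (hV.decayingOffPi P Q)

theorem BoundedOff.barnesInt_eq_contourIntegral (hV : BoundedOff L V) (hL : ∀ j, IsLeftSet (L j))
    {P Q : Fin k → ℂ} {γ : Fin k → ℝ → ℂ}
    (hγ : ∀ j, Separates (pathChain (γ j)) (L j) (rightPoles (P j) ∪ rightPoles (Q j))) :
    Integrable (contourIntegrand γ fun w => V w * barnesKernel P Q w) ∧
      barnesInt L V P Q = contourIntegral γ fun w => V w * barnesKernel P Q w := by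
  have hF := hV.decayingOffPi P Q
  obtain ⟨x, ε, hε, h⟩ := exists_dist_le_pi hγ fun j =>
    (hL j).stripFinite.union ((stripFinite_rightPoles _).union (stripFinite_rightPoles _))
  obtain ⟨M, hM0, hM⟩ := hF.bound x ε hε
  have hc : ContinuousOn (fun w => V w * barnesKernel P Q w) {w | ∀ j, w j ∈ Set.range (γ j)} :=
    hF.differentiableOn.continuousOn.mono fun w hw j hj => (hγ j).avoid _ hj (hw j)
  have hb : ∀ w : Fin k → ℂ, (∀ j, w j ∈ Set.range (γ j)) →
      ‖V w * barnesKernel P Q w‖ ≤ M * ∏ j, decay (w j) := fun w hw =>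
    hM w (fun j => (h j _ (by simpa using hw j)).1) fun j => (h j _ (by simpa using hw j)).2
  refine ⟨integrable_contourIntegrand (fun j => (hγ j).path) hc hb, ?_⟩
  rw [hV.barnesInt_eq hL hγ]
  exact (contourIntegral_eq_iteratedInt (fun j => (hγ j).path) hc hb).symm

theorem contourIntegrand_vline (c : Fin k → ℝ) (F : (Fin k → ℂ) → ℂ) (t : Fin k → ℝ) :
    contourIntegrand (fun j => vline (c j)) F t = F (fun j => vline (c j) (t j)) * Complex.I ^ k := by
  simp [contourIntegrand]

theorem BoundedOff.barnesInt_eq_integral_vline (hV : BoundedOff L V) (hL : ∀ j, IsLeftSet (L j))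
    {P Q : Fin k → ℂ} {c : Fin k → ℝ} (hc : ∀ j, ∀ s ∈ L j, s.re < c j)
    (hP : ∀ j, c j < (P j).re) (hQ : ∀ j, c j < (Q j).re) :
    Integrable (fun t : Fin k → ℝ => V (fun j => vline (c j) (t j)) *
      barnesKernel P Q fun j => vline (c j) (t j)) ∧
    barnesInt L V P Q = Complex.I ^ k * ∫ t : Fin k → ℝ, V (fun j => vline (c j) (t j)) *
      barnesKernel P Q fun j => vline (c j) (t j) := by
  obtain ⟨h1, h2⟩ := hV.barnesInt_eq_contourIntegral hL (γ := fun j => vline (c j)) (P := P) (Q := Q)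
    fun j => separates_vline (hc j) fun w hw => hw.elim
      (fun hw => (hP j).trans_le (re_le_of_mem_rightPoles hw))
      fun hw => (hQ j).trans_le (re_le_of_mem_rightPoles hw)
  constructor
  · have := h1.mul_const ((Complex.I ^ k)⁻¹)
    refine this.congr (Eventually.of_forall fun t => ?_)
    simp only [contourIntegrand_vline]
    rw [mul_assoc, mul_inv_cancel₀ (pow_ne_zero _ Complex.I_ne_zero), mul_one]
  · rw [h2, contourIntegral]
    simp only [contourIntegrand_vline]
    rw [integral_mul_const, mul_comm]

theorem exists_separates_pi (hL : ∀ j, IsLeftSet (L j)) (x : ℝ) {ε : ℝ} (hε : 0 < ε) :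
    ∃ (C : Fin k → Chain) (x' δ : ℝ), 0 < δ ∧ (∀ j, (C j).IsRegular) ∧
      (∀ j, ∀ z ∈ (C j).supp, |z.re| ≤ x' ∧ ∀ s ∈ L j, δ ≤ ‖z - s‖) ∧
      ∀ R : Fin k → Set ℂ, (∀ j, ∀ w ∈ R j, -x ≤ w.re ∧ ∀ s ∈ L j, ε ≤ ‖w - s‖) →
        (∀ j, Separates (C j) (L j) (R j)) ∧ ∀ j, ∀ z ∈ (C j).supp, ∀ s ∈ R j, δ ≤ ‖z - s‖ := by
  choose C x' δ hδ hreg hL' hR using fun j => (hL j).exists_separates x hε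
  obtain ⟨X, hX⟩ := (Set.finite_range x').bddAbove
  by_cases hk : Nonempty (Fin k)
  · obtain ⟨j₀, hj₀⟩ := Finite.exists_min δ
    exact ⟨C, X, δ j₀, hδ j₀, hreg, fun j z hz => ⟨((hL' j z hz).1).trans (hX ⟨j, rfl⟩),
      fun s hs => (hj₀ j).trans ((hL' j z hz).2 s hs)⟩, fun R h => ⟨fun j => (hR j (R j) (h j)).1,
      fun j z hz s hs => (hj₀ j).trans ((hR j (R j) (h j)).2 z hz s hs)⟩⟩
  · exact ⟨C, 0, 1, one_pos, hreg, fun j => (hk ⟨j⟩).elim, fun R h => ⟨fun j => (hk ⟨j⟩).elim,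
      fun j => (hk ⟨j⟩).elim⟩⟩

theorem rightPoles_union_spec {L : Set ℂ} (hL : IsLeftSet L) {P Q : ℂ} {x ε : ℝ} (hP : |P.re| ≤ x)
    (hQ : |Q.re| ≤ x) (hPL : ∀ s ∈ L, ε ≤ ‖P - s‖) (hQL : ∀ s ∈ L, ε ≤ ‖Q - s‖) :
    ∀ w ∈ rightPoles P ∪ rightPoles Q, -x ≤ w.re ∧ ∀ s ∈ L, ε ≤ ‖w - s‖ := by
  rintro w (hw | hw)
  · exact ⟨(abs_le.mp hP).1.trans (re_le_of_mem_rightPoles hw), hL.dist_le_of_rightPoles hPL w hw⟩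
  · exact ⟨(abs_le.mp hQ).1.trans (re_le_of_mem_rightPoles hw), hL.dist_le_of_rightPoles hQL w hw⟩

/-- One and the same cycle serves all admissible `P`, `Q`, and the bounds over it are independent of
their imaginary parts. This lets boundedness on strips pass through the recursion. -/
theorem BoundedOff.exists_norm_barnesInt_le (hV : BoundedOff L V) (hL : ∀ j, IsLeftSet (L j)) (x : ℝ)
    {ε : ℝ} (hε : 0 < ε) : ∃ M, 0 ≤ M ∧ ∀ P Q : Fin k → ℂ,
      (∀ j, |(P j).re| ≤ x) → (∀ j, |(Q j).re| ≤ x) → (∀ j, ∀ s ∈ L j, ε ≤ ‖P j - s‖) →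
      (∀ j, ∀ s ∈ L j, ε ≤ ‖Q j - s‖) → ‖barnesInt L V P Q‖ ≤ M := by
  obtain ⟨C, x', δ, hδ, hreg, hCL, hCR⟩ := exists_separates_pi hL x hε
  obtain ⟨K, hK0, hK⟩ := exists_norm_iteratedInt_le hreg
  obtain ⟨C₁, hC₁0, hC₁⟩ := hV.bound x' δ hδ
  obtain ⟨C₂, hC₂0, hC₂⟩ := exists_norm_barnesKernel_le k (max x x') hδ
  refine ⟨C₁ * C₂ * K, by positivity, fun P Q hP hQ hPL hQL => ?_⟩
  obtain ⟨hsep, hR⟩ := hCR (fun j => rightPoles (P j) ∪ rightPoles (Q j)) fun j =>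
    rightPoles_union_spec (hL j) (hP j) (hQ j) (hPL j) (hQL j)
  rw [hV.barnesInt_eq hL hsep]
  refine hK P _ _ (by positivity) fun w hw => ?_
  rw [norm_mul, mul_assoc]
  refine mul_le_mul (hC₁ w (fun j => (hCL j _ (hw j)).1) fun j => (hCL j _ (hw j)).2) ?_
    (norm_nonneg _) hC₁0
  exact hC₂ P Q w (fun j => (hP j).trans (le_max_left _ _)) (fun j => (hQ j).trans (le_max_left _ _))
    (fun j => (hCL j _ (hw j)).1.trans (le_max_right _ _)) fun j => hR j _ (hw j)

theorem exists_dist_le_of_notMem (hL : ∀ j, IsLeftSet (L j)) {P : Fin k → ℂ} (hP : ∀ j, P j ∉ L j) :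
    ∃ ε, 0 < ε ∧ ∀ j, ∀ s ∈ L j, ε ≤ ‖P j - s‖ := by
  have : ∀ j, ∃ ε, 0 < ε ∧ ∀ s ∈ L j, ε ≤ ‖P j - s‖ := fun j => by
    obtain ⟨ε, hε, h⟩ := (hL j).stripFinite.exists_dist_le (K := {P j}) isClosed_singleton
      (x := |(P j).re|) (by simp) (by rintro s hs rfl; exact hP j hs)
    exact ⟨ε, hε, h _ rfl⟩
  choose ε hε h using this
  by_cases hk : Nonempty (Fin k)
  · obtain ⟨j₀, hj₀⟩ := Finite.exists_min ε
    exact ⟨ε j₀, hε j₀, fun j s hs => (hj₀ j).trans (h j s hs)⟩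
  · exact ⟨1, one_pos, fun j => (hk ⟨j⟩).elim⟩

/-- Near `(P₀, Q₀)` the cycle can be kept fixed, so only the integrand depends on the parameters. -/
theorem BoundedOff.differentiableAt_barnesInt (hV : BoundedOff L V) (hL : ∀ j, IsLeftSet (L j))
    {P₀ Q₀ : Fin k → ℂ} (hP₀ : ∀ j, P₀ j ∉ L j) (hQ₀ : ∀ j, Q₀ j ∉ L j) :
    DifferentiableAt ℂ (fun q : (Fin k → ℂ) × (Fin k → ℂ) => barnesInt L V q.1 q.2) (P₀, Q₀) := by
  obtain ⟨ε₁, hε₁, hP₁⟩ := exists_dist_le_of_notMem hL hP₀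
  obtain ⟨ε₂, hε₂, hQ₁⟩ := exists_dist_le_of_notMem hL hQ₀
  obtain ⟨B₁, hB₁⟩ := exists_bound_re_im P₀
  obtain ⟨B₂, hB₂⟩ := exists_bound_re_im Q₀
  set ε := min ε₁ ε₂ / 2 with hεdef
  have hε : 0 < ε := half_pos (lt_min hε₁ hε₂)
  have hεle : 2 * ε = min ε₁ ε₂ := by rw [hεdef]; ring
  set B := max B₁ B₂ + ε with hB
  set O := Metric.ball (P₀, Q₀) ε with hO
  have hcoord : ∀ z z₀ : ℂ, ‖z - z₀‖ < ε → ∀ B', B' + ε ≤ B → |z₀.re| ≤ B' ∧ |z₀.im| ≤ B' →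
      |z.re| ≤ B ∧ |z.im| ≤ B := by
    intro z z₀ hz B' hB' h
    have h1 := (Complex.abs_re_le_norm (z - z₀)).trans_lt hz
    have h2 := (Complex.abs_im_le_norm (z - z₀)).trans_lt hz
    rw [Complex.sub_re] at h1
    rw [Complex.sub_im] at h2
    have h3 := abs_sub_abs_le_abs_sub z.re z₀.re
    have h4 := abs_sub_abs_le_abs_sub z.im z₀.im
    exact ⟨by linarith [h.1], by linarith [h.2]⟩
  have hOP : ∀ q ∈ O, ∀ j, q.1 j ∈ Metric.ball (P₀ j) ε := fun q hq j => by
    rw [hO, Metric.mem_ball, Prod.dist_eq, max_lt_iff] at hq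
    exact (dist_le_pi_dist q.1 P₀ j).trans_lt hq.1
  have hOQ : ∀ q ∈ O, ∀ j, q.2 j ∈ Metric.ball (Q₀ j) ε := fun q hq j => by
    rw [hO, Metric.mem_ball, Prod.dist_eq, max_lt_iff] at hq
    exact (dist_le_pi_dist q.2 Q₀ j).trans_lt hq.2
  have hPB : ∀ q ∈ O, ∀ j, |(q.1 j).re| ≤ B ∧ |(q.1 j).im| ≤ B := fun q hq j =>
    hcoord _ _ (mem_ball_iff_norm.mp (hOP q hq j)) B₁ (by rw [hB]; gcongr; exact le_max_left _ _)
      (hB₁ j)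
  have hQB : ∀ q ∈ O, ∀ j, |(q.2 j).re| ≤ B ∧ |(q.2 j).im| ≤ B := fun q hq j =>
    hcoord _ _ (mem_ball_iff_norm.mp (hOQ q hq j)) B₂ (by rw [hB]; gcongr; exact le_max_right _ _)
      (hB₂ j)
  have hPL : ∀ q ∈ O, ∀ j, ∀ s ∈ L j, ε ≤ ‖q.1 j - s‖ := fun q hq j =>
    dist_ge_of_mem_ball (fun s hs => by rw [hεle]; exact (min_le_left _ _).trans (hP₁ j s hs))
      (hOP q hq j)
  have hQL : ∀ q ∈ O, ∀ j, ∀ s ∈ L j, ε ≤ ‖q.2 j - s‖ := fun q hq j =>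
    dist_ge_of_mem_ball (fun s hs => by rw [hεle]; exact (min_le_right _ _).trans (hQ₁ j s hs))
      (hOQ q hq j)
  obtain ⟨C, x', δ, hδ, hreg, hCL, hCR⟩ := exists_separates_pi hL B hε
  have hspec : ∀ q ∈ O, (∀ j, Separates (C j) (L j) (rightPoles (q.1 j) ∪ rightPoles (q.2 j))) ∧
      ∀ j, ∀ z ∈ (C j).supp, ∀ s ∈ rightPoles (q.1 j) ∪ rightPoles (q.2 j), δ ≤ ‖z - s‖ :=
    fun q hq => hCR (fun j => rightPoles (q.1 j) ∪ rightPoles (q.2 j)) fun j =>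
      rightPoles_union_spec (hL j) (hPB q hq j).1 (hQB q hq j).1 (hPL q hq j) (hQL q hq j)
  -- Neighbourhoods of the supports that keep away from `L` and from the right poles of all
  -- parameters in the ball simultaneously.
  choose W hW hW1 hW2 using fun j : Fin k =>
    isOpen_dist_gt (T := L j ∪ ⋃ q ∈ O, (rightPoles (q.1 j) ∪ rightPoles (q.2 j))) x' hδ
  have hWR : ∀ q ∈ O, ∀ j, ∀ z ∈ W j, ∀ s ∈ rightPoles (q.1 j) ∪ rightPoles (q.2 j),
      δ / 2 ≤ ‖z - s‖ := fun q hq j z hz s hs =>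
    (hW2 j z hz).2 s (Or.inr (Set.mem_biUnion hq hs))
  have hnot : ∀ {T : Set ℂ} {z : ℂ}, (∀ s ∈ T, δ / 2 ≤ ‖z - s‖) → z ∉ T := fun h hz => by
    have := h _ hz
    simp at this
    linarith
  obtain ⟨C₁, hC₁0, hC₁⟩ := hV.bound (x' + δ / 2) (δ / 2) (half_pos hδ)
  obtain ⟨C₂, hC₂0, hC₂⟩ := exists_norm_barnesKernel_le k (max B (x' + δ / 2)) (half_pos hδ)
  have key := differentiableOn_iteratedInt hreg (O := O) Metric.isOpen_ball hW
    (fun j z hz => hW1 j z (hCL j z hz).1 fun s hs => hs.elim (fun hs => (hCL j z hz).2 s hs)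
      fun hs => by
        obtain ⟨q, hq, hs⟩ := Set.mem_iUnion₂.mp hs
        exact (hspec q hq).2 j z hz s hs)
    (F := fun q : ((Fin k → ℂ) × (Fin k → ℂ)) × (Fin k → ℂ) => V q.2 * barnesKernel q.1.1 q.1.2 q.2)
    (M := C₁ * (C₂ * (2 * (1 + B ^ 2)) ^ k)) (by positivity) ?_ ?_
  · refine ((key.differentiableAt (Metric.ball_mem_nhds _ hε))).congr_of_eventuallyEq ?_
    filter_upwards [Metric.ball_mem_nhds (P₀, Q₀) hε] with q hq
    exact hV.barnesInt_eq hL (hspec q hq).1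
  · refine DifferentiableOn.mul ?_ fun q hq => ?_
    · exact hV.differentiableOn.comp (f := fun q : ((Fin k → ℂ) × (Fin k → ℂ)) × (Fin k → ℂ) => q.2)
        (by fun_prop) fun q hq j => hnot fun s hs => (hW2 j _ (hq.2 j)).2 s (Or.inl hs)
    · exact (differentiableAt_barnesKernel
        (fun j => hnot fun s hs => hWR q.1 hq.1 j _ (hq.2 j) s (Or.inl hs))
        fun j => hnot fun s hs => hWR q.1 hq.1 j _ (hq.2 j) s (Or.inr hs)).differentiableWithinAt
  · intro q hq w hw
    rw [norm_mul, mul_assoc, mul_assoc]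
    refine mul_le_mul (hC₁ w (fun j => (hW2 j _ (hw j)).1) fun j s hs =>
      (hW2 j _ (hw j)).2 s (Or.inl hs)) ?_ (norm_nonneg _) hC₁0
    refine (hC₂ q.1 q.2 w (fun j => (hPB q hq j).1.trans (le_max_left _ _))
      (fun j => (hQB q hq j).1.trans (le_max_left _ _))
      (fun j => (hW2 j _ (hw j)).1.trans (le_max_right _ _)) fun j => hWR q hq j _ (hw j)).trans ?_
    exact mul_le_mul_of_nonneg_left (decay_prod_sub_le (fun j => (hPB q hq j).2) w) hC₂0

end

/-! ### The recursion in the rank -/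

/-- The polar sets in the `k` variables attached to `k + 1` parameters. -/
def poles {k : ℕ} (a : Fin (k + 1) → ℂ) (j : Fin k) : Set ℂ :=
  {w | ∃ I : Finset (Fin (k + 1)), I.card = (j : ℕ) + 1 ∧
    ∃ m : ℕ, w = -(∑ i ∈ I, a i) - 2 * (m : ℂ)}

theorem isLeftSet_poles {k : ℕ} (a : Fin (k + 1) → ℂ) (j : Fin k) : IsLeftSet (poles a j) where
  finite x := by
    obtain ⟨B, hB⟩ := (Set.finite_range fun I : Finset (Fin (k + 1)) =>
      -(∑ i ∈ I, a i).re).bddAbove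
    obtain ⟨N, hN⟩ := exists_nat_ge (B - x)
    refine ((Set.finite_univ (α := Finset (Fin (k + 1)))).prod (Set.finite_le_nat N) |>.image
      fun q => -(∑ i ∈ q.1, a i) - 2 * (q.2 : ℂ)).subset ?_
    rintro _ ⟨⟨I, -, m, rfl⟩, hm⟩
    refine ⟨(I, m), ⟨trivial, ?_⟩, rfl⟩
    have h1 : (-(∑ i ∈ I, a i) - 2 * (m : ℂ)).re = -(∑ i ∈ I, a i).re - 2 * m := by simp
    rw [h1] at hm
    have h2 := hB ⟨I, rfl⟩
    simp only at h2
    have : (m : ℝ) ≤ N := by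
      have : (0 : ℝ) ≤ m := m.cast_nonneg
      linarith
    exact_mod_cast this
  sub_mem := by
    rintro _ ⟨I, hI, m, rfl⟩ m'
    exact ⟨I, hI, m + m', by push_cast; ring⟩

/-- Index sets avoiding `0`. With `sub_mem_poles_of_tail`, which adjoins `0` to the index set, it
shows that the integral in the recursion has no poles beyond the expected ones. -/
theorem poles_tail_subset {k : ℕ} (a : Fin (k + 2) → ℂ) (j : Fin k) :
    poles (Fin.tail a) j ⊆ poles a j.castSucc := by
  rintro _ ⟨I, hI, m, rfl⟩
  refine ⟨I.map (Fin.succEmb _), by simpa using hI, m, ?_⟩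
  simp [Fin.tail]

theorem sub_mem_poles_of_tail {k : ℕ} {a : Fin (k + 2) → ℂ} {j : Fin k} {s : ℂ}
    (h : s ∈ poles (Fin.tail a) j) : s - a 0 ∈ poles a j.succ := by
  obtain ⟨I, hI, m, rfl⟩ := h
  refine ⟨Finset.cons 0 (I.map (Fin.succEmb _)) (by simp), by simpa using hI, m, ?_⟩
  rw [Finset.sum_cons, Finset.sum_map]
  simp [Fin.tail]
  ring

theorem neg_head_mem_poles {k : ℕ} (a : Fin (k + 2) → ℂ) (m : ℕ) : -a 0 - 2 * m ∈ poles a 0 :=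
  ⟨{0}, by simp, m, by simp⟩

theorem neg_sum_tail_mem_poles {k : ℕ} (a : Fin (k + 2) → ℂ) (m : ℕ) :
    -(∑ i, Fin.tail a i) - 2 * m ∈ poles a (Fin.last k) :=
  ⟨Finset.univ.map (Fin.succEmb _), by simp, m, by simp [Fin.tail]⟩

/-- The Mellin transform of the class one Whittaker function up to a power of `2`, through the
recursive integral of Mellin-Barnes type. -/
def mellinBarnes : (k : ℕ) → (Fin (k + 1) → ℂ) → (Fin k → ℂ) → ℂ
  | 0, _, _ => 1
  | k + 1, a, s =>
      Complex.Gammaℝ (s 0 + a 0) * Complex.Gammaℝ (s (Fin.last k) + ∑ i, Fin.tail a i) *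
        ((4 * (Real.pi : ℂ) * Complex.I) ^ k)⁻¹ *
        barnesInt (poles (Fin.tail a)) (mellinBarnes k (Fin.tail a)) (fun j => s j.castSucc)
          fun j => s j.succ + a 0

/-- Holomorphy and boundedness are proved together: the integral in the recursion needs both for the
lower rank. The two gamma factors in front contribute the poles with index sets `{0}` and its
complement. -/
theorem boundedOff_mellinBarnes : ∀ {k : ℕ} (a : Fin (k + 1) → ℂ),
    BoundedOff (poles a) (mellinBarnes k a)
  | 0, a => by
      constructor
      · exact differentiableOn_const (1 : ℂ)
      · intro x ε _
        exact ⟨1, zero_le_one, fun w _ _ => by simp [mellinBarnes]⟩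
  | k + 1, a => by
      have ih := boundedOff_mellinBarnes (Fin.tail a)
      have hL := isLeftSet_poles (Fin.tail a)
      constructor
      · intro s hs
        have h1 : DifferentiableAt ℂ (fun s : Fin (k + 1) → ℂ => Complex.Gammaℝ (s 0 + a 0)) s := by
          refine (differentiableAt_Gammaℝ (z := s 0 + a 0) fun m hm => hs 0 ?_).comp s
            (f := fun s : Fin (k + 1) → ℂ => s 0 + a 0) (by fun_prop)
          rw [show s 0 = -a 0 - 2 * m by linear_combination hm]
          exact neg_head_mem_poles a m
        have h2 : DifferentiableAt ℂ (fun s : Fin (k + 1) → ℂ =>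
            Complex.Gammaℝ (s (Fin.last k) + ∑ i, Fin.tail a i)) s := by
          refine (differentiableAt_Gammaℝ (z := s (Fin.last k) + ∑ i, Fin.tail a i)
            fun m hm => hs (Fin.last k) ?_).comp s
            (f := fun s : Fin (k + 1) → ℂ => s (Fin.last k) + ∑ i, Fin.tail a i) (by fun_prop)
          rw [show s (Fin.last k) = -(∑ i, Fin.tail a i) - 2 * m by linear_combination hm]
          exact neg_sum_tail_mem_poles a m
        have h3 := (ih.differentiableAt_barnesInt hL (P₀ := fun j => s j.castSucc)
          (Q₀ := fun j => s j.succ + a 0) (fun j hj => hs _ (poles_tail_subset a j hj))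
          fun j hj => hs j.succ (by simpa using sub_mem_poles_of_tail hj)).comp s
          (f := fun s : Fin (k + 1) → ℂ => ((fun j => s j.castSucc : Fin k → ℂ),
            (fun j => s j.succ + a 0 : Fin k → ℂ))) (by fun_prop)
        exact (((h1.mul h2).mul_const _).mul h3).differentiableWithinAt
      · intro x ε hε
        set A := |(a 0).re| + |(∑ i, Fin.tail a i).re| with hA
        have hA1 : |(a 0).re| ≤ A := le_add_of_nonneg_right (abs_nonneg _)
        have hA2 : |(∑ i, Fin.tail a i).re| ≤ A := le_add_of_nonneg_left (abs_nonneg _)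
        obtain ⟨C, hC0, hC⟩ := exists_norm_Gammaℝ_le (x + A) hε
        obtain ⟨M, hM0, hM⟩ := ih.exists_norm_barnesInt_le hL (x + A) hε
        refine ⟨C * C * ‖((4 * (Real.pi : ℂ) * Complex.I) ^ k)⁻¹‖ * M, by positivity,
          fun s hs hsL => ?_⟩
        rw [mellinBarnes, norm_mul, norm_mul, norm_mul]
        have hC' : ∀ z : ℂ, |z.re| ≤ x + A → (∀ m : ℕ, ε ≤ ‖z + 2 * m‖) →
            ‖Complex.Gammaℝ z‖ ≤ C := fun z h1 h2 =>
          (hC z h1 h2).trans (mul_le_of_le_one_right hC0 (decay_le_one _))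
        have hadd : ∀ z b : ℂ, |z.re| ≤ x → |b.re| ≤ A → |(z + b).re| ≤ x + A := fun z b h1 h2 => by
          rw [Complex.add_re]
          exact (abs_add_le _ _).trans (add_le_add h1 h2)
        have hA0 : 0 ≤ A := by positivity
        gcongr
        · refine hC' _ (hadd _ _ (hs 0) hA1) fun m => ?_
          refine (hsL 0 _ (neg_head_mem_poles a m)).trans (le_of_eq ?_)
          congr 1
          ring
        · refine hC' _ (hadd _ _ (hs _) hA2) fun m => ?_
          refine (hsL _ _ (neg_sum_tail_mem_poles a m)).trans (le_of_eq ?_)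
          congr 1
          ring
        · refine hM _ _ (fun j => (hs _).trans (le_add_of_nonneg_right hA0))
            (fun j => hadd _ _ (hs _) hA1)
            (fun j z hz => hsL _ z (poles_tail_subset a j hz)) fun j z hz => ?_
          refine (hsL _ _ (sub_mem_poles_of_tail hz)).trans (le_of_eq ?_)
          congr 1
          ring

theorem four_pi_I_inv_mul (k : ℕ) :
    ((4 * (Real.pi : ℂ) * Complex.I) ^ k)⁻¹ * Complex.I ^ k = ((4 * (Real.pi : ℂ)) ^ k)⁻¹ := by
  rw [mul_pow, mul_inv, mul_assoc, inv_mul_cancel₀ (pow_ne_zero _ Complex.I_ne_zero), mul_one]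

/-- The recursion on vertical lines. -/
theorem mellinBarnes_succ_eq_integral {k : ℕ} (a : Fin (k + 2) → ℂ) {s : Fin (k + 1) → ℂ}
    {c : Fin k → ℝ} (hc : ∀ j, ∀ z ∈ poles (Fin.tail a) j, z.re < c j)
    (h1 : ∀ j : Fin k, c j < (s j.castSucc).re) (h2 : ∀ j : Fin k, c j < (s j.succ + a 0).re) :
    mellinBarnes (k + 1) a s =
      Complex.Gammaℝ (s 0 + a 0) * Complex.Gammaℝ (s (Fin.last k) + ∑ i, Fin.tail a i) *
        ((4 * (Real.pi : ℂ)) ^ k)⁻¹ * ∫ t : Fin k → ℝ,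
          mellinBarnes k (Fin.tail a) (fun j => vline (c j) (t j)) *
            barnesKernel (fun j => s j.castSucc) (fun j => s j.succ + a 0)
              fun j => vline (c j) (t j) := by
  rw [mellinBarnes, ((boundedOff_mellinBarnes (Fin.tail a)).barnesInt_eq_integral_vline
    (isLeftSet_poles (Fin.tail a)) hc h1 h2).2, ← four_pi_I_inv_mul]
  ring

/-- `mellinBarnes` on vertical lines is continuous and bounded. -/
theorem mellinBarnes_vline {k : ℕ} (a : Fin (k + 1) → ℂ) {c : Fin k → ℝ}
    (hc : ∀ j, ∀ z ∈ poles a j, z.re < c j) :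
    Continuous (fun t : Fin k → ℝ => mellinBarnes k a fun j => vline (c j) (t j)) ∧
      ∃ M, 0 ≤ M ∧ ∀ t : Fin k → ℝ, ‖mellinBarnes k a fun j => vline (c j) (t j)‖ ≤ M := by
  have hsep : ∀ j, Separates (pathChain (vline (c j))) (poles a j) ∅ := fun j =>
    separates_vline (hc j) (by simp)
  have hg := boundedOff_mellinBarnes a
  constructor
  · refine hg.differentiableOn.continuousOn.comp_continuous
      (f := fun t : Fin k → ℝ => fun j => vline (c j) (t j))
      (continuous_pi fun j => (continuous_vline _).comp (continuous_apply j)) fun t j hj => ?_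
    exact (hc j _ hj).ne (vline_re _ _)
  · obtain ⟨x, ε, hε, h⟩ := exists_dist_le_pi hsep fun j => by
      simpa using (isLeftSet_poles a j).stripFinite
    obtain ⟨M, hM0, hM⟩ := hg.bound x ε hε
    refine ⟨M, hM0, fun t => hM _ (fun j => (h j _ ?_).1) fun j s hs => (h j _ ?_).2 s (Or.inl hs)⟩
    all_goals simp

theorem continuous_Gammaℝ_comp {X : Type*} [TopologicalSpace X] {f : X → ℂ} (hf : Continuous f)
    (h : ∀ x, 0 < (f x).re) : Continuous fun x => Complex.Gammaℝ (f x) := by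
  refine continuous_iff_continuousAt.mpr fun x =>
    ContinuousAt.comp (f := f) (g := Complex.Gammaℝ) ?_ hf.continuousAt
  refine (differentiableAt_Gammaℝ fun m hm => ?_).continuousAt
  have := h x
  rw [hm] at this
  simp at this
  have : (0 : ℝ) ≤ m := m.cast_nonneg
  linarith

theorem exists_norm_Gammaℝ_le_of_re {x : ℝ} (hx : 0 < x) :
    ∃ C, 0 ≤ C ∧ ∀ z : ℂ, z.re = x → ‖Complex.Gammaℝ z‖ ≤ C * decay z := by
  obtain ⟨C, hC0, hC⟩ := exists_norm_Gammaℝ_le x hx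
  refine ⟨C, hC0, fun z hz => hC z (by rw [hz, abs_of_pos hx]) fun m => ?_⟩
  refine le_trans ?_ ((le_abs_self _).trans (Complex.abs_re_le_norm _))
  simp [hz]

/-! ### Barnes' first lemma under an integral sign -/

/-- Absolute convergence of a double integral of Mellin-Barnes type. -/
theorem integrable_prod_barnes {k n : ℕ} {ι : Fin k → Fin n} (hι : Function.Injective ι)
    {V : (Fin k → ℝ) → ℂ} (hV : Continuous V) {M : ℝ} (hM : 0 ≤ M) (hVM : ∀ t, ‖V t‖ ≤ M)
    {A B : Fin n → (Fin k → ℝ) → ℂ} (hA : ∀ j, Continuous (A j)) (hB : ∀ j, Continuous (B j))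
    {x y : Fin n → ℝ} (hx : ∀ j, 0 < x j) (hy : ∀ j, 0 < y j) (hAx : ∀ j t, (A j t).re = x j)
    (hBy : ∀ j t, (B j t).re = y j) (hAι : ∀ i t, (A (ι i) t).im = -t i)
    {G D : Fin n → ℂ} (hG : ∀ j, 0 < (G j).re) (hD : ∀ j, 0 < (D j).re) :
    Integrable (fun r : (Fin n → ℝ) × (Fin k → ℝ) => V r.2 * ∏ j,
      (Complex.Gammaℝ (A j r.2 + r.1 j * Complex.I) * Complex.Gammaℝ (B j r.2 + r.1 j * Complex.I) *
        (Complex.Gammaℝ (G j - r.1 j * Complex.I) * Complex.Gammaℝ (D j - r.1 j * Complex.I)))) := by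
  choose CA hCA0 hCA using fun j => exists_norm_Gammaℝ_le_of_re (hx j)
  choose CB hCB0 hCB using fun j => exists_norm_Gammaℝ_le_of_re (hy j)
  choose CG hCG0 hCG using fun j => exists_norm_Gammaℝ_le_of_re (hG j)
  choose CD hCD0 hCD using fun j => exists_norm_Gammaℝ_le_of_re (hD j)
  -- `φ` collects decay in the outer variables `q`. Since `Im (A (ι i) t) = -t i`, the factors in
  -- `A` decay in `t i - q (ι i)`, and `ψ` collects this. The product is integrable by translating
  -- `t`; the factors in `B`, `D` and `V` are only bounded.
  set φ : (Fin n → ℝ) → ℝ := fun q => ∏ j, decay (G j - q j * Complex.I) with hφ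
  set ψ : (Fin k → ℝ) → ℝ := fun t => ∏ i, (1 + t i ^ 2)⁻¹ with hψ
  have hφi : Integrable φ := Integrable.fintype_prod (f := fun j (q : ℝ) => decay (G j - q * Complex.I))
    fun j => integrable_decay_vertical (G j)
  have hψi : Integrable ψ := Integrable.fintype_prod (f := fun _ (s : ℝ) => (1 + s ^ 2)⁻¹)
    fun j => integrable_inv_one_add_sq
  have hdom : Integrable (fun r : (Fin n → ℝ) × (Fin k → ℝ) =>
      φ r.1 * ψ (r.2 - fun i => r.1 (ι i))) := by
    have hcont : Continuous (fun r : (Fin n → ℝ) × (Fin k → ℝ) =>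
        φ r.1 * ψ (r.2 - fun i => r.1 (ι i))) := by
      refine Continuous.mul ?_ ?_
      · refine continuous_finsetProd _ fun j _ => ?_
        exact continuous_decay.comp (by fun_prop)
      · refine continuous_finsetProd _ fun i _ => ?_
        refine Continuous.inv₀ ?_ fun r => by positivity
        simp only [Pi.sub_apply]
        fun_prop
    rw [Measure.volume_eq_prod]
    refine (integrable_prod_iff hcont.aestronglyMeasurable).mpr ⟨?_, ?_⟩
    · exact Eventually.of_forall fun q => ((hψi.comp_sub_right fun i => q (ι i)).const_mul (φ q))
    · have : ∀ q, ∫ t, ‖φ q * ψ (t - fun i => q (ι i))‖ = ‖φ q‖ * ∫ t, ‖ψ t‖ := fun q => by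
        simp only [norm_mul]
        rw [integral_const_mul]
        congr 1
        exact integral_sub_right_eq_self (fun t => ‖ψ t‖) _
      simp only [this]
      exact hφi.norm.mul_const _
  have hpos : ∀ (z : ℂ) (q : ℝ), (z + q * Complex.I).re = z.re ∧ (z - q * Complex.I).re = z.re :=
    fun z q => by simp
  refine (hdom.const_mul (M * ∏ j, (CA j * CB j * (CG j * CD j)))).mono' ?_
    (Eventually.of_forall fun r => ?_)
  · refine Continuous.aestronglyMeasurable ?_
    refine (hV.comp continuous_snd).mul (continuous_finsetProd _ fun j _ => ?_)
    refine Continuous.mul (Continuous.mul ?_ ?_) (Continuous.mul ?_ ?_)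
    · refine continuous_Gammaℝ_comp (((hA j).comp continuous_snd).add (by fun_prop)) fun r => ?_
      rw [(hpos _ _).1]
      exact (hAx j r.2).symm ▸ hx j
    · refine continuous_Gammaℝ_comp (((hB j).comp continuous_snd).add (by fun_prop)) fun r => ?_
      rw [(hpos _ _).1]
      exact (hBy j r.2).symm ▸ hy j
    · exact continuous_Gammaℝ_comp (by fun_prop) fun r => by rw [(hpos _ _).2]; exact hG j
    · exact continuous_Gammaℝ_comp (by fun_prop) fun r => by rw [(hpos _ _).2]; exact hD j
  · obtain ⟨q, t⟩ := r
    simp only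
    have hψle : ∏ j, decay (A j t + q j * Complex.I) ≤ ψ (t - fun i => q (ι i)) := by
      have h1 : ψ (t - fun i => q (ι i)) = ∏ j ∈ Finset.univ.map ⟨ι, hι⟩,
          decay (A j t + q j * Complex.I) := by
        rw [Finset.prod_map]
        refine Finset.prod_congr rfl fun i _ => ?_
        simp only [Function.Embedding.coeFn_mk, decay, Complex.add_im, hAι, Pi.sub_apply]
        congr 2
        simp
        ring
      rw [h1, ← Finset.prod_sdiff (Finset.subset_univ (Finset.univ.map ⟨ι, hι⟩))]
      exact mul_le_of_le_one_left (Finset.prod_nonneg fun j _ => (decay_pos _).le)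
        (Finset.prod_le_one (fun j _ => (decay_pos _).le) fun j _ => decay_le_one _)
    have hφ0 : 0 ≤ φ q := Finset.prod_nonneg fun j _ => (decay_pos _).le
    calc _ ≤ M * ∏ j, ((CA j * decay (A j t + q j * Complex.I)) * CB j *
          ((CG j * decay (G j - q j * Complex.I)) * CD j)) := by
          rw [norm_mul, norm_prod]
          refine mul_le_mul (hVM t) (Finset.prod_le_prod (fun _ _ => norm_nonneg _) fun j _ => ?_)
            (Finset.prod_nonneg fun _ _ => norm_nonneg _) hM
          rw [norm_mul, norm_mul, norm_mul]
          have h1 := hCA j (A j t + q j * Complex.I) (by rw [(hpos _ _).1, hAx])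
          have h2 := (hCB j (B j t + q j * Complex.I) (by rw [(hpos _ _).1, hBy])).trans
            (mul_le_of_le_one_right (hCB0 j) (decay_le_one _))
          have h3 := hCG j (G j - q j * Complex.I) (hpos _ _).2
          have h4 := (hCD j (D j - q j * Complex.I) (hpos _ _).2).trans
            (mul_le_of_le_one_right (hCD0 j) (decay_le_one _))
          have p1 := mul_nonneg (hCA0 j) (decay_pos (A j t + q j * Complex.I)).le
          have p3 := mul_nonneg (hCG0 j) (decay_pos (G j - q j * Complex.I)).le
          have := hCB0 j
          gcongr
      _ = M * (∏ j, (CA j * CB j * (CG j * CD j))) * (φ q * ∏ j, decay (A j t + q j * Complex.I)) := by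
          rw [hφ]
          simp only [Finset.prod_mul_distrib]
          ring
      _ ≤ _ := by
          have : 0 ≤ ∏ j, (CA j * CB j * (CG j * CD j)) := Finset.prod_nonneg fun j _ => by
            have := hCA0 j; have := hCB0 j; have := hCG0 j; have := hCD0 j; positivity
          gcongr

/-- Barnes' first lemma applied under an integral sign in each of several variables. -/
theorem integral_integral_barnes {k n : ℕ} {ι : Fin k → Fin n} (hι : Function.Injective ι)
    {V : (Fin k → ℝ) → ℂ} (hV : Continuous V) {M : ℝ} (hM : 0 ≤ M) (hVM : ∀ t, ‖V t‖ ≤ M)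
    {A B : Fin n → (Fin k → ℝ) → ℂ} (hA : ∀ j, Continuous (A j)) (hB : ∀ j, Continuous (B j))
    {x y : Fin n → ℝ} (hx : ∀ j, 0 < x j) (hy : ∀ j, 0 < y j) (hAx : ∀ j t, (A j t).re = x j)
    (hBy : ∀ j t, (B j t).re = y j) (hAι : ∀ i t, (A (ι i) t).im = -t i)
    {G D : Fin n → ℂ} (hG : ∀ j, 0 < (G j).re) (hD : ∀ j, 0 < (D j).re) :
    ∫ q : Fin n → ℝ, ∫ t : Fin k → ℝ, V t * ∏ j,
      (Complex.Gammaℝ (A j t + q j * Complex.I) * Complex.Gammaℝ (B j t + q j * Complex.I) *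
        (Complex.Gammaℝ (G j - q j * Complex.I) * Complex.Gammaℝ (D j - q j * Complex.I))) =
      (4 * (Real.pi : ℂ)) ^ n * ∫ t : Fin k → ℝ, V t * ∏ j,
        (Complex.Gammaℝ (A j t + G j) * Complex.Gammaℝ (A j t + D j) * Complex.Gammaℝ (B j t + G j) *
          Complex.Gammaℝ (B j t + D j) / Complex.Gammaℝ (A j t + B j t + G j + D j)) := by
  have h := integrable_prod_barnes hι hV hM hVM hA hB hx hy hAx hBy hAι hG hD
  rw [integral_integral_swap h, ← integral_const_mul]
  congr 1
  ext t
  rw [integral_const_mul]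
  have h1 := integral_fintype_prod_volume_eq_prod (𝕜 := ℂ) fun (j : Fin n) (u : ℝ) =>
    Complex.Gammaℝ (A j t + u * Complex.I) * Complex.Gammaℝ (B j t + u * Complex.I) *
        (Complex.Gammaℝ (G j - u * Complex.I) * Complex.Gammaℝ (D j - u * Complex.I))
  rw [h1]
  have h2 : ∀ j, _ := fun j => barnes_first_lemma (α := A j t) (β := B j t) (γ := G j) (δ := D j)
    ((hAx j t).symm ▸ hx j) ((hBy j t).symm ▸ hy j) (hG j) (hD j)
  simp only [h2, Finset.prod_mul_distrib, Finset.prod_const, Finset.card_univ, Fintype.card_fin]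
  ring

/-! ### The integral identity for parameters with large real part -/

/-- `p` followed by `-|a|`. -/
def extend {k : ℕ} (a : Fin (k + 1) → ℂ) (p : Fin k → ℂ) : Fin (k + 1) → ℂ :=
  Fin.snoc p (-∑ i, a i)

@[simp] theorem extend_castSucc {k : ℕ} (a : Fin (k + 1) → ℂ) (p : Fin k → ℂ) (j : Fin k) :
    extend a p j.castSucc = p j := by simp [extend]

@[simp] theorem extend_last {k : ℕ} (a : Fin (k + 1) → ℂ) (p : Fin k → ℂ) :
    extend a p (Fin.last k) = -∑ i, a i := by simp [extend]

/-- The Mellin-Barnes integral identity, with the denominators cleared. -/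
def BarnesIdentity {k : ℕ} (a : Fin (k + 1) → ℂ) (σ : ℂ) (p : Fin k → ℂ) : Prop :=
  mellinBarnes k a p * (∏ i, Complex.Gammaℝ (σ - a i)) * (Complex.Gammaℝ (extend a p 0 + σ))⁻¹ =
    ((4 * (Real.pi : ℂ) * Complex.I) ^ k)⁻¹ *
      barnesInt (poles a) (mellinBarnes k a) p fun j => extend a p j.succ + σ

theorem exists_re_lt_of_poles {k : ℕ} (a : Fin (k + 1) → ℂ) :
    ∃ D, 0 ≤ D ∧ ∀ j, ∀ z ∈ poles a j, z.re < D := by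
  obtain ⟨B, hB⟩ := (Set.finite_range fun I : Finset (Fin (k + 1)) => -(∑ i ∈ I, a i).re).bddAbove
  refine ⟨|B| + 1, by positivity, ?_⟩
  rintro j _ ⟨I, -, m, rfl⟩
  have h1 := hB ⟨I, rfl⟩
  have h2 := le_abs_self B
  have h3 : (0 : ℝ) ≤ m := m.cast_nonneg
  simp only at h1
  have h4 : (-(∑ i ∈ I, a i) - 2 * (m : ℂ)).re = -(∑ i ∈ I, a i).re - 2 * m := by simp
  rw [h4]
  linarith

/-- With `0` put before `w` and `-e` after it, the two gamma factors in front fit the pattern of the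
kernel. Each `q j` then occurs in exactly two factors, ready for Barnes' first lemma. -/
theorem prod_kernel_eq {k : ℕ} (q : Fin (k + 1) → ℂ) (b e : ℂ) (w : Fin k → ℂ) :
    Complex.Gammaℝ (q 0 + b) * Complex.Gammaℝ (q (Fin.last k) + e) *
      barnesKernel (fun j => q j.castSucc) (fun j => q j.succ + b) w =
    ∏ j, (Complex.Gammaℝ (q j - (Fin.snoc w (-e) : Fin (k + 1) → ℂ) j) *
      Complex.Gammaℝ (q j + b - (Fin.cons 0 w : Fin (k + 1) → ℂ) j)) := by
  rw [Finset.prod_mul_distrib, Fin.prod_univ_castSucc, Fin.prod_univ_succ (n := k), barnesKernel,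
    Finset.prod_mul_distrib]
  simp only [Fin.snoc_castSucc, Fin.snoc_last, Fin.cons_zero, Fin.cons_succ, sub_neg_eq_add, sub_zero]
  ring

/-- The same regrouping for the kernel of the identity: the factor left over is free of `v`. -/
theorem prod_kernel_extend_eq {k : ℕ} (a : Fin (k + 1) → ℂ) (v w : Fin k → ℂ) (σ : ℂ) :
    Complex.Gammaℝ (extend a v 0 + σ) * barnesKernel v (fun j => extend a v j.succ + σ) w =
    Complex.Gammaℝ (-(∑ i, a i) + σ - (Fin.cons 0 w : Fin (k + 1) → ℂ) (Fin.last k)) *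
    ∏ j, (Complex.Gammaℝ (v j - w j) *
      Complex.Gammaℝ (v j + σ - (Fin.cons 0 w : Fin (k + 1) → ℂ) j.castSucc)) := by
  have h : Complex.Gammaℝ (extend a v 0 + σ) * ∏ j : Fin k, Complex.Gammaℝ (extend a v j.succ + σ - w j)
      = ∏ j : Fin (k + 1), Complex.Gammaℝ (extend a v j + σ - (Fin.cons 0 w : Fin (k + 1) → ℂ) j) := by
    rw [Fin.prod_univ_succ]
    simp
  rw [barnesKernel, Finset.prod_mul_distrib, Finset.prod_mul_distrib, mul_left_comm, h,
    Fin.prod_univ_castSucc]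
  simp only [extend_castSucc, extend_last]
  ring

/-- The factor contributed by one application of Barnes' first lemma. -/
def barnesFactor (α β γ δ : ℂ) : ℂ :=
  Complex.Gammaℝ (α + γ) * Complex.Gammaℝ (α + δ) * Complex.Gammaℝ (β + γ) *
    Complex.Gammaℝ (β + δ) / Complex.Gammaℝ (α + β + γ + δ)

theorem telescope {k : ℕ} {X Y : Fin k → ℂ} {r : Fin (k + 1) → ℂ} (hr : ∀ j, r j ≠ 0)
    (h : ∀ j : Fin k, X j * r j.succ = Y j * r j.castSucc) :
    (∏ j, X j) * r (Fin.last k) = (∏ j, Y j) * r 0 := by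
  have h1 : (∏ j, X j) * ∏ j : Fin k, r j.succ = (∏ j, Y j) * ∏ j : Fin k, r j.castSucc := by
    rw [← Finset.prod_mul_distrib, ← Finset.prod_mul_distrib]
    exact Finset.prod_congr rfl fun j _ => h j
  have h2 := (Fin.prod_univ_succ r).symm.trans (Fin.prod_univ_castSucc r)
  have h3 : ∏ j : Fin k, r j.succ ≠ 0 := Finset.prod_ne_zero_iff.mpr fun j _ => hr _
  refine mul_right_cancel₀ h3 ?_
  linear_combination r (Fin.last k) * h1 - (∏ j, Y j) * h2

/-- The abscissae `c` and `e` cancel within each factor. The last of the `k + 1` factors is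
simplified separately; the other `k` match those on the right up to the quotients of consecutive
`r_j = Γ_ℝ(p_j + a_0 - W_j)/Γ_ℝ(p_j + σ - W_j)`, which telescope. The boundary value at `W_0 = 0`
gives the factors in `p 0`. -/
theorem kernels_agree {k : ℕ} (a : Fin (k + 2) → ℂ) (σ : ℂ) (p : Fin (k + 1) → ℂ) (w : Fin k → ℂ)
    (c e : ℂ) (h1 : ∀ j, Complex.Gammaℝ (p j + a 0 - (Fin.cons 0 w : Fin (k + 1) → ℂ) j) ≠ 0)
    (h2 : ∀ j, Complex.Gammaℝ (p j + σ - (Fin.cons 0 w : Fin (k + 1) → ℂ) j) ≠ 0) :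
    ∏ j, barnesFactor (c - (Fin.snoc w (-∑ i, Fin.tail a i) : Fin (k + 1) → ℂ) j)
      (c + a 0 - (Fin.cons 0 w : Fin (k + 1) → ℂ) j) (p j - c) (extend a p j.succ + σ - c) =
    (Complex.Gammaℝ (p 0 + σ))⁻¹ * Complex.Gammaℝ (p 0 + a 0) *
      Complex.Gammaℝ (p (Fin.last k) + ∑ i, Fin.tail a i) * Complex.Gammaℝ (σ - a 0) *
      (Complex.Gammaℝ (-(∑ i, Fin.tail a i) + σ - (Fin.cons 0 w : Fin (k + 1) → ℂ) (Fin.last k)) *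
      ∏ j : Fin k, barnesFactor (e - w j)
        (e + σ - (Fin.cons 0 w : Fin (k + 1) → ℂ) j.castSucc) (p j.castSucc - e)
        (p j.succ + a 0 - e)) := by
  set W : Fin (k + 1) → ℂ := Fin.cons 0 w with hW
  have hw : ∀ j, w j = W j.succ := fun j => by simp [hW]
  have hsum : ∑ i, a i = a 0 + ∑ i, Fin.tail a i := Fin.sum_univ_succ a
  rw [Fin.prod_univ_castSucc]
  have hlast : barnesFactor (c - (Fin.snoc w (-∑ i, Fin.tail a i) : Fin (k + 1) → ℂ) (Fin.last k))
      (c + a 0 - W (Fin.last k)) (p (Fin.last k) - c)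
      (extend a p (Fin.last k).succ + σ - c) =
      Complex.Gammaℝ (p (Fin.last k) + ∑ i, Fin.tail a i) * Complex.Gammaℝ (σ - a 0) *
      Complex.Gammaℝ (-(∑ i, Fin.tail a i) + σ - W (Fin.last k)) *
      (Complex.Gammaℝ (p (Fin.last k) + a 0 - W (Fin.last k)) /
        Complex.Gammaℝ (p (Fin.last k) + σ - W (Fin.last k))) := by
    rw [barnesFactor, Fin.succ_last, extend_last, Fin.snoc_last, hsum]
    generalize ∑ i, Fin.tail a i = S
    rw [show c - -S + (p (Fin.last k) - c) = p (Fin.last k) + S by ring,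
      show c - -S + (-(a 0 + S) + σ - c) = σ - a 0 by ring,
      show c + a 0 - W (Fin.last k) + (p (Fin.last k) - c) = p (Fin.last k) + a 0 - W (Fin.last k) by
        ring,
      show c + a 0 - W (Fin.last k) + (-(a 0 + S) + σ - c) = -S + σ - W (Fin.last k) by ring,
      show c - -S + (c + a 0 - W (Fin.last k)) + (p (Fin.last k) - c) + (-(a 0 + S) + σ - c) =
        p (Fin.last k) + σ - W (Fin.last k) by ring]
    ring
  rw [hlast]
  have htel := telescope (X := fun j : Fin k => barnesFactor
      (c - (Fin.snoc w (-∑ i, Fin.tail a i) : Fin (k + 1) → ℂ) j.castSucc)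
      (c + a 0 - W j.castSucc) (p j.castSucc - c) (extend a p j.castSucc.succ + σ - c))
    (Y := fun j : Fin k => barnesFactor (e - w j) (e + σ - W j.castSucc) (p j.castSucc - e)
        (p j.succ + a 0 - e))
    (r := fun j => Complex.Gammaℝ (p j + a 0 - W j) / Complex.Gammaℝ (p j + σ - W j))
    (fun j => div_ne_zero (h1 j) (h2 j)) fun j => by
      simp only [Fin.snoc_castSucc, ← Fin.castSucc_succ, extend_castSucc, hw, barnesFactor]
      rw [show c - W j.succ + (p j.castSucc - c) = p j.castSucc - W j.succ by ring,
        show c - W j.succ + (p j.succ + σ - c) = p j.succ + σ - W j.succ by ring,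
        show c + a 0 - W j.castSucc + (p j.castSucc - c) = p j.castSucc + a 0 - W j.castSucc by ring,
        show c + a 0 - W j.castSucc + (p j.succ + σ - c) = p j.succ + σ + a 0 - W j.castSucc by ring,
        show c - W j.succ + (c + a 0 - W j.castSucc) + (p j.castSucc - c) + (p j.succ + σ - c) =
          p j.castSucc + p j.succ + σ + a 0 - W j.succ - W j.castSucc by ring,
        show e - W j.succ + (p j.castSucc - e) = p j.castSucc - W j.succ by ring,
        show e - W j.succ + (p j.succ + a 0 - e) = p j.succ + a 0 - W j.succ by ring,
        show e + σ - W j.castSucc + (p j.castSucc - e) = p j.castSucc + σ - W j.castSucc by ring,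
        show e + σ - W j.castSucc + (p j.succ + a 0 - e) = p j.succ + σ + a 0 - W j.castSucc by ring,
        show e - W j.succ + (e + σ - W j.castSucc) + (p j.castSucc - e) + (p j.succ + a 0 - e) =
          p j.castSucc + p j.succ + σ + a 0 - W j.succ - W j.castSucc by ring]
      have e1 := h2 j.succ
      have e2 := h2 j.castSucc
      generalize Complex.Gammaℝ (p j.succ + σ - W j.succ) = g1 at *
      generalize Complex.Gammaℝ (p j.castSucc + σ - W j.castSucc) = g2 at *
      rw [← mul_div_assoc, ← mul_div_assoc, div_eq_div_iff e1 e2]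
      ring
  have h0 : W 0 = 0 := by simp [hW]
  rw [h0, sub_zero, sub_zero] at htel
  rw [div_eq_mul_inv (Complex.Gammaℝ (p 0 + a 0))] at htel
  linear_combination (Complex.Gammaℝ (p (Fin.last k) + ∑ i, Fin.tail a i) * Complex.Gammaℝ (σ - a 0) *
    Complex.Gammaℝ (-(∑ i, Fin.tail a i) + σ - W (Fin.last k))) * htel

theorem continuous_cons_vline {k : ℕ} (d : ℝ) (j : Fin (k + 1)) :
    Continuous fun t : Fin k → ℝ => (Fin.cons 0 (fun i => vline d (t i)) : Fin (k + 1) → ℂ) j := by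
  refine Fin.cases ?_ (fun j => ?_) j
  · simp only [Fin.cons_zero]; fun_prop
  · simp only [Fin.cons_succ]; exact (continuous_vline d).comp (continuous_apply j)

theorem continuous_snoc_vline {k : ℕ} (d : ℝ) (e : ℂ) (j : Fin (k + 1)) :
    Continuous fun t : Fin k → ℝ => (Fin.snoc (fun i => vline d (t i)) e : Fin (k + 1) → ℂ) j := by
  refine Fin.lastCases ?_ (fun j => ?_) j
  · simp only [Fin.snoc_last]; fun_prop
  · simp only [Fin.snoc_castSucc]; exact (continuous_vline d).comp (continuous_apply j)

theorem re_cons_vline {k : ℕ} (d : ℝ) (j : Fin (k + 1)) (t : Fin k → ℝ) :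
    ((Fin.cons 0 (fun i => vline d (t i)) : Fin (k + 1) → ℂ) j).re =
      (Fin.cons 0 (fun _ => d) : Fin (k + 1) → ℝ) j := by
  refine Fin.cases ?_ (fun j => ?_) j <;> simp

theorem re_snoc_vline {k : ℕ} (d : ℝ) (e : ℂ) (j : Fin (k + 1)) (t : Fin k → ℝ) :
    ((Fin.snoc (fun i => vline d (t i)) e : Fin (k + 1) → ℂ) j).re =
      (Fin.snoc (fun _ => d) e.re : Fin (k + 1) → ℝ) j := by
  refine Fin.lastCases ?_ (fun j => ?_) j <;> simp

theorem cons_const_le {k : ℕ} {d : ℝ} (hd : 0 ≤ d) (j : Fin (k + 1)) :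
    (Fin.cons 0 (fun _ => d) : Fin (k + 1) → ℝ) j ≤ d := by
  refine Fin.cases ?_ (fun j => ?_) j <;> simp [hd]

/-- The right-hand side of the identity, as an integral over the variables of the recursion. -/
theorem integral_mellinBarnes_mul_kernel {k : ℕ} (a : Fin (k + 2) → ℂ) (σ : ℂ) (p : Fin (k + 1) → ℂ)
    {d c : ℝ} (hd : 0 ≤ d) (hdL : ∀ j, ∀ z ∈ poles (Fin.tail a) j, z.re < d) (hdc : d < c)
    (hdc' : d < c + (a 0).re) (hc : 0 < c + (∑ i, Fin.tail a i).re) (hp : ∀ j, c < (p j).re)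
    (hp' : ∀ j : Fin (k + 1), c < (extend a p j.succ + σ).re) :
    ∫ q : Fin (k + 1) → ℝ, mellinBarnes (k + 1) a (fun j => vline c (q j)) *
        barnesKernel p (fun j => extend a p j.succ + σ) (fun j => vline c (q j)) =
      4 * (Real.pi : ℂ) * ∫ t : Fin k → ℝ, mellinBarnes k (Fin.tail a) (fun j => vline d (t j)) *
        ∏ j, barnesFactor
          (c - (Fin.snoc (fun j => vline d (t j)) (-∑ i, Fin.tail a i) : Fin (k + 1) → ℂ) j)
          (c + a 0 - (Fin.cons 0 (fun j => vline d (t j)) : Fin (k + 1) → ℂ) j) (p j - c)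
          (extend a p j.succ + σ - c) := by
  obtain ⟨hVc, M, hM0, hM⟩ := mellinBarnes_vline (Fin.tail a) (c := fun _ => d) hdL
  have key := integral_integral_barnes (ι := Fin.castSucc) (Fin.castSucc_injective k) hVc hM0 hM
    (A := fun j t => c - (Fin.snoc (fun j => vline d (t j)) (-∑ i, Fin.tail a i) :
      Fin (k + 1) → ℂ) j)
    (B := fun j t => c + a 0 - (Fin.cons 0 (fun j => vline d (t j)) : Fin (k + 1) → ℂ) j)
    (x := fun j => c - (Fin.snoc (fun _ => d) (-∑ i, Fin.tail a i).re : Fin (k + 1) → ℝ) j)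
    (y := fun j => c + (a 0).re - (Fin.cons 0 (fun _ => d) : Fin (k + 1) → ℝ) j)
    (fun j => continuous_const.sub (continuous_snoc_vline d _ j))
    (fun j => continuous_const.sub (continuous_cons_vline d j))
    (fun j => by
      refine Fin.lastCases ?_ (fun j => ?_) j
      · simp only [Fin.snoc_last, Complex.neg_re]; linarith
      · simp only [Fin.snoc_castSucc]; linarith)
    (fun j => by have := cons_const_le hd j; linarith)
    (fun j t => by rw [Complex.sub_re, re_snoc_vline, Complex.ofReal_re])
    (fun j t => by rw [Complex.sub_re, re_cons_vline, Complex.add_re, Complex.ofReal_re])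
    (fun j t => by simp) (G := fun j => p j - c) (D := fun j => extend a p j.succ + σ - c)
    (fun j => by have := hp j; simp; linarith)
    (fun j => by have := hp' j; rw [Complex.sub_re, Complex.ofReal_re]; linarith)
  have h4 : (4 * (Real.pi : ℂ)) ≠ 0 := by simp [Real.pi_ne_zero]
  calc _ = ((4 * (Real.pi : ℂ)) ^ k)⁻¹ * ∫ q : Fin (k + 1) → ℝ, ∫ t : Fin k → ℝ,
        mellinBarnes k (Fin.tail a) (fun j => vline d (t j)) * ∏ j,
          (Complex.Gammaℝ (c - (Fin.snoc (fun j => vline d (t j)) (-∑ i, Fin.tail a i) :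
              Fin (k + 1) → ℂ) j + q j * Complex.I) *
            Complex.Gammaℝ (c + a 0 - (Fin.cons 0 (fun j => vline d (t j)) : Fin (k + 1) → ℂ) j +
              q j * Complex.I) *
          (Complex.Gammaℝ (p j - c - q j * Complex.I) *
            Complex.Gammaℝ (extend a p j.succ + σ - c - q j * Complex.I))) := by
        rw [← integral_const_mul]
        congr 1
        ext q
        rw [mellinBarnes_succ_eq_integral a (c := fun _ => d) hdL (fun j => by simpa using hdc)
          fun j => by simpa using hdc']
        rw [mul_comm _ (∫ t : Fin k → ℝ, _), mul_assoc, ← integral_mul_const, ← integral_const_mul]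
        congr 1
        ext t
        have h1 := prod_kernel_eq (fun j => vline c (q j)) (a 0) (∑ i, Fin.tail a i)
          fun j => vline d (t j)
        have h2 : ∏ j : Fin (k + 1),
          (Complex.Gammaℝ (c - (Fin.snoc (fun j => vline d (t j)) (-∑ i, Fin.tail a i) :
              Fin (k + 1) → ℂ) j + q j * Complex.I) *
            Complex.Gammaℝ (c + a 0 - (Fin.cons 0 (fun j => vline d (t j)) : Fin (k + 1) → ℂ) j +
              q j * Complex.I) *
          (Complex.Gammaℝ (p j - c - q j * Complex.I) *
            Complex.Gammaℝ (extend a p j.succ + σ - c - q j * Complex.I))) =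
          (∏ j, (Complex.Gammaℝ (vline c (q j) -
              (Fin.snoc (fun j => vline d (t j)) (-∑ i, Fin.tail a i) : Fin (k + 1) → ℂ) j) *
            Complex.Gammaℝ (vline c (q j) + a 0 -
              (Fin.cons 0 (fun j => vline d (t j)) : Fin (k + 1) → ℂ) j))) *
          barnesKernel p (fun j => extend a p j.succ + σ) (fun j => vline c (q j)) := by
          rw [barnesKernel, ← Finset.prod_mul_distrib]
          refine Finset.prod_congr rfl fun j _ => ?_
          simp only [vline]
          congr 1
          · congr 2 <;> ring
          · congr 2 <;> ring
        rw [h2, ← h1]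
        ring
    _ = _ := by
        rw [key, pow_succ, ← mul_assoc, ← mul_assoc, inv_mul_cancel₀ (pow_ne_zero _ h4), one_mul]
        rfl

/-- The left-hand side of the identity, as an integral over the variables of the recursion. -/
theorem mellinBarnes_mul_prod_eq_integral {k : ℕ} (a : Fin (k + 2) → ℂ) (σ : ℂ)
    (p : Fin (k + 1) → ℂ) {d e : ℝ} (hd : 0 ≤ d)
    (hdL : ∀ j, ∀ z ∈ poles (Fin.tail a) j, z.re < d) (hde : d < e) (hσ : 0 ≤ σ.re)
    (hσ' : d < (-(∑ i, Fin.tail a i) + σ).re) (hp : ∀ j, e < (p j).re)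
    (hp' : ∀ j, e < (p j + a 0).re)
    (ih : ∀ v : Fin k → ℂ, (∀ j, (v j).re = e) → BarnesIdentity (Fin.tail a) σ v) :
    mellinBarnes (k + 1) a p * ∏ i, Complex.Gammaℝ (σ - a i) =
      Complex.Gammaℝ (p 0 + a 0) * Complex.Gammaℝ (p (Fin.last k) + ∑ i, Fin.tail a i) *
        Complex.Gammaℝ (σ - a 0) * ((4 * (Real.pi : ℂ)) ^ k)⁻¹ *
        ∫ t : Fin k → ℝ, mellinBarnes k (Fin.tail a) (fun j => vline d (t j)) *
          (Complex.Gammaℝ (-(∑ i, Fin.tail a i) + σ -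
            (Fin.cons 0 (fun j => vline d (t j)) : Fin (k + 1) → ℂ) (Fin.last k)) *
          ∏ j : Fin k, barnesFactor (e - vline d (t j))
            (e + σ - (Fin.cons 0 (fun j => vline d (t j)) : Fin (k + 1) → ℂ) j.castSucc)
            (p j.castSucc - e) (p j.succ + a 0 - e)) := by
  set a' := Fin.tail a with ha'
  obtain ⟨hVc, M, hM0, hM⟩ := mellinBarnes_vline a' (c := fun _ => d) hdL
  have h4 : (4 * (Real.pi : ℂ)) ≠ 0 := by simp [Real.pi_ne_zero]
  set T : (Fin k → ℝ) → ℂ := fun t => -(∑ i, a' i) + σ -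
    (Fin.cons 0 (fun j => vline d (t j)) : Fin (k + 1) → ℂ) (Fin.last k) with hT
  set xT : ℝ := (-(∑ i, a' i) + σ).re - (Fin.cons 0 (fun _ => d) : Fin (k + 1) → ℝ) (Fin.last k)
    with hxT
  have hxT0 : 0 < xT := by have := cons_const_le hd (Fin.last k); linarith
  have hTx : ∀ t, (T t).re = xT := fun t => by rw [hT, hxT]; simp only; rw [Complex.sub_re, re_cons_vline]
  have hTc : Continuous T := continuous_const.sub (continuous_cons_vline d _)
  obtain ⟨N, hN0, hN⟩ := exists_norm_Gammaℝ_le_of_re hxT0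
  have key := integral_integral_barnes (ι := id) Function.injective_id
    (V := fun t => mellinBarnes k a' (fun j => vline d (t j)) * Complex.Gammaℝ (T t))
    (hVc.mul (continuous_Gammaℝ_comp hTc fun t => (hTx t).symm ▸ hxT0)) (mul_nonneg hM0 hN0)
    (fun t => by
      rw [norm_mul]
      exact mul_le_mul (hM t) ((hN _ (hTx t)).trans (mul_le_of_le_one_right hN0 (decay_le_one _)))
        (norm_nonneg _) hM0)
    (A := fun j t => e - vline d (t j))
    (B := fun j t => e + σ - (Fin.cons 0 (fun j => vline d (t j)) : Fin (k + 1) → ℂ) j.castSucc)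
    (x := fun j => e - d)
    (y := fun j => e + σ.re - (Fin.cons 0 (fun _ => d) : Fin (k + 1) → ℝ) j.castSucc)
    (fun j => continuous_const.sub ((continuous_vline d).comp (continuous_apply j)))
    (fun j => continuous_const.sub (continuous_cons_vline d _))
    (fun j => by linarith)
    (fun j => by have := cons_const_le hd j.castSucc; linarith)
    (fun j t => by simp)
    (fun j t => by rw [Complex.sub_re, re_cons_vline, Complex.add_re, Complex.ofReal_re])
    (fun j t => by simp) (G := fun j => p j.castSucc - e) (D := fun j => p j.succ + a 0 - e)
    (fun j => by have := hp j.castSucc; simp; linarith)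
    (fun j => by have := hp' j.succ; rw [Complex.sub_re, Complex.ofReal_re]; linarith)
  -- The identity in lower rank, with `v` on the line `Re = e` and its contour on `Re = d < e`,
  -- regrouped so that each `v j` occurs in two gamma factors.
  have hline : ∀ v : Fin k → ℂ, (∀ j, (v j).re = e) →
      mellinBarnes k a' v * ∏ i, Complex.Gammaℝ (σ - a' i) =
      ((4 * (Real.pi : ℂ)) ^ k)⁻¹ * ∫ t : Fin k → ℝ, mellinBarnes k a' (fun j => vline d (t j)) *
        Complex.Gammaℝ (T t) * ∏ j, (Complex.Gammaℝ (v j - vline d (t j)) * Complex.Gammaℝ (v j + σ -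
          (Fin.cons 0 (fun j => vline d (t j)) : Fin (k + 1) → ℂ) j.castSucc)) := by
    intro v hv
    have hre : ∀ j : Fin (k + 1), d < (extend a' v j + σ).re := fun j => by
      refine Fin.lastCases ?_ (fun j => ?_) j
      · rw [extend_last]; exact hσ'
      · rw [extend_castSucc, Complex.add_re, hv]; linarith
    have h0 : Complex.Gammaℝ (extend a' v 0 + σ) ≠ 0 :=
      Complex.Gammaℝ_ne_zero_of_re_pos (hd.trans_lt (hre 0))
    have h1 := ih v hv
    rw [BarnesIdentity, ((boundedOff_mellinBarnes a').barnesInt_eq_integral_vline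
      (isLeftSet_poles a') hdL (fun j => by rw [hv]; exact hde) fun j => hre j.succ).2,
      ← mul_assoc, four_pi_I_inv_mul, ← div_eq_mul_inv, div_eq_iff h0] at h1
    rw [h1, mul_assoc, ← integral_mul_const]
    congr 2
    ext t
    have h2 := prod_kernel_extend_eq a' v (fun j => vline d (t j)) σ
    linear_combination mellinBarnes k a' (fun j => vline d (t j)) * h2
  rw [mellinBarnes_succ_eq_integral a (c := fun _ => e) (fun j z hz => (hdL j z hz).trans hde)
    (fun j => hp _) fun j => hp' _, Fin.prod_univ_succ]
  have hswap : (∫ t : Fin k → ℝ, mellinBarnes k a' (fun j => vline e (t j)) *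
      barnesKernel (fun j => p j.castSucc) (fun j => p j.succ + a 0) fun j => vline e (t j)) *
      ∏ i, Complex.Gammaℝ (σ - a' i) = ∫ t : Fin k → ℝ,
        mellinBarnes k a' (fun j => vline d (t j)) * (Complex.Gammaℝ (T t) *
        ∏ j : Fin k, barnesFactor (e - vline d (t j))
            (e + σ - (Fin.cons 0 (fun j => vline d (t j)) : Fin (k + 1) → ℂ) j.castSucc)
            (p j.castSucc - e) (p j.succ + a 0 - e)) := by
    calc _ = ((4 * (Real.pi : ℂ)) ^ k)⁻¹ * ∫ q : Fin k → ℝ, ∫ t : Fin k → ℝ,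
          mellinBarnes k a' (fun j => vline d (t j)) * Complex.Gammaℝ (T t) * ∏ j,
          (Complex.Gammaℝ (e - vline d (t j) + q j * Complex.I) *
            Complex.Gammaℝ (e + σ - (Fin.cons 0 (fun j => vline d (t j)) : Fin (k + 1) → ℂ)
              j.castSucc + q j * Complex.I) *
          (Complex.Gammaℝ (p j.castSucc - e - q j * Complex.I) *
            Complex.Gammaℝ (p j.succ + a 0 - e - q j * Complex.I))) := by
          rw [← integral_mul_const, ← integral_const_mul]
          congr 1
          ext q
          rw [mul_right_comm, hline (fun j => vline e (q j)) fun j => vline_re _ _, mul_assoc,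
            ← integral_mul_const]
          congr 2
          ext t
          rw [barnesKernel, mul_assoc, ← Finset.prod_mul_distrib]
          congr 1
          refine Finset.prod_congr rfl fun j _ => ?_
          simp only [vline]
          congr 1
          · congr 2 <;> ring
          · congr 2 <;> ring
      _ = _ := by
          rw [key, ← mul_assoc, inv_mul_cancel₀ (pow_ne_zero _ h4), one_mul]
          congr 1
          ext t
          rw [mul_assoc]
          rfl
  rw [← hswap]
  simp only [ha', Fin.tail]
  ring

/-- For large real parts all contours are vertical lines, both sides become integrals over the
variables of the recursion, and `kernels_agree` compares the integrands. -/
theorem exists_barnesIdentity_of_large {k : ℕ} (a : Fin (k + 2) → ℂ)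
    (ih : ∀ (σ : ℂ) (p : Fin k → ℂ), (∀ j, p j ∉ poles (Fin.tail a) j) →
      (∀ j : Fin k, extend (Fin.tail a) p j.succ + σ ∉ poles (Fin.tail a) j) →
      (∀ i, ∀ m : ℕ, σ - Fin.tail a i ≠ -(2 * m)) → BarnesIdentity (Fin.tail a) σ p) :
    ∃ X : ℝ, ∀ (σ : ℂ) (p : Fin (k + 1) → ℂ), X ≤ σ.re → (∀ j, X ≤ (p j).re) →
      BarnesIdentity a σ p := by
  obtain ⟨d, hd, hdL⟩ := exists_re_lt_of_poles (Fin.tail a)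
  obtain ⟨d', hd', hdL'⟩ := exists_re_lt_of_poles a
  set S := ∑ i, |(a i).re| with hS
  have hSa : ∀ i, |(a i).re| ≤ S := fun i =>
    Finset.single_le_sum (f := fun i => |(a i).re|) (fun _ _ => abs_nonneg _) (Finset.mem_univ i)
  have hS1 : |(∑ i, a i).re| ≤ S := by rw [Complex.re_sum]; exact Finset.abs_sum_le_sum_abs _ _
  have hS2 : |(∑ i, Fin.tail a i).re| ≤ S := by
    rw [Complex.re_sum]
    have hS' : S = |(a 0).re| + ∑ i : Fin (k + 1), |(a i.succ).re| := Fin.sum_univ_succ _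
    have h0 := abs_nonneg (a 0).re
    have h1 := Finset.abs_sum_le_sum_abs (fun i => (a (Fin.succ i)).re) Finset.univ
    simp only [Fin.tail]
    linarith
  have hS0 : 0 ≤ S := (abs_nonneg _).trans hS1
  have b0 := abs_le.mp (hSa 0)
  have b1 := abs_le.mp hS1
  have b2 := abs_le.mp hS2
  -- `d` and `d'` lie to the right of the poles for `Fin.tail a` and for `a`; `S` absorbs the shifts
  -- by `a 0` and by the sums of the parameters.
  set e := d + d' + S + 1 with he
  refine ⟨e + S + 1, fun σ p hσ hp => ?_⟩
  have hext : ∀ j : Fin (k + 1), e < (extend a p j.succ + σ).re := fun j => by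
    refine Fin.lastCases ?_ (fun j => ?_) j
    · rw [Fin.succ_last, extend_last, Complex.add_re, Complex.neg_re]; linarith
    · rw [← Fin.castSucc_succ, extend_castSucc, Complex.add_re]; have := hp j.succ; linarith
  have hL := mellinBarnes_mul_prod_eq_integral a σ p (e := e) hd hdL (by linarith) (by linarith)
    (by rw [Complex.add_re, Complex.neg_re]; linarith) (fun j => by have := hp j; linarith)
    (fun j => by have := hp j; rw [Complex.add_re]; linarith) fun v hv => by
      refine ih σ v (fun j hj => ?_) (fun j hj => ?_) fun i m hm => ?_
      · have := hdL j _ hj; rw [hv] at this; linarith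
      · have := hdL j _ hj
        revert this
        refine Fin.lastCases (fun h => ?_) (fun j h => ?_) j.succ
        · rw [extend_last, Complex.add_re, Complex.neg_re] at h; linarith
        · rw [extend_castSucc, Complex.add_re, hv] at h; linarith
      · have h1 := congrArg Complex.re hm
        have h2 := abs_le.mp (hSa i.succ)
        simp [Fin.tail] at h1
        have : (0 : ℝ) ≤ m := m.cast_nonneg
        linarith
  have hR := integral_mellinBarnes_mul_kernel a σ p (c := e) hd hdL (by linarith) (by linarith)
    (by linarith) (fun j => by have := hp j; linarith) hext
  rw [BarnesIdentity, ((boundedOff_mellinBarnes a).barnesInt_eq_integral_vline (c := fun _ => e)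
    (isLeftSet_poles a) (fun j z hz => by have := hdL' j z hz; linarith)
    (fun j => by have := hp j; linarith) hext).2, ← mul_assoc, four_pi_I_inv_mul, hR, hL]
  have hk : ∀ t : Fin k → ℝ, _ := fun t => kernels_agree a σ p (fun j => vline d (t j)) e e
    (fun j => Complex.Gammaℝ_ne_zero_of_re_pos (by
      have := hp j; have := cons_const_le hd j
      rw [Complex.sub_re, re_cons_vline, Complex.add_re]; linarith))
    (fun j => Complex.Gammaℝ_ne_zero_of_re_pos (by
      have := hp j; have := cons_const_le hd j
      rw [Complex.sub_re, re_cons_vline, Complex.add_re]; linarith))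
  simp only [hk]
  have h4 : (4 * (Real.pi : ℂ)) ≠ 0 := by simp [Real.pi_ne_zero]
  simp only [mul_left_comm (mellinBarnes k (Fin.tail a) _)]
  simp only [integral_const_mul]
  simp only [← mul_assoc]
  have h00 : extend a p 0 = p 0 := extend_castSucc a p 0
  rw [h00, pow_succ, mul_inv, mul_assoc _ (4 * (Real.pi : ℂ))⁻¹ 4]
  field_simp

/-! ### Analytic continuation of the identity -/

/-- The complement of a countable set in the plane is connected, so the identity theorem applies. -/
theorem eq_of_eq_of_le_re {B : Set ℂ} (hBc : IsClosed B) (hB : B.Countable) {f g : ℂ → ℂ}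
    (hf : DifferentiableOn ℂ f Bᶜ) (hg : DifferentiableOn ℂ g Bᶜ) {r : ℝ}
    (h : ∀ t : ℂ, r ≤ t.re → f t = g t) {t : ℂ} (ht : t ∉ B) : f t = g t := by
  have hU : IsOpen {t : ℂ | r < t.re} := isOpen_lt continuous_const Complex.continuous_re
  obtain ⟨t₀, ht₀, ht₀B⟩ := (hB.dense_compl ℝ).inter_open_nonempty _ hU
    ⟨((r + 1 : ℝ) : ℂ), by simp⟩
  have hconn : IsPreconnected Bᶜ := (hB.isConnected_compl_of_one_lt_rank
    (by rw [Complex.rank_real_complex]; norm_num)).isPreconnected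
  refine (hf.analyticOnNhd hBc.isOpen_compl).eqOn_of_preconnected_of_eventuallyEq
    (hg.analyticOnNhd hBc.isOpen_compl) hconn ht₀B ?_ ht
  filter_upwards [hU.mem_nhds ht₀] with t ht using h t ht.le

theorem isClosed_and_countable_iUnion_preimage {ι : Type*} [Finite ι] {T : ι → Set ℂ}
    (hT : ∀ i, StripFinite (T i)) {f : ι → ℂ → ℂ} (hf : ∀ i, Continuous (f i))
    (hi : ∀ i, Function.Injective (f i)) :
    IsClosed (⋃ i, f i ⁻¹' T i) ∧ (⋃ i, f i ⁻¹' T i).Countable :=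
  ⟨isClosed_iUnion_of_finite fun i => (hT i).isClosed.preimage (hf i),
    Set.countable_iUnion fun i => (hT i).countable.preimage (hi i)⟩

theorem isOpen_setOf_forall_notMem {k : ℕ} {T : Fin k → Set ℂ} (hT : ∀ j, IsClosed (T j)) :
    IsOpen {w : Fin k → ℂ | ∀ j, w j ∉ T j} := by
  simp only [Set.ofPred_forall]
  exact isOpen_iInter_of_finite fun j =>
    ((hT j).preimage (f := fun w : Fin k → ℂ => w j) (continuous_apply j)).isOpen_compl

theorem extend_add {k : ℕ} (a : Fin (k + 1) → ℂ) (p : Fin k → ℂ) (j : Fin (k + 1)) :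
    Differentiable ℂ (fun t => extend a (fun i => p i + t) j) ∧
      Function.Injective fun t : ℂ => extend a (fun i => p i + t) j + t := by
  refine Fin.lastCases ?_ (fun j => ?_) j
  · simp only [extend_last]
    exact ⟨by fun_prop, add_right_injective _⟩
  · simp only [extend_castSucc]
    refine ⟨by fun_prop, fun t t' h => ?_⟩
    have : t * 2 = t' * 2 := by linear_combination h
    exact mul_right_cancel₀ two_ne_zero this

/-- All parameters are moved together as `(σ + t, p + t)`. For `Re t` large the identity is known,
and continuation leads back to `t = 0`; it suffices that `0` itself is not exceptional. -/
theorem barnesIdentity_succ {k : ℕ} (a : Fin (k + 2) → ℂ)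
    (ih : ∀ (σ : ℂ) (p : Fin k → ℂ), (∀ j, p j ∉ poles (Fin.tail a) j) →
      (∀ j : Fin k, extend (Fin.tail a) p j.succ + σ ∉ poles (Fin.tail a) j) →
      (∀ i, ∀ m : ℕ, σ - Fin.tail a i ≠ -(2 * m)) → BarnesIdentity (Fin.tail a) σ p)
    {σ : ℂ} {p : Fin (k + 1) → ℂ} (hp : ∀ j, p j ∉ poles a j)
    (hp' : ∀ j : Fin (k + 1), extend a p j.succ + σ ∉ poles a j)
    (hσ : ∀ i, ∀ m : ℕ, σ - a i ≠ -(2 * m)) : BarnesIdentity a σ p := by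
  obtain ⟨X, hX⟩ := exists_barnesIdentity_of_large a ih
  obtain ⟨Y, hY⟩ := exists_bound_re_im p
  have hL := fun j => (isLeftSet_poles a j).stripFinite
  -- The exceptional `t`: either argument of the Barnes integral meets a pole, or some `Γ_ℝ(σ + t -
  -- a_i)` has a pole. The factor `1/Γ_ℝ` is entire and adds none.
  obtain ⟨c1, d1⟩ := isClosed_and_countable_iUnion_preimage hL (f := fun j t => p j + t)
    (fun j => by fun_prop) fun j => add_right_injective _
  obtain ⟨c2, d2⟩ := isClosed_and_countable_iUnion_preimage hL
    (f := fun j t => extend a (fun i => p i + t) j.succ + (σ + t))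
    (fun j => (extend_add a p j.succ).1.continuous.add (by fun_prop)) fun j t t' h =>
      (extend_add a p j.succ).2 (by simp only at h ⊢; linear_combination h)
  obtain ⟨c3, d3⟩ := isClosed_and_countable_iUnion_preimage (ι := Fin (k + 2))
    (fun _ => stripFinite_rightPoles 0) (f := fun i t => -(σ + t - a i)) (fun i => by fun_prop)
    fun i t t' h => by simp only at h; linear_combination -h
  have hd : Differentiable ℂ fun t : ℂ => (((fun j => p j + t : Fin (k + 1) → ℂ)),
      (fun j => extend a (fun i => p i + t) j.succ + (σ + t) : Fin (k + 1) → ℂ)) :=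
    (differentiable_pi.mpr fun j => by fun_prop).prodMk (differentiable_pi.mpr fun j =>
      (extend_add a p j.succ).1.add (by fun_prop))
  have key := eq_of_eq_of_le_re ((c1.union c2).union c3) ((d1.union d2).union d3)
    (f := fun t => mellinBarnes (k + 1) a (fun j => p j + t) *
      (∏ i, Complex.Gammaℝ (σ + t - a i)) *
      (Complex.Gammaℝ (extend a (fun j => p j + t) 0 + (σ + t)))⁻¹)
    (g := fun t => ((4 * (Real.pi : ℂ) * Complex.I) ^ (k + 1))⁻¹ *
      barnesInt (poles a) (mellinBarnes (k + 1) a) (fun j => p j + t)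
        fun j => extend a (fun j => p j + t) j.succ + (σ + t)) ?_ ?_ (r := X + Y + ‖σ‖)
    (fun t ht => hX (σ + t) (fun j => p j + t) ?_ fun j => ?_) (t := 0) ?_
  · simp only [add_zero] at key
    exact key
  · intro t ht
    simp only [Set.mem_compl_iff, Set.mem_union, Set.mem_iUnion, Set.mem_preimage, not_or,
      not_exists] at ht
    refine DifferentiableAt.differentiableWithinAt (DifferentiableAt.mul (DifferentiableAt.mul ?_
      (DifferentiableAt.fun_finsetProd fun i _ => ?_)) ?_)
    · exact DifferentiableAt.comp t (f := fun t : ℂ => (fun j => p j + t : Fin (k + 1) → ℂ))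
        ((boundedOff_mellinBarnes a).differentiableOn.differentiableAt ((isOpen_setOf_forall_notMem
          fun j => (hL j).isClosed).mem_nhds ht.1.1)) (by fun_prop)
    · refine DifferentiableAt.comp t (f := fun t : ℂ => σ + t - a i)
        (differentiableAt_Gammaℝ fun m hm => ht.2 i ⟨m, ?_⟩) (by fun_prop)
      rw [hm]
      ring
    · exact DifferentiableAt.comp t (g := fun z => (Complex.Gammaℝ z)⁻¹)
        (Complex.differentiable_Gammaℝ_inv _) (((extend_add a p 0).1 t).add (by fun_prop))
  · intro t ht
    simp only [Set.mem_compl_iff, Set.mem_union, Set.mem_iUnion, Set.mem_preimage, not_or,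
      not_exists] at ht
    refine (DifferentiableAt.const_mul ?_ _).differentiableWithinAt
    exact ((boundedOff_mellinBarnes a).differentiableAt_barnesInt (isLeftSet_poles a) ht.1.1
      ht.1.2).comp t (hd t)
  · have h1 := Complex.abs_re_le_norm σ
    have h2 := neg_abs_le σ.re
    have h3 := (abs_nonneg _).trans (hY 0).1
    rw [Complex.add_re]
    linarith
  · have h2 := neg_abs_le (p j).re
    have h3 := (hY j).1
    have h4 := norm_nonneg σ
    rw [Complex.add_re]
    linarith
  · simp only [Set.mem_union, Set.mem_iUnion, Set.mem_preimage, not_or, not_exists, add_zero]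
    refine ⟨⟨hp, hp'⟩, ?_⟩
    rintro i ⟨m, hm⟩
    refine hσ i m ?_
    linear_combination -hm

theorem barnesIdentity : ∀ {k : ℕ} (a : Fin (k + 1) → ℂ) (σ : ℂ) (p : Fin k → ℂ),
    (∀ j, p j ∉ poles a j) → (∀ j : Fin k, extend a p j.succ + σ ∉ poles a j) →
    (∀ i, ∀ m : ℕ, σ - a i ≠ -(2 * m)) → BarnesIdentity a σ p
  -- There are no variables, and `extend a p 0 = -a 0`, so the identity reads `Γ_ℝ(σ - a 0)/Γ_ℝ(σ -
  -- a 0) = 1`.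
  | 0, a, σ, p, _, _, hσ => by
      have h0 : extend a p 0 = -a 0 := by
        have := extend_last a p
        simpa using this
      have h1 : Complex.Gammaℝ (σ - a 0) ≠ 0 := fun h => by
        obtain ⟨m, hm⟩ := Complex.Gammaℝ_eq_zero_iff.mp h
        exact hσ 0 m hm
      rw [BarnesIdentity, h0, neg_add_eq_sub]
      simp [mellinBarnes, barnesInt, iteratedInt, barnesKernel, h1]
  | _ + 1, a, _, _, hp, hp', hσ =>
      barnesIdentity_succ a (fun σ' p' => barnesIdentity (Fin.tail a) σ' p') hp hp' hσ

/-! ### The symmetry `a ↦ -a` -/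

/-- Reversal of the coordinates followed by a translation. -/
def revShift {k : ℕ} (b : ℂ) (s : Fin k → ℂ) : Fin k → ℂ := fun j => s j.rev + b

theorem integral_comp_rev_add {k : ℕ} (F : (Fin k → ℝ) → ℂ) (y : ℝ) :
    ∫ t : Fin k → ℝ, F (fun j => t j.rev + y) = ∫ t, F t := by
  have h1 := (volume_measurePreserving_piCongrLeft (fun _ : Fin k => ℝ) Fin.revPerm).integral_comp'
    (fun t : Fin k → ℝ => F (t + fun _ => y))
  rw [integral_add_right_eq_self F (fun _ => y)] at h1
  rw [← h1]
  congr 1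
  ext t
  congr 1
  ext j
  have := MeasurableEquiv.piCongrLeft_apply_apply (β := fun _ : Fin k => ℝ) Fin.revPerm t j.rev
  rw [Pi.add_apply]
  rw [Fin.revPerm_apply, Fin.rev_rev] at this
  rw [this]

theorem barnesKernel_revShift {k : ℕ} (b : ℂ) (P Q w : Fin k → ℂ) :
    barnesKernel (revShift b P) (revShift b Q) (revShift b w) = barnesKernel P Q w := by
  simp only [barnesKernel, revShift, add_sub_add_right_eq_sub]
  exact Equiv.prod_comp Fin.revPerm
    (fun j => Complex.Gammaℝ (P j - w j) * Complex.Gammaℝ (Q j - w j))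

theorem barnesInt_comm {k : ℕ} (L : Fin k → Set ℂ) (V : (Fin k → ℂ) → ℂ) (P Q : Fin k → ℂ) :
    barnesInt L V P Q = barnesInt L V Q P := by
  simp only [barnesInt, barnesKernel, mul_comm (Complex.Gammaℝ (P _ - _)),
    Set.union_comm (rightPoles (P _))]

section

variable {k : ℕ} {L L' : Fin k → Set ℂ} {V V' : (Fin k → ℂ) → ℂ}

theorem barnesInt_revShift_of_large (hV : BoundedOff L V) (hL : ∀ j, IsLeftSet (L j))
    (hV' : BoundedOff L' V') (hL' : ∀ j, IsLeftSet (L' j)) {b : ℂ}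
    (hLL' : ∀ j z, z ∈ L' j → z - b ∈ L j.rev)
    (hVV' : ∀ w : Fin k → ℂ, (∀ j, w j ∉ L j) → V' (revShift b w) = V w) {d : ℝ}
    (hd : ∀ j, ∀ z ∈ L j, z.re < d) {P Q : Fin k → ℂ} (hP : ∀ j, d < (P j).re)
    (hQ : ∀ j, d < (Q j).re) :
    barnesInt L' V' (revShift b P) (revShift b Q) = barnesInt L V P Q := by
  rw [(hV.barnesInt_eq_integral_vline hL hd hP hQ).2,
    (hV'.barnesInt_eq_integral_vline hL' (c := fun _ => d + b.re)
      (fun j z hz => by have := hd _ _ (hLL' j z hz); rw [Complex.sub_re] at this; linarith)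
      (fun j => by rw [revShift, Complex.add_re]; linarith [hP j.rev])
      (fun j => by rw [revShift, Complex.add_re]; linarith [hQ j.rev])).2,
    ← integral_comp_rev_add _ b.im]
  congr 2
  ext t
  have h : (fun j : Fin k => vline (d + b.re) (t j.rev + b.im)) =
      revShift b fun j => vline d (t j) := by
    ext j
    apply Complex.ext <;> simp [revShift]
  rw [h, barnesKernel_revShift, hVV']
  intro j hj
  exact (hd j _ hj).ne (vline_re _ _)

theorem BoundedOff.exists_differentiableOn_barnesInt_add (hV : BoundedOff L V)
    (hL : ∀ j, IsLeftSet (L j)) (P Q : Fin k → ℂ) :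
    ∃ B : Set ℂ, IsClosed B ∧ B.Countable ∧ (∀ t ∉ B, ∀ j, P j + t ∉ L j ∧ Q j + t ∉ L j) ∧
      ((∀ j, P j ∉ L j) → (∀ j, Q j ∉ L j) → 0 ∉ B) ∧
      DifferentiableOn ℂ (fun t => barnesInt L V (fun j => P j + t) fun j => Q j + t) Bᶜ := by
  obtain ⟨c1, d1⟩ := isClosed_and_countable_iUnion_preimage (fun j => (hL j).stripFinite)
    (f := fun j t => P j + t) (fun j => by fun_prop) fun j => add_right_injective _
  obtain ⟨c2, d2⟩ := isClosed_and_countable_iUnion_preimage (fun j => (hL j).stripFinite)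
    (f := fun j t => Q j + t) (fun j => by fun_prop) fun j => add_right_injective _
  refine ⟨_, c1.union c2, d1.union d2, fun t ht j => ?_, fun hP hQ => ?_, fun t ht => ?_⟩
  · simp only [Set.mem_union, Set.mem_iUnion, Set.mem_preimage, not_or, not_exists] at ht
    exact ⟨ht.1 j, ht.2 j⟩
  · simp only [Set.mem_union, Set.mem_iUnion, Set.mem_preimage, not_or, not_exists, add_zero]
    exact ⟨hP, hQ⟩
  · simp only [Set.mem_compl_iff, Set.mem_union, Set.mem_iUnion, Set.mem_preimage, not_or,
      not_exists] at ht
    exact ((hV.differentiableAt_barnesInt hL ht.1 ht.2).comp t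
      (f := fun t : ℂ => ((fun j => P j + t : Fin k → ℂ), (fun j => Q j + t : Fin k → ℂ)))
      (by fun_prop)).differentiableWithinAt

/-- For parameters far to the right both sides are integrals over vertical lines and a change of
variables suffices; the general case follows by continuation in a common translation. -/
theorem barnesInt_revShift (hV : BoundedOff L V) (hL : ∀ j, IsLeftSet (L j))
    (hV' : BoundedOff L' V') (hL' : ∀ j, IsLeftSet (L' j)) {b : ℂ}
    (hLL' : ∀ j z, z ∈ L' j → z - b ∈ L j.rev)
    (hVV' : ∀ w : Fin k → ℂ, (∀ j, w j ∉ L j) → V' (revShift b w) = V w) {d : ℝ}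
    (hd : ∀ j, ∀ z ∈ L j, z.re < d) {P Q : Fin k → ℂ} (hP : ∀ j, P j ∉ L j)
    (hQ : ∀ j, Q j ∉ L j) :
    barnesInt L' V' (revShift b P) (revShift b Q) = barnesInt L V P Q := by
  obtain ⟨B, hBc, hBd, -, hB0, hB⟩ := hV.exists_differentiableOn_barnesInt_add hL P Q
  obtain ⟨B', hBc', hBd', -, hB0', hB'⟩ := hV'.exists_differentiableOn_barnesInt_add hL'
    (revShift b P) (revShift b Q)
  obtain ⟨Y₁, hY₁⟩ := exists_bound_re_im P
  obtain ⟨Y₂, hY₂⟩ := exists_bound_re_im Q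
  have hshift : ∀ (R : Fin k → ℂ) (t : ℂ), (fun j => revShift b R j + t) =
      revShift b fun j => R j + t := fun R t => by
    ext j
    simp only [revShift]
    ring
  have key := eq_of_eq_of_le_re (hBc.union hBc') (hBd.union hBd')
    (hB'.mono (Set.compl_subset_compl.mpr Set.subset_union_right))
    (hB.mono (Set.compl_subset_compl.mpr Set.subset_union_left)) (r := d + 1 + |Y₁| + |Y₂|)
    (fun t ht => by
      rw [hshift, hshift]
      refine barnesInt_revShift_of_large hV hL hV' hL' hLL' hVV' hd (fun j => ?_) fun j => ?_
      · have h1 := (hY₁ j).1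
        have h2 := neg_abs_le (P j).re
        have h3 := le_abs_self Y₁
        have h4 := abs_nonneg Y₂
        rw [Complex.add_re]
        linarith
      · have h1 := (hY₂ j).1
        have h2 := neg_abs_le (Q j).re
        have h3 := le_abs_self Y₂
        have h4 := abs_nonneg Y₁
        rw [Complex.add_re]
        linarith) (t := 0) (fun h => h.elim (hB0 hP hQ) (hB0'
          (fun j hj => hP j.rev (by simpa [revShift] using hLL' j _ hj))
          fun j hj => hQ j.rev (by simpa [revShift] using hLL' j _ hj)))
  simpa only [add_zero] using key

end

/-- Index sets are replaced by their complements. -/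
theorem poles_neg {k : ℕ} (a : Fin (k + 1) → ℂ) (j : Fin k) (z : ℂ) (h : z ∈ poles (-a) j) :
    z - ∑ i, a i ∈ poles a j.rev := by
  obtain ⟨I, hI, m, rfl⟩ := h
  refine ⟨Iᶜ, ?_, m, ?_⟩
  · rw [Finset.card_compl, hI, Fintype.card_fin, Fin.val_rev]
    have := j.isLt
    omega
  · rw [← Finset.sum_add_sum_compl I a]
    simp
    ring

/-- Under reversal and translation the recursion keeps its shape: the two gamma factors in front
change places, and so do the two families in the kernel. -/
theorem mellinBarnes_neg : ∀ {k : ℕ} (a : Fin (k + 1) → ℂ) (s : Fin k → ℂ), (∀ j, s j ∉ poles a j) →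
    mellinBarnes k (-a) (revShift (∑ i, a i) s) = mellinBarnes k a s
  | 0, _, _, _ => rfl
  | k + 1, a, s, hs => by
      obtain ⟨d, -, hd⟩ := exists_re_lt_of_poles (Fin.tail a)
      have hsum : ∑ i, a i = a 0 + ∑ i, Fin.tail a i := Fin.sum_univ_succ a
      have htail : Fin.tail (-a) = -Fin.tail a := rfl
      have key := barnesInt_revShift (boundedOff_mellinBarnes (Fin.tail a))
        (isLeftSet_poles (Fin.tail a)) (boundedOff_mellinBarnes (-Fin.tail a))
        (isLeftSet_poles (-Fin.tail a)) (poles_neg (Fin.tail a))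
        (mellinBarnes_neg (Fin.tail a)) hd (P := fun j => s j.succ + a 0) (Q := fun j => s j.castSucc)
        (fun j hj => hs j.succ (by simpa using sub_mem_poles_of_tail hj))
        fun j hj => hs _ (poles_tail_subset a j hj)
      rw [mellinBarnes, mellinBarnes, barnesInt_comm _ _ (fun j => s j.castSucc), ← key, htail]
      have e1 : (fun j : Fin k => revShift (∑ i, a i) s j.castSucc) =
          revShift (∑ i, Fin.tail a i) fun j => s j.succ + a 0 := by
        ext j
        simp only [revShift, Fin.rev_castSucc, hsum]
        ring
      have e2 : (fun j : Fin k => revShift (∑ i, a i) s j.succ + (-a) 0) =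
          revShift (∑ i, Fin.tail a i) fun j => s j.castSucc := by
        ext j
        simp only [revShift, Fin.rev_succ, hsum, Pi.neg_apply]
        ring
      have e3 : revShift (∑ i, a i) s 0 + (-a) 0 = s (Fin.last k) + ∑ i, Fin.tail a i := by
        simp only [revShift, Fin.rev_zero, hsum, Pi.neg_apply]
        ring
      have e4 : revShift (∑ i, a i) s (Fin.last k) + ∑ i, (-Fin.tail a) i = s 0 + a 0 := by
        simp only [revShift, Fin.rev_last, hsum, Pi.neg_apply, Finset.sum_neg_distrib]
        ring
      rw [e1, e2, e3, e4]
      ring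

/-! ### The Mellin transform of the Whittaker function -/

/-- The integrand of the inverse Mellin kernel attached to `Γ_ℝ(P - w) Γ_ℝ(Q - w)`. -/
def kernelExp (P Q : ℂ) (x τ : ℝ) : ℂ :=
  Complex.exp (-(Real.exp (-τ) : ℂ) - (Real.pi ^ 2 * Real.exp (2 * x + τ) : ℝ) +
    Q * (x + τ / 2 : ℝ) - P * (τ / 2 : ℝ))

theorem continuous_kernelExp (P Q : ℂ) : Continuous fun r : ℝ × ℝ => kernelExp P Q r.1 r.2 := by
  unfold kernelExp
  fun_prop

theorem kernelExp_eq_exp_mul (c P Q : ℂ) (x τ : ℝ) :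
    kernelExp P Q x τ = Complex.exp (c * x) * kernelExp (P - c) (Q - c) x τ := by
  rw [kernelExp, kernelExp, ← Complex.exp_add]
  push_cast
  ring_nf

theorem re_half_pos {z : ℂ} (hz : 0 < z.re) : 0 < (z / 2).re := by
  simp only [Complex.div_ofNat_re]
  linarith

theorem integrable_exp_neg_exp_neg {z : ℂ} (hz : 0 < z.re) :
    Integrable fun τ : ℝ => Complex.exp (-(Real.exp (-τ) : ℂ) - z * (τ / 2 : ℝ)) := by
  refine ((integrable_exp_gamma (re_half_pos hz)).comp_neg).congr (Eventually.of_forall fun τ => ?_)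
  simp only
  push_cast
  ring_nf

theorem integral_exp_neg_exp_neg {z : ℂ} (hz : 0 < z.re) :
    ∫ τ : ℝ, Complex.exp (-(Real.exp (-τ) : ℂ) - z * (τ / 2 : ℝ)) =
      (Real.pi : ℂ) ^ (z / 2) * Complex.Gammaℝ z := by
  rw [pi_cpow_mul_Gammaℝ, ← integral_exp_gamma (re_half_pos hz), ← integral_neg_eq_self]
  congr 1
  ext τ
  push_cast
  ring_nf

theorem pi_sq_mul_exp (u : ℝ) : Real.exp (u + 2 * Real.log Real.pi) = Real.pi ^ 2 * Real.exp u := by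
  rw [Real.exp_add, two_mul (Real.log _), Real.exp_add, Real.exp_log Real.pi_pos]
  ring

theorem integrable_exp_neg_pi_sq {z : ℂ} (hz : 0 < z.re) :
    Integrable fun x : ℝ => Complex.exp (-(Real.pi ^ 2 * Real.exp (2 * x) : ℝ) + z * x) := by
  refine ((integrable_exp_gamma_shift (re_half_pos hz) (2 * Real.log Real.pi)).comp_mul_left'
    two_ne_zero).congr (Eventually.of_forall fun x => ?_)
  simp only [pi_sq_mul_exp]
  push_cast
  ring_nf

theorem integral_exp_neg_pi_sq {z : ℂ} (hz : 0 < z.re) :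
    ∫ x : ℝ, Complex.exp (-(Real.pi ^ 2 * Real.exp (2 * x) : ℝ) + z * x) =
      1 / 2 * ((Real.pi : ℂ) ^ (-(z / 2)) * Complex.Gammaℝ z) := by
  have hpi : (Real.pi : ℂ) ≠ 0 := by simp [Real.pi_ne_zero]
  have h := Measure.integral_comp_mul_left (fun v : ℝ =>
    Complex.exp (-(Real.exp (v + 2 * Real.log Real.pi) : ℂ) + z / 2 * v)) 2
  rw [integral_exp_gamma_shift (re_half_pos hz), ← pi_cpow_mul_Gammaℝ] at h
  have e : Complex.exp (-(z / 2 * (2 * Real.log Real.pi : ℝ))) = (Real.pi : ℂ) ^ (-z) := by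
    rw [Complex.cpow_def_of_ne_zero hpi, ← Complex.ofReal_log Real.pi_pos.le]
    push_cast
    ring_nf
  rw [e, ← mul_assoc, ← Complex.cpow_add _ _ hpi, show -z + z / 2 = -(z / 2) by ring,
    Complex.real_smul] at h
  convert! h using 1
  · congr 1
    ext x
    rw [pi_sq_mul_exp]
    push_cast
    ring_nf
  · rw [abs_of_pos (by norm_num)]
    push_cast
    norm_num

/-- After extracting `e^(cx)` one gamma density is bounded and the other is integrable, both
uniformly in `x`. The growth `e^(cx)` matches the weight under which the lower-rank Whittaker
function is integrable. -/
theorem exists_integral_norm_kernelExp_le {P Q : ℂ} {c : ℝ} (hP : c < P.re) (hQ : c < Q.re) :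
    ∃ K, 0 ≤ K ∧ ∀ x : ℝ, Integrable (kernelExp P Q x) ∧
      ∫ τ, ‖kernelExp P Q x τ‖ ≤ K * Real.exp (c * x) := by
  have hP' : 0 < (P - c).re := by simpa using hP
  have hQ' : 0 < (Q - c).re := by simpa using hQ
  obtain ⟨C, hC⟩ := exists_bound_exp_gamma (re_half_pos hQ') (2 * Real.log Real.pi)
  have hC0 : 0 ≤ C := (norm_nonneg _).trans (hC 0)
  have hT := integrable_exp_neg_exp_neg hP'
  have hle : ∀ x τ : ℝ, ‖kernelExp P Q x τ‖ ≤ Real.exp (c * x) *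
      (C * ‖Complex.exp (-(Real.exp (-τ) : ℂ) - (P - c) * (τ / 2 : ℝ))‖) := fun x τ => by
    have e : kernelExp P Q x τ = Complex.exp ((c * x : ℝ) : ℂ) *
        (Complex.exp (-(Real.exp (2 * x + τ + 2 * Real.log Real.pi) : ℂ) +
          (Q - c) / 2 * (2 * x + τ : ℝ)) *
        Complex.exp (-(Real.exp (-τ) : ℂ) - (P - c) * (τ / 2 : ℝ))) := by
      rw [kernelExp_eq_exp_mul c, kernelExp, ← Complex.exp_add, ← Complex.exp_add,
        ← Complex.exp_add, pi_sq_mul_exp]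
      push_cast
      ring_nf
    rw [e, norm_mul, norm_mul, ← Complex.ofReal_exp, Complex.norm_of_nonneg (Real.exp_pos _).le]
    gcongr
    exact hC _
  refine ⟨C * ∫ τ : ℝ, ‖Complex.exp (-(Real.exp (-τ) : ℂ) - (P - c) * (τ / 2 : ℝ))‖,
    mul_nonneg hC0 (integral_nonneg fun _ => norm_nonneg _), fun x => ?_⟩
  have hint : Integrable (kernelExp P Q x) := by
    refine ((hT.norm.const_mul C).const_mul (Real.exp (c * x))).mono'
      (Continuous.aestronglyMeasurable ?_) (Eventually.of_forall (hle x))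
    exact (continuous_kernelExp P Q).comp (continuous_const.prodMk continuous_id)
  refine ⟨hint, (integral_mono hint.norm ((hT.norm.const_mul C).const_mul (Real.exp (c * x)))
    (hle x)).trans (le_of_eq ?_)⟩
  rw [integral_const_mul, integral_const_mul]
  ring

/-- The inverse Mellin transform of `Γ_ℝ(P - w) Γ_ℝ(Q - w)` along the line `Re w = c`. -/
theorem integral_kernelExp {P Q : ℂ} {c : ℝ} (hP : c < P.re) (hQ : c < Q.re) (x : ℝ) :
    ∫ τ, kernelExp P Q x τ = (Real.pi : ℂ) ^ ((P - Q) / 2) * (1 / (4 * Real.pi)) *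
      ∫ t : ℝ, Complex.Gammaℝ (P - vline c t) * Complex.Gammaℝ (Q - vline c t) *
        Complex.exp (vline c t * x) := by
  have h := kernel_eq_inverse_mellin (β := Q - c) (δ := P - c) (by simpa using hQ)
    (by simpa using hP) x
  simp only [kernelExp_eq_exp_mul (c : ℂ) P Q, integral_const_mul]
  rw [show (P - c - (Q - c)) / 2 = (P - Q) / 2 by ring] at h
  simp only [kernelExp]
  rw [h, mul_left_comm, ← integral_const_mul]
  congr 2
  ext t
  have e : Complex.exp (vline c t * x) = Complex.exp (c * x) * Complex.exp (t * Complex.I * x) := by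
    rw [← Complex.exp_add, vline]
    ring_nf
  rw [e, vline]
  simp only [sub_sub]
  ring

theorem integrable_Gammaℝ_mul_Gammaℝ_vline {P Q : ℂ} {c : ℝ} (hP : c < P.re) (hQ : c < Q.re) :
    Integrable fun t : ℝ => Complex.Gammaℝ (P - vline c t) * Complex.Gammaℝ (Q - vline c t) := by
  have := integrable_Gammaℝ_mul_Gammaℝ_vertical (z := P - c) (w := Q - c) (by simpa using hP)
    (by simpa using hQ)
  refine this.congr (Eventually.of_forall fun t => ?_)
  simp only [vline, sub_sub]

theorem integrable_head_tail {𝕜 : Type*} [RCLike 𝕜] {k : ℕ} {f : ℝ → 𝕜} {h : (Fin k → ℝ) → 𝕜}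
    (hf : Integrable f) (hh : Integrable h) :
    Integrable (fun u : Fin (k + 1) → ℝ => f (u 0) * h (Fin.tail u)) := by
  have hmp := volume_preserving_piFinSuccAbove (fun _ : Fin (k + 1) => ℝ) 0
  have h1 : Integrable (fun z : ℝ × (Fin k → ℝ) => f z.1 * h z.2) := hf.mul_prod hh
  exact (hmp.integrable_comp_emb (MeasurableEquiv.measurableEmbedding _)).mpr h1

theorem integral_head_tail {𝕜 : Type*} [RCLike 𝕜] {k : ℕ} (f : ℝ → 𝕜) (h : (Fin k → ℝ) → 𝕜) :
    ∫ u : Fin (k + 1) → ℝ, f (u 0) * h (Fin.tail u) = (∫ x, f x) * ∫ x, h x := by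
  have hmp := volume_preserving_piFinSuccAbove (fun _ : Fin (k + 1) => ℝ) 0
  exact (hmp.integral_comp' fun z : ℝ × (Fin k → ℝ) => f z.1 * h z.2).trans
    (integral_prod_mul f h)

/-- The radial Whittaker function in logarithmic coordinates, through a recursion in which the
parameters are not normalized. -/
def logWhittaker : (k : ℕ) → (Fin (k + 1) → ℂ) → (Fin k → ℝ) → ℂ
  | 0, _, _ => 1
  | k + 1, a, η =>
      (Real.pi : ℂ) ^ (((k : ℂ) + 2) * a 0 / 2 - (∑ i, a i) / 2) *
        ∫ τ : Fin (k + 1) → ℝ,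
          logWhittaker k (Fin.tail a) (fun j => η j.succ + (τ j.succ - τ j.castSucc) / 2) *
            Complex.exp ((∑ j, (-(Real.pi ^ 2 * Real.exp (2 * η j + τ j) : ℝ) -
              (Real.exp (-τ j) : ℂ) + a 0 * (η j + τ j / 2 : ℝ))) -
              (∑ i, Fin.tail a i) * (τ (Fin.last k) / 2 : ℝ))

theorem stronglyMeasurable_logWhittaker : ∀ {k : ℕ} (a : Fin (k + 1) → ℂ),
    StronglyMeasurable (logWhittaker k a)
  | 0, _ => stronglyMeasurable_const
  | k + 1, a => by
      refine StronglyMeasurable.const_mul ?_ _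
      have h := stronglyMeasurable_logWhittaker (Fin.tail a)
      refine StronglyMeasurable.integral_prod_right (ν := volume) (f := fun (η : Fin (k + 1) → ℝ)
        (τ : Fin (k + 1) → ℝ) => logWhittaker k (Fin.tail a)
            (fun j => η j.succ + (τ j.succ - τ j.castSucc) / 2) *
            Complex.exp ((∑ j, (-(Real.pi ^ 2 * Real.exp (2 * η j + τ j) : ℝ) -
              (Real.exp (-τ j) : ℂ) + a 0 * (η j + τ j / 2 : ℝ))) -
              (∑ i, Fin.tail a i) * (τ (Fin.last k) / 2 : ℝ))) ?_
      refine (h.comp_measurable (g := fun z : (Fin (k + 1) → ℝ) × (Fin (k + 1) → ℝ) =>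
        fun j : Fin k => z.1 j.succ + (z.2 j.succ - z.2 j.castSucc) / 2) ?_).mul ?_
      · exact (by fun_prop : Continuous _).measurable
      · exact Continuous.stronglyMeasurable (by fun_prop)

theorem IsLeftSet.exists_between {L : Set ℂ} (h : IsLeftSet L) {x : ℝ} (hx : ∀ z ∈ L, z.re < x) :
    ∃ d, d < x ∧ ∀ z ∈ L, z.re < d := by
  have hfin := (h.finite (x - 1)).image Complex.re
  obtain ⟨M, hM, hMx⟩ : ∃ M, (∀ z ∈ L, z.re ≤ M) ∧ M < x := by
    by_cases hne : {s ∈ L | x - 1 ≤ s.re}.Nonempty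
    · obtain ⟨s, hs, hmax⟩ := (h.finite (x - 1)).exists_maximalFor Complex.re _ hne
      refine ⟨s.re, fun z hz => ?_, hx s hs.1⟩
      by_cases hzx : x - 1 ≤ z.re
      · by_contra hlt
        push Not at hlt
        have := hmax (j := z) ⟨hz, hzx⟩ hlt.le
        linarith
      · push Not at hzx
        exact hzx.le.trans hs.2
    · refine ⟨x - 1, fun z hz => ?_, by linarith⟩
      by_contra hlt
      push Not at hlt
      exact hne ⟨z, hz, hlt.le⟩
  refine ⟨(M + x) / 2, by linarith, fun z hz => ?_⟩
  have := hM z hz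
  linarith

/-- The Mellin kernel applied to the Whittaker function, in the coordinates that separate the
integrations. -/
def separatedIntegrand {k : ℕ} (a : Fin (k + 2) → ℂ) (s : Fin (k + 1) → ℂ)
    (τ u : Fin (k + 1) → ℝ) : ℂ :=
  (Complex.exp (-(Real.pi ^ 2 * Real.exp (2 * u 0) : ℝ) + (s 0 + a 0) * u 0) *
    logWhittaker k (Fin.tail a) (Fin.tail u)) *
  ((∏ j : Fin k, kernelExp (s j.castSucc) (s j.succ + a 0) (u j.succ) (τ j.castSucc)) *
    Complex.exp (-(Real.exp (-τ (Fin.last k)) : ℂ) -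
      (s (Fin.last k) + ∑ i, Fin.tail a i) * (τ (Fin.last k) / 2 : ℝ)))

/-- The translation that separates the integrations. -/
def separatingShift {k : ℕ} (τ : Fin (k + 1) → ℝ) : Fin (k + 1) → ℝ :=
  Fin.cons (τ 0 / 2) fun j : Fin k => (τ j.succ - τ j.castSucc) / 2

theorem continuous_separatingShift {k : ℕ} :
    Continuous (separatingShift : (Fin (k + 1) → ℝ) → Fin (k + 1) → ℝ) := by
  refine continuous_pi fun j => ?_
  refine Fin.cases ?_ (fun j => ?_) j
  · simp only [separatingShift, Fin.cons_zero]; fun_prop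
  · simp only [separatingShift, Fin.cons_succ]; fun_prop

/-- In the translated variables `u`, the identity `2 η_{j+1} + τ_{j+1} = 2 u_{j+1} + τ_j` pairs
`τ_j` with `u_{j+1}`. Only `u_0` and the last `τ` remain unpaired; they give the two gamma factors
in front of the recursion. -/
theorem separatedIntegrand_add_shift {k : ℕ} (a : Fin (k + 2) → ℂ) (s : Fin (k + 1) → ℂ)
    (τ η : Fin (k + 1) → ℝ) :
    separatedIntegrand a s τ (η + separatingShift τ) =
      logWhittaker k (Fin.tail a) (fun j => η j.succ + (τ j.succ - τ j.castSucc) / 2) *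
        Complex.exp ((∑ j, (-(Real.pi ^ 2 * Real.exp (2 * η j + τ j) : ℝ) -
          (Real.exp (-τ j) : ℂ) + a 0 * (η j + τ j / 2 : ℝ))) -
          (∑ i, Fin.tail a i) * (τ (Fin.last k) / 2 : ℝ)) * Complex.exp (∑ j, s j * η j) := by
  have h0 : (η + separatingShift τ) 0 = η 0 + τ 0 / 2 := rfl
  have h1 : ∀ j : Fin k, (η + separatingShift τ) j.succ =
      η j.succ + (τ j.succ - τ j.castSucc) / 2 := fun j => rfl
  have htail : Fin.tail (η + separatingShift τ) =
      fun j : Fin k => η j.succ + (τ j.succ - τ j.castSucc) / 2 := rfl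
  rw [separatedIntegrand, htail, h0]
  simp only [h1, kernelExp]
  rw [← Complex.exp_sum, mul_assoc (logWhittaker _ _ _), ← Complex.exp_add, ← Complex.exp_add,
    mul_right_comm, ← Complex.exp_add, mul_comm]
  congr 2
  have e1 : ∑ j : Fin (k + 1), (Real.exp (-τ j) : ℂ) = ∑ j : Fin k, (Real.exp (-τ j.castSucc) : ℂ) +
      Real.exp (-τ (Fin.last k)) := Fin.sum_univ_castSucc _
  have e2 : ∑ j : Fin (k + 1), ((Real.pi ^ 2 * Real.exp (2 * η j + τ j) : ℝ) : ℂ) =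
      ((Real.pi ^ 2 * Real.exp (2 * η 0 + τ 0) : ℝ) : ℂ) +
      ∑ j : Fin k, ((Real.pi ^ 2 * Real.exp (2 * η j.succ + τ j.succ) : ℝ) : ℂ) := Fin.sum_univ_succ _
  have e3 : ∑ j : Fin (k + 1), a 0 * ((η j + τ j / 2 : ℝ) : ℂ) = a 0 * ((η 0 + τ 0 / 2 : ℝ) : ℂ) +
      ∑ j : Fin k, a 0 * ((η j.succ + τ j.succ / 2 : ℝ) : ℂ) := Fin.sum_univ_succ _
  have e4 : ∑ j : Fin (k + 1), s j * ((η j + τ j / 2 : ℝ) : ℂ) = s 0 * ((η 0 + τ 0 / 2 : ℝ) : ℂ) +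
      ∑ j : Fin k, s j.succ * ((η j.succ + τ j.succ / 2 : ℝ) : ℂ) := Fin.sum_univ_succ _
  have e5 : ∑ j : Fin (k + 1), s j * ((τ j / 2 : ℝ) : ℂ) =
      ∑ j : Fin k, s j.castSucc * ((τ j.castSucc / 2 : ℝ) : ℂ) +
        s (Fin.last k) * ((τ (Fin.last k) / 2 : ℝ) : ℂ) := Fin.sum_univ_castSucc _
  have e6 : ∑ j : Fin (k + 1), s j * (η j : ℂ) = ∑ j : Fin (k + 1), s j * ((η j + τ j / 2 : ℝ) : ℂ) -
      ∑ j : Fin (k + 1), s j * ((τ j / 2 : ℝ) : ℂ) := by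
    rw [← Finset.sum_sub_distrib]
    refine Finset.sum_congr rfl fun j _ => ?_
    push_cast
    ring
  have e7 : ∀ j : Fin k, 2 * (η j.succ + (τ j.succ - τ j.castSucc) / 2) + τ j.castSucc =
      2 * η j.succ + τ j.succ := fun j => by ring
  have e8 : ∀ j : Fin k, η j.succ + (τ j.succ - τ j.castSucc) / 2 + τ j.castSucc / 2 =
      η j.succ + τ j.succ / 2 := fun j => by ring
  have e9 : 2 * (η 0 + τ 0 / 2) = 2 * η 0 + τ 0 := by ring
  rw [e6, e4, e5]
  simp only [e7, e8, e9, Finset.sum_add_distrib, Finset.sum_sub_distrib, Finset.sum_neg_distrib,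
    add_mul, e1, e2, e3]
  ring

section

variable {k : ℕ} {a : Fin (k + 2) → ℂ} {s : Fin (k + 1) → ℂ} {c : Fin k → ℝ}

theorem stronglyMeasurable_separatedIntegrand :
    StronglyMeasurable fun r : (Fin (k + 1) → ℝ) × (Fin (k + 1) → ℝ) =>
      separatedIntegrand a s r.1 r.2 := by
  refine StronglyMeasurable.mul (StronglyMeasurable.mul ?_ ?_) (StronglyMeasurable.mul ?_ ?_)
  · exact Continuous.stronglyMeasurable (by fun_prop)
  · refine (stronglyMeasurable_logWhittaker (Fin.tail a)).comp_measurable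
      (g := fun r : (Fin (k + 1) → ℝ) × (Fin (k + 1) → ℝ) => Fin.tail r.2) ?_
    exact (continuous_pi fun j => by unfold Fin.tail; fun_prop : Continuous _).measurable
  · refine Continuous.stronglyMeasurable (continuous_finsetProd _ fun j _ => ?_)
    exact (continuous_kernelExp _ _).comp (f := fun r : (Fin (k + 1) → ℝ) × (Fin (k + 1) → ℝ) =>
      (r.2 j.succ, r.1 j.castSucc)) (by fun_prop)
  · exact Continuous.stronglyMeasurable (by fun_prop)

/-- The factors of the separated integrand in the variables `τ j`. -/
def separatedFactor (a : Fin (k + 2) → ℂ) (s : Fin (k + 1) → ℂ) (u : Fin (k + 1) → ℝ) :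
    Fin (k + 1) → ℝ → ℂ :=
  Fin.snoc (fun j : Fin k => kernelExp (s j.castSucc) (s j.succ + a 0) (u j.succ))
    fun τ => Complex.exp (-(Real.exp (-τ) : ℂ) -
      (s (Fin.last k) + ∑ i, Fin.tail a i) * (τ / 2 : ℝ))

theorem separatedIntegrand_eq (τ u : Fin (k + 1) → ℝ) : separatedIntegrand a s τ u =
    (Complex.exp (-(Real.pi ^ 2 * Real.exp (2 * u 0) : ℝ) + (s 0 + a 0) * u 0) *
    logWhittaker k (Fin.tail a) (Fin.tail u)) * ∏ j, separatedFactor a s u j (τ j) := by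
  rw [separatedIntegrand, Fin.prod_univ_castSucc]
  simp [separatedFactor]

theorem integrable_separatedFactor (h1 : ∀ j : Fin k, c j < (s j.castSucc).re)
    (h2 : ∀ j : Fin k, c j < (s j.succ + a 0).re)
    (hT : 0 < (s (Fin.last k) + ∑ i, Fin.tail a i).re) (u : Fin (k + 1) → ℝ) (j : Fin (k + 1)) :
    Integrable (separatedFactor a s u j) := by
  refine Fin.lastCases ?_ (fun j => ?_) j
  · simpa [separatedFactor] using integrable_exp_neg_exp_neg hT
  · obtain ⟨K, -, hK⟩ := exists_integral_norm_kernelExp_le (h1 j) (h2 j)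
    simpa [separatedFactor] using (hK (u j.succ)).1

theorem norm_cexp_real_sum (c : Fin k → ℝ) (u : Fin k → ℝ) :
    ‖Complex.exp (∑ j, (c j : ℂ) * u j)‖ = ∏ j, Real.exp (c j * u j) := by
  rw [Complex.exp_sum, norm_prod]
  refine Finset.prod_congr rfl fun j _ => ?_
  rw [Complex.norm_exp, ← Complex.ofReal_mul, Complex.ofReal_re]

/-- Tonelli with `τ` integrated first: the kernels cost `∏ e^(c_j u_j)`, which the lower-rank
integrability hypothesis absorbs. -/
theorem integrable_separatedIntegrand (h1 : ∀ j : Fin k, c j < (s j.castSucc).re)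
    (h2 : ∀ j : Fin k, c j < (s j.succ + a 0).re)
    (hT : 0 < (s (Fin.last k) + ∑ i, Fin.tail a i).re) (hA : 0 < (s 0 + a 0).re)
    (ih : Integrable fun u : Fin k → ℝ =>
      logWhittaker k (Fin.tail a) u * Complex.exp (∑ j, (c j : ℂ) * u j)) :
    Integrable (fun r : (Fin (k + 1) → ℝ) × (Fin (k + 1) → ℝ) =>
      separatedIntegrand a s r.1 r.2) := by
  choose K hK0 hK using fun j : Fin k => exists_integral_norm_kernelExp_le (h1 j) (h2 j)
  have hm := stronglyMeasurable_separatedIntegrand (a := a) (s := s)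
  rw [Measure.volume_eq_prod]
  refine (integrable_prod_iff' hm.aestronglyMeasurable).mpr ⟨?_, ?_⟩
  · refine Eventually.of_forall fun u => ?_
    simp only [separatedIntegrand_eq]
    exact (Integrable.fintype_prod (integrable_separatedFactor h1 h2 hT u)).const_mul _
  · set N := ∫ τ : ℝ, ‖Complex.exp (-(Real.exp (-τ) : ℂ) -
      (s (Fin.last k) + ∑ i, Fin.tail a i) * (τ / 2 : ℝ))‖ with hN
    have hN0 : 0 ≤ N := integral_nonneg fun _ => norm_nonneg _
    have hdom := (integrable_head_tail (integrable_exp_neg_pi_sq hA).norm ih.norm).const_mul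
      ((∏ j, K j) * N)
    refine hdom.mono' ?_ (Eventually.of_forall fun u => ?_)
    · exact (hm.norm.integral_prod_left' (μ := volume)).aestronglyMeasurable
    · simp only [separatedIntegrand_eq, norm_mul, norm_prod]
      rw [integral_const_mul, norm_mul, norm_mul, norm_norm, norm_norm,
        integral_fintype_prod_volume_eq_prod (fun j t => ‖separatedFactor a s u j t‖),
        norm_cexp_real_sum, Fin.prod_univ_castSucc]
      have hb : ‖(∏ j : Fin k, ∫ t, ‖separatedFactor a s u j.castSucc t‖) *
          ∫ t, ‖separatedFactor a s u (Fin.last k) t‖‖ ≤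
          (∏ j, (K j * Real.exp (c j * Fin.tail u j))) * N := by
        rw [norm_mul, norm_prod]
        refine mul_le_mul (Finset.prod_le_prod (fun _ _ => norm_nonneg _) fun j _ => ?_) ?_
          (norm_nonneg _) (Finset.prod_nonneg fun j _ => mul_nonneg (hK0 j) (Real.exp_pos _).le)
        · rw [Real.norm_of_nonneg (integral_nonneg fun _ => norm_nonneg _)]
          simpa [separatedFactor, Fin.tail] using (hK j (u j.succ)).2
        · rw [Real.norm_of_nonneg (integral_nonneg fun _ => norm_nonneg _)]
          simp [separatedFactor, hN]
      rw [Finset.prod_mul_distrib] at hb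
      refine (mul_le_mul_of_nonneg_left hb (by positivity)).trans (le_of_eq ?_)
      ring

theorem integral_separatedIntegrand (u : Fin (k + 1) → ℝ)
    (hT : 0 < (s (Fin.last k) + ∑ i, Fin.tail a i).re) :
    ∫ τ : Fin (k + 1) → ℝ, separatedIntegrand a s τ u =
      (Real.pi : ℂ) ^ ((s (Fin.last k) + ∑ i, Fin.tail a i) / 2) *
        Complex.Gammaℝ (s (Fin.last k) + ∑ i, Fin.tail a i) *
      (Complex.exp (-(Real.pi ^ 2 * Real.exp (2 * u 0) : ℝ) + (s 0 + a 0) * u 0) *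
        (logWhittaker k (Fin.tail a) (Fin.tail u) *
        ∏ j : Fin k, ∫ τ, kernelExp (s j.castSucc) (s j.succ + a 0) (Fin.tail u j) τ)) := by
  simp only [separatedIntegrand_eq]
  rw [integral_const_mul,
    integral_fintype_prod_volume_eq_prod (fun j t => separatedFactor a s u j t),
    Fin.prod_univ_castSucc]
  simp only [separatedFactor, Fin.snoc_castSucc, Fin.snoc_last]
  rw [integral_exp_neg_exp_neg hT]
  simp only [Fin.tail]
  ring

/-- Each kernel is written as an inverse Mellin integral; after interchanging, the integral over `u`
is the lower-rank Mellin transform on vertical lines. -/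
theorem integral_logWhittaker_mul_kernelExp (h1 : ∀ j : Fin k, c j < (s j.castSucc).re)
    (h2 : ∀ j : Fin k, c j < (s j.succ + a 0).re)
    (ih : Integrable fun u : Fin k → ℝ =>
      logWhittaker k (Fin.tail a) u * Complex.exp (∑ j, (c j : ℂ) * u j)) :
    ∫ u : Fin k → ℝ, logWhittaker k (Fin.tail a) u *
        ∏ j : Fin k, ∫ τ, kernelExp (s j.castSucc) (s j.succ + a 0) (u j) τ =
      (∏ j : Fin k, (Real.pi : ℂ) ^ ((s j.castSucc - (s j.succ + a 0)) / 2)) *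
      ((4 * (Real.pi : ℂ)) ^ k)⁻¹ * ∫ t : Fin k → ℝ,
        (∫ u : Fin k → ℝ, logWhittaker k (Fin.tail a) u *
          Complex.exp (∑ j, vline (c j) (t j) * u j)) *
        barnesKernel (fun j => s j.castSucc) (fun j => s j.succ + a 0)
          fun j => vline (c j) (t j) := by
  have hΓ : Integrable fun t : Fin k → ℝ => barnesKernel (fun j => s j.castSucc)
      (fun j => s j.succ + a 0) fun j => vline (c j) (t j) :=
    Integrable.fintype_prod (f := fun j (t : ℝ) => Complex.Gammaℝ (s j.castSucc - vline (c j) t) *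
      Complex.Gammaℝ (s j.succ + a 0 - vline (c j) t))
      fun j => integrable_Gammaℝ_mul_Gammaℝ_vline (h1 j) (h2 j)
  have hexp : ∀ u t : Fin k → ℝ, Complex.exp (∑ j, vline (c j) (t j) * u j) =
      Complex.exp (∑ j, (c j : ℂ) * u j) * Complex.exp (∑ j, (t j : ℂ) * Complex.I * u j) := by
    intro u t
    rw [← Complex.exp_add, ← Finset.sum_add_distrib]
    congr 1
    refine Finset.sum_congr rfl fun j _ => ?_
    rw [vline]
    ring
  have hint : Integrable (fun r : (Fin k → ℝ) × (Fin k → ℝ) => logWhittaker k (Fin.tail a) r.1 *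
      Complex.exp (∑ j, vline (c j) (r.2 j) * r.1 j) * barnesKernel (fun j => s j.castSucc)
      (fun j => s j.succ + a 0) fun j => vline (c j) (r.2 j)) := by
    have h3 := (ih.mul_prod hΓ).mul_bdd (c := 1) (g := fun r : (Fin k → ℝ) × (Fin k → ℝ) =>
      Complex.exp (∑ j, (r.2 j : ℂ) * Complex.I * r.1 j))
      (Continuous.aestronglyMeasurable (by fun_prop)) (Eventually.of_forall fun r => by
        rw [Complex.norm_exp]
        simp)
    refine h3.congr (Eventually.of_forall fun r => ?_)
    simp only
    rw [hexp]
    ring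
  calc _ = ∫ u : Fin k → ℝ, ((∏ j : Fin k,
          (Real.pi : ℂ) ^ ((s j.castSucc - (s j.succ + a 0)) / 2)) * ((4 * (Real.pi : ℂ)) ^ k)⁻¹) *
          ∫ t : Fin k → ℝ, logWhittaker k (Fin.tail a) u *
            Complex.exp (∑ j, vline (c j) (t j) * u j) * barnesKernel (fun j => s j.castSucc)
            (fun j => s j.succ + a 0) fun j => vline (c j) (t j) := by
        congr 1
        ext u
        have h4 := integral_fintype_prod_volume_eq_prod (𝕜 := ℂ) fun (j : Fin k) (t : ℝ) =>
          Complex.Gammaℝ (s j.castSucc - vline (c j) t) *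
            Complex.Gammaℝ (s j.succ + a 0 - vline (c j) t) * Complex.exp (vline (c j) t * u j)
        have h5 : ∀ j : Fin k, _ := fun j => integral_kernelExp (h1 j) (h2 j) (u j)
        simp only [h5]
        rw [Finset.prod_mul_distrib, Finset.prod_mul_distrib, ← h4, Finset.prod_const,
          Finset.card_univ, Fintype.card_fin, one_div, inv_pow, mul_left_comm, ← integral_const_mul]
        congr 2
        ext t
        rw [Finset.prod_mul_distrib, ← Complex.exp_sum, barnesKernel]
        ring
    _ = _ := by
        rw [integral_const_mul, integral_integral_swap hint]
        simp only [integral_mul_const]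

theorem integral_logWhittaker_succ (hc : ∀ j, ∀ z ∈ poles (Fin.tail a) j, z.re < c j)
    (h1 : ∀ j : Fin k, c j < (s j.castSucc).re) (h2 : ∀ j : Fin k, c j < (s j.succ + a 0).re)
    (hT : 0 < (s (Fin.last k) + ∑ i, Fin.tail a i).re) (hA : 0 < (s 0 + a 0).re)
    (ih : ∀ w : Fin k → ℂ, (∀ j, (w j).re = c j) → Integrable (fun u : Fin k → ℝ =>
        logWhittaker k (Fin.tail a) u * Complex.exp (∑ j, w j * u j)) ∧
      ∫ u : Fin k → ℝ, logWhittaker k (Fin.tail a) u * Complex.exp (∑ j, w j * u j) =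
        (2 ^ k)⁻¹ * mellinBarnes k (Fin.tail a) w) :
    Integrable (fun u : Fin (k + 1) → ℝ => logWhittaker (k + 1) a u *
      Complex.exp (∑ j, s j * u j)) ∧
    ∫ u : Fin (k + 1) → ℝ, logWhittaker (k + 1) a u * Complex.exp (∑ j, s j * u j) =
      (2 ^ (k + 1))⁻¹ * mellinBarnes (k + 1) a s := by
  have ih0 := (ih (fun j => c j) fun j => rfl).1
  have hsep := integrable_separatedIntegrand h1 h2 hT hA ih0
  have hmp : MeasurePreserving (fun r : (Fin (k + 1) → ℝ) × (Fin (k + 1) → ℝ) =>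
      (r.1, r.2 + separatingShift r.1)) (volume.prod volume) (volume.prod volume) := by
    refine (MeasurePreserving.id volume).skew_product
      (g := fun τ η : Fin (k + 1) → ℝ => η + separatingShift τ) ?_
      (Eventually.of_forall fun τ => map_add_right_eq_self _ _)
    exact (continuous_snd.add (continuous_separatingShift.comp continuous_fst)).measurable
  set c₀ : ℂ := (Real.pi : ℂ) ^ (((k : ℂ) + 2) * a 0 / 2 - (∑ i, a i) / 2) with hc₀
  have hF : Integrable (fun r : (Fin (k + 1) → ℝ) × (Fin (k + 1) → ℝ) =>
      separatedIntegrand a s r.1 (r.2 + separatingShift r.1)) :=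
    hmp.integrable_comp_of_integrable hsep
  have heq : ∀ η : Fin (k + 1) → ℝ, logWhittaker (k + 1) a η * Complex.exp (∑ j, s j * η j) =
      c₀ * ∫ τ, separatedIntegrand a s τ (η + separatingShift τ) := fun η => by
    simp only [separatedIntegrand_add_shift, integral_mul_const]
    rw [logWhittaker, ← hc₀, mul_assoc]
  simp only [heq]
  refine ⟨(Integrable.integral_prod_right hF).const_mul _, ?_⟩
  rw [integral_const_mul, integral_integral_swap (f := fun η τ : Fin (k + 1) → ℝ =>
    separatedIntegrand a s τ (η + separatingShift τ)) hF.swap]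
  have hshift : ∀ τ : Fin (k + 1) → ℝ, ∫ η, separatedIntegrand a s τ (η + separatingShift τ) =
      ∫ η, separatedIntegrand a s τ η := fun τ => integral_add_right_eq_self _ _
  simp only [hshift]
  rw [integral_integral_swap hsep]
  simp only [integral_separatedIntegrand _ hT]
  rw [integral_const_mul, integral_head_tail (fun x : ℝ =>
    Complex.exp (-(Real.pi ^ 2 * Real.exp (2 * x) : ℝ) + (s 0 + a 0) * x)) (fun u : Fin k → ℝ =>
      logWhittaker k (Fin.tail a) u *
        ∏ j : Fin k, ∫ τ, kernelExp (s j.castSucc) (s j.succ + a 0) (u j) τ),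
    integral_exp_neg_pi_sq hA, integral_logWhittaker_mul_kernelExp h1 h2 ih0,
    mellinBarnes_succ_eq_integral a hc h1 h2]
  have hN : ∀ t : Fin k → ℝ, ∫ u : Fin k → ℝ, logWhittaker k (Fin.tail a) u *
      Complex.exp (∑ j, vline (c j) (t j) * u j) =
      (2 ^ k)⁻¹ * mellinBarnes k (Fin.tail a) fun j => vline (c j) (t j) := fun t =>
    (ih _ fun j => vline_re _ _).2
  simp only [hN, mul_assoc ((2 : ℂ) ^ k)⁻¹]
  rw [integral_const_mul]
  have hpi : (Real.pi : ℂ) ≠ 0 := by simp [Real.pi_ne_zero]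
  -- All powers of `π` cancel, which is what fixes the prefactor in `logWhittaker`. The additional
  -- factor `1/2` in the conclusion comes from the integral over `u 0`.
  have hpow : c₀ * (Real.pi : ℂ) ^ ((s (Fin.last k) + ∑ i, Fin.tail a i) / 2) *
      (Real.pi : ℂ) ^ (-((s 0 + a 0) / 2)) *
      ∏ j : Fin k, (Real.pi : ℂ) ^ ((s j.castSucc - (s j.succ + a 0)) / 2) = 1 := by
    have e1 : ∏ j : Fin k, (Real.pi : ℂ) ^ ((s j.castSucc - (s j.succ + a 0)) / 2) =
        (Real.pi : ℂ) ^ (∑ j : Fin k, (s j.castSucc - (s j.succ + a 0)) / 2) := by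
      simp only [Complex.cpow_def_of_ne_zero hpi, Finset.mul_sum, Complex.exp_sum]
    have e2 : ∑ j : Fin k, (s j.castSucc - (s j.succ + a 0)) / 2 =
        (s 0 - s (Fin.last k)) / 2 - k * a 0 / 2 := by
      have h3 := (Fin.sum_univ_succ s).symm.trans (Fin.sum_univ_castSucc s)
      rw [← Finset.sum_div, Finset.sum_sub_distrib, Finset.sum_add_distrib, Finset.sum_const,
        Finset.card_univ, Fintype.card_fin, nsmul_eq_mul]
      linear_combination -h3 / 2
    rw [e1, hc₀, ← Complex.cpow_add _ _ hpi, ← Complex.cpow_add _ _ hpi, ← Complex.cpow_add _ _ hpi,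
      e2]
    have hsum : ∑ i, a i = a 0 + ∑ i, Fin.tail a i := Fin.sum_univ_succ a
    rw [hsum]
    convert Complex.cpow_zero (Real.pi : ℂ) using 2
    ring
  rw [pow_succ, mul_inv]
  linear_combination (Complex.Gammaℝ (s 0 + a 0) *
    Complex.Gammaℝ (s (Fin.last k) + ∑ i, Fin.tail a i) * (1 / 2) * ((4 * (Real.pi : ℂ)) ^ k)⁻¹ *
    ((2 ^ k)⁻¹ * ∫ t : Fin k → ℝ, mellinBarnes k (Fin.tail a) (fun j => vline (c j) (t j)) *
      barnesKernel (fun j => s j.castSucc) (fun j => s j.succ + a 0)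
        fun j => vline (c j) (t j))) * hpow

end

/-- The Mellin transform of the Whittaker function in the tube of absolute convergence. -/
theorem integral_logWhittaker : ∀ {k : ℕ} (a : Fin (k + 1) → ℂ) (s : Fin k → ℂ),
    (∀ j, ∀ z ∈ poles a j, z.re < (s j).re) →
    Integrable (fun u : Fin k → ℝ => logWhittaker k a u * Complex.exp (∑ j, s j * u j)) ∧
      ∫ u : Fin k → ℝ, logWhittaker k a u * Complex.exp (∑ j, s j * u j) =
        (2 ^ k)⁻¹ * mellinBarnes k a s
  | 0, a, s, _ => by
      constructor
      · exact Integrable.of_finite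
      · simp [logWhittaker, mellinBarnes, measureReal_def, volume_pi]
  | k + 1, a, s, hs => by
      -- The abscissa `c j` must lie to the right of the poles of the lower rank and to the left of
      -- both `Re (s j.castSucc)` and `Re (s j.succ + a 0)`.
      choose c₁ hc₁ hc₁' using fun j : Fin k => (isLeftSet_poles (Fin.tail a) j).exists_between
        (x := (s j.castSucc).re) fun z hz => hs _ z (poles_tail_subset a j hz)
      choose c₂ hc₂ hc₂' using fun j : Fin k => (isLeftSet_poles (Fin.tail a) j).exists_between
        (x := (s j.succ + a 0).re) fun z hz => by
          have := hs _ _ (sub_mem_poles_of_tail hz)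
          rw [Complex.sub_re] at this
          rw [Complex.add_re]
          linarith
      have hc : ∀ j, ∀ z ∈ poles (Fin.tail a) j, z.re < min (c₁ j) (c₂ j) := fun j z hz =>
        lt_min (hc₁' j z hz) (hc₂' j z hz)
      refine integral_logWhittaker_succ (c := fun j => min (c₁ j) (c₂ j)) hc
        (fun j => (min_le_left _ _).trans_lt (hc₁ j)) (fun j => (min_le_right _ _).trans_lt (hc₂ j))
        ?_ ?_ fun w hw => integral_logWhittaker (Fin.tail a) w fun j z hz => ?_
      · have := hs _ _ (neg_sum_tail_mem_poles a 0)
        simp only [Nat.cast_zero, mul_zero, sub_zero, Complex.neg_re] at this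
        rw [Complex.add_re]
        linarith
      · have := hs _ _ (neg_head_mem_poles a 0)
        simp only [Nat.cast_zero, mul_zero, sub_zero, Complex.neg_re] at this
        rw [Complex.add_re]
        linarith
      · rw [hw]
        exact hc j z hz

/-- A twist by a power of the determinant. It converts the parameters `Fin.tail a` of this recursion
into the normalized `ã` of the original one. -/
theorem logWhittaker_add_const : ∀ {k : ℕ} (b : Fin (k + 1) → ℂ) (c : ℂ) (η : Fin k → ℝ),
    logWhittaker k (fun i => b i + c) η =
      Complex.exp (c * ∑ j : Fin k, ((j : ℂ) + 1) * η j) * logWhittaker k b η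
  | 0, _, _, _ => by simp [logWhittaker]
  | k + 1, b, c, η => by
      have htail : Fin.tail (fun i => b i + c) = fun i => Fin.tail b i + c := rfl
      have hs1 : ∑ i, (b i + c) = ∑ i, b i + (k + 2) * c := by
        rw [Finset.sum_add_distrib, Finset.sum_const, Finset.card_univ, Fintype.card_fin,
          nsmul_eq_mul]
        push_cast
        ring
      have hs2 : ∑ i, (Fin.tail b i + c) = ∑ i, Fin.tail b i + (k + 1) * c := by
        rw [Finset.sum_add_distrib, Finset.sum_const, Finset.card_univ, Fintype.card_fin,
          nsmul_eq_mul]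
        push_cast
        ring
      have e0 : ∀ x : Fin (k + 1) → ℝ, ∑ j : Fin (k + 1), ((j : ℂ) + 1) * (x j : ℂ) =
          ∑ j : Fin (k + 1), (j : ℂ) * (x j : ℂ) + ∑ j, (x j : ℂ) := fun x => by
        rw [← Finset.sum_add_distrib]
        exact Finset.sum_congr rfl fun j _ => by ring
      have e1 : ∀ x : Fin (k + 1) → ℝ, ∑ j : Fin (k + 1), (j : ℂ) * (x j : ℂ) =
          ∑ j : Fin k, ((j : ℂ) + 1) * (x j.succ : ℂ) := fun x => by
        rw [Fin.sum_univ_succ]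
        simp
      have e2 : ∀ x : Fin (k + 1) → ℝ, ∑ j : Fin (k + 1), ((j : ℂ) + 1) * (x j : ℂ) =
          ∑ j : Fin k, ((j : ℂ) + 1) * (x j.castSucc : ℂ) + (k + 1) * x (Fin.last k) := fun x => by
        rw [Fin.sum_univ_castSucc]
        simp
      -- Summation by parts: the terms in `τ` that carry the factor `c` cancel.
      have hE : ∀ (τ : Fin (k + 1) → ℝ) (X : Fin (k + 1) → ℂ),
          c * (∑ j : Fin k, ((j : ℂ) + 1) *
            ((η j.succ + (τ j.succ - τ j.castSucc) / 2 : ℝ) : ℂ)) +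
          ((∑ j, (X j + (b 0 + c) * ((η j + τ j / 2 : ℝ) : ℂ))) -
            (∑ i, Fin.tail b i + (k + 1) * c) * ((τ (Fin.last k) / 2 : ℝ) : ℂ)) =
          c * (∑ j : Fin (k + 1), ((j : ℂ) + 1) * (η j : ℂ)) +
          ((∑ j, (X j + b 0 * ((η j + τ j / 2 : ℝ) : ℂ))) -
            (∑ i, Fin.tail b i) * ((τ (Fin.last k) / 2 : ℝ) : ℂ)) := by
        intro τ X
        have e5 : ∑ j : Fin k, ((j : ℂ) + 1) *
            ((η j.succ + (τ j.succ - τ j.castSucc) / 2 : ℝ) : ℂ) =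
            ∑ j : Fin k, ((j : ℂ) + 1) * (η j.succ : ℂ) +
            (∑ j : Fin k, ((j : ℂ) + 1) * (τ j.succ : ℂ) -
              ∑ j : Fin k, ((j : ℂ) + 1) * (τ j.castSucc : ℂ)) / 2 := by
          rw [← Finset.sum_sub_distrib, Finset.sum_div, ← Finset.sum_add_distrib]
          refine Finset.sum_congr rfl fun j _ => ?_
          push_cast
          ring
        have e7 : ∑ j : Fin (k + 1), ((η j + τ j / 2 : ℝ) : ℂ) =
            ∑ j, (η j : ℂ) + (∑ j, (τ j : ℂ)) / 2 := by
          rw [Finset.sum_div, ← Finset.sum_add_distrib]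
          exact Finset.sum_congr rfl fun j _ => by push_cast; ring
        have e8 : ∀ β : ℂ, ∑ j, (X j + β * ((η j + τ j / 2 : ℝ) : ℂ)) = ∑ j, X j +
            β * (∑ j, (η j : ℂ) + (∑ j, (τ j : ℂ)) / 2) := fun β => by
          rw [Finset.sum_add_distrib, ← Finset.mul_sum, e7]
        have f1 := e0 η
        have f2 := e1 η
        have f3 := e0 τ
        have f4 := e1 τ
        have f5 := e2 τ
        rw [e8, e8, e5, Complex.ofReal_div, Complex.ofReal_ofNat]
        linear_combination -c * f1 - c * f2 + c / 2 * f5 - c / 2 * f3 - c / 2 * f4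
      have hpt : ∀ τ : Fin (k + 1) → ℝ, logWhittaker k (fun i => Fin.tail b i + c)
            (fun j => η j.succ + (τ j.succ - τ j.castSucc) / 2) *
            Complex.exp ((∑ j, (-(Real.pi ^ 2 * Real.exp (2 * η j + τ j) : ℝ) -
              (Real.exp (-τ j) : ℂ) + (b 0 + c) * (η j + τ j / 2 : ℝ))) -
              (∑ i, Fin.tail b i + (k + 1) * c) * (τ (Fin.last k) / 2 : ℝ)) =
          Complex.exp (c * ∑ j : Fin (k + 1), ((j : ℂ) + 1) * η j) * (logWhittaker k (Fin.tail b)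
            (fun j => η j.succ + (τ j.succ - τ j.castSucc) / 2) *
            Complex.exp ((∑ j, (-(Real.pi ^ 2 * Real.exp (2 * η j + τ j) : ℝ) -
              (Real.exp (-τ j) : ℂ) + b 0 * (η j + τ j / 2 : ℝ))) -
              (∑ i, Fin.tail b i) * (τ (Fin.last k) / 2 : ℝ))) := fun τ => by
        rw [logWhittaker_add_const (Fin.tail b) c, mul_right_comm, ← Complex.exp_add, hE,
          Complex.exp_add]
        ring
      rw [logWhittaker, logWhittaker, htail, hs1, hs2]
      simp only [hpt]
      rw [integral_const_mul, show ((k : ℂ) + 2) * (b 0 + c) / 2 - (∑ i, b i + (k + 2) * c) / 2 =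
        (k + 2) * b 0 / 2 - (∑ i, b i) / 2 by ring, mul_left_comm]

/-! ### Passage from logarithmic to multiplicative coordinates -/

/-- The coordinatewise exponential. -/
def expPi {k : ℕ} (η : Fin k → ℝ) : Fin k → ℝ := fun j => Real.exp (η j)

theorem image_expPi (k : ℕ) : (expPi : (Fin k → ℝ) → Fin k → ℝ) '' Set.univ = posOrthant k := by
  ext t
  constructor
  · rintro ⟨η, -, rfl⟩ j
    exact Real.exp_pos _
  · intro ht
    exact ⟨fun j => Real.log (t j), trivial, funext fun j => Real.exp_log (ht j)⟩

theorem injective_expPi (k : ℕ) : Function.Injective (expPi : (Fin k → ℝ) → Fin k → ℝ) :=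
  fun _ _ h => funext fun j => Real.exp_injective (congrFun h j)

/-- The derivative of the coordinatewise exponential. -/
def expPiDeriv {k : ℕ} (η : Fin k → ℝ) : (Fin k → ℝ) →L[ℝ] (Fin k → ℝ) :=
  LinearMap.toContinuousLinearMap (Matrix.toLin' (Matrix.diagonal (expPi η)))

theorem hasFDerivAt_expPi {k : ℕ} (η : Fin k → ℝ) : HasFDerivAt expPi (expPiDeriv η) η := by
  rw [hasFDerivAt_pi']
  intro j
  have h := (Real.hasDerivAt_exp (η j)).comp_hasFDerivAt η
    (ContinuousLinearMap.proj (R := ℝ) (φ := fun _ : Fin k => ℝ) j).hasFDerivAt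
  refine h.congr_fderiv ?_
  ext v
  simp [expPiDeriv, Matrix.mulVec_diagonal, expPi]

theorem abs_det_expPiDeriv {k : ℕ} (η : Fin k → ℝ) : |(expPiDeriv η).det| = ∏ j, expPi η j := by
  rw [expPiDeriv, LinearMap.det_toContinuousLinearMap, LinearMap.det_toLin', Matrix.det_diagonal]
  exact abs_of_pos (Finset.prod_pos fun j _ => Real.exp_pos (η j))

theorem prod_smul_prod_inv {k : ℕ} (f : (Fin k → ℝ) → ℂ) (η : Fin k → ℝ) :
    |(expPiDeriv η).det| • (f (expPi η) * ∏ j, (expPi η j : ℂ)⁻¹) = f (expPi η) := by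
  have h : ∏ j, (expPi η j : ℂ) ≠ 0 := Finset.prod_ne_zero_iff.mpr fun j _ => by
    exact_mod_cast (Real.exp_pos (η j)).ne'
  rw [abs_det_expPiDeriv, Complex.real_smul, Complex.ofReal_prod, Finset.prod_inv_distrib,
    mul_left_comm, mul_inv_cancel₀ h, mul_one]

theorem setIntegral_posOrthant {k : ℕ} (f : (Fin k → ℝ) → ℂ) :
    ∫ t in posOrthant k, f t * ∏ j, (t j : ℂ)⁻¹ = ∫ η, f (expPi η) := by
  rw [← image_expPi, integral_image_eq_integral_abs_det_fderiv_smul volume MeasurableSet.univ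
    (fun η _ => (hasFDerivAt_expPi η).hasFDerivWithinAt) (injective_expPi k).injOn]
  simp only [prod_smul_prod_inv, Measure.restrict_univ]

theorem integrableOn_posOrthant {k : ℕ} (f : (Fin k → ℝ) → ℂ) :
    IntegrableOn (fun t => f t * ∏ j, (t j : ℂ)⁻¹) (posOrthant k) ↔
      Integrable fun η => f (expPi η) := by
  rw [← image_expPi, integrableOn_image_iff_integrableOn_abs_det_fderiv_smul volume
    MeasurableSet.univ (fun η _ => (hasFDerivAt_expPi η).hasFDerivWithinAt)
    (injective_expPi k).injOn]
  simp only [prod_smul_prod_inv, integrableOn_univ]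

theorem ofReal_exp_cpow (u : ℝ) (z : ℂ) : (Real.exp u : ℂ) ^ z = Complex.exp (z * u) := by
  rw [Complex.cpow_def_of_ne_zero (by simp), ← Complex.ofReal_log (Real.exp_pos u).le, Real.log_exp,
    mul_comm]

theorem besselK_eq_integral (ν : ℂ) (x : ℝ) : besselK ν x =
    1 / 2 * ∫ u : ℝ, Complex.exp (-(x / 2 * (Real.exp u + Real.exp (-u)) : ℝ) + ν * u) := by
  rw [besselK, ← Real.range_exp, ← Set.image_univ, integral_image_eq_integral_abs_deriv_smul
    MeasurableSet.univ (fun x _ => (Real.hasDerivAt_exp x).hasDerivWithinAt)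
    Real.exp_injective.injOn, Measure.restrict_univ]
  congr 2
  ext u
  have h : (Real.exp u : ℂ) ≠ 0 := by exact_mod_cast (Real.exp_pos u).ne'
  rw [abs_of_pos (Real.exp_pos u), Complex.real_smul, ofReal_exp_cpow, mul_div_cancel₀ _ h,
    Complex.ofReal_exp, ← Complex.exp_add, Real.exp_neg, one_div]
  push_cast
  ring_nf

/-- The translation `u = τ + η 0 + log π` in the integral for the `K`-Bessel function makes the
exponents agree. -/
theorem whittakerRadial_zero_expPi (a : Fin 2 → ℂ) (η : Fin 1 → ℝ) :
    whittakerRadial 0 a (expPi η) = logWhittaker 1 a η := by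
  have hpi : (Real.pi : ℂ) ≠ 0 := by simp [Real.pi_ne_zero]
  have hl : (Real.log Real.pi : ℂ) = Complex.log Real.pi := Complex.ofReal_log Real.pi_pos.le
  rw [whittakerRadial, besselK_eq_integral, logWhittaker]
  set f : ℝ → ℂ := fun τ => Complex.exp (-(Real.pi ^ 2 * Real.exp (2 * η 0 + τ) : ℝ) -
    (Real.exp (-τ) : ℂ) + a 0 * (η 0 + τ / 2 : ℝ) - a 1 * (τ / 2 : ℝ)) with hf
  have h1 : ∀ τ : Fin 1 → ℝ, logWhittaker 0 (Fin.tail a)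
      (fun j : Fin 0 => η j.succ + (τ j.succ - τ j.castSucc) / 2) *
      Complex.exp ((∑ j, (-(Real.pi ^ 2 * Real.exp (2 * η j + τ j) : ℝ) -
        (Real.exp (-τ j) : ℂ) + a 0 * (η j + τ j / 2 : ℝ))) -
        (∑ i, Fin.tail a i) * (τ (Fin.last 0) / 2 : ℝ)) =
      f (τ 0) * (fun _ : Fin 0 → ℝ => (1 : ℂ)) (Fin.tail τ) := fun τ => by
    simp [logWhittaker, hf, Fin.tail]
  have h2 : ∫ _ : Fin 0 → ℝ, (1 : ℂ) = 1 := by simp [measureReal_def, volume_pi]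
  have h3 : ∫ τ : Fin 1 → ℝ, f (τ 0) * (fun _ : Fin 0 → ℝ => (1 : ℂ)) (Fin.tail τ) =
      (∫ x, f x) * ∫ _ : Fin 0 → ℝ, (1 : ℂ) :=
    integral_head_tail (𝕜 := ℂ) (k := 0) f fun _ => 1
  rw [integral_congr_ae (Eventually.of_forall h1), h3, h2, mul_one,
    ← integral_add_right_eq_self (fun u : ℝ => Complex.exp
    (-(2 * Real.pi * expPi η 0 / 2 * (Real.exp u + Real.exp (-u)) : ℝ) + (a 0 - a 1) / 2 * u))
    (η 0 + Real.log Real.pi), mul_left_comm, ← mul_assoc, ← mul_assoc]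
  rw [expPi, ofReal_exp_cpow, ← integral_const_mul, ← integral_const_mul]
  congr 1
  ext τ
  have e1 : 2 * Real.pi * Real.exp (η 0) / 2 * (Real.exp (τ + (η 0 + Real.log Real.pi)) +
      Real.exp (-(τ + (η 0 + Real.log Real.pi)))) =
      Real.pi ^ 2 * Real.exp (2 * η 0 + τ) + Real.exp (-τ) := by
    rw [neg_add, neg_add, Real.exp_add τ, Real.exp_add (η 0), Real.exp_log Real.pi_pos,
      Real.exp_add (-τ), Real.exp_add (-η 0), Real.exp_neg (Real.log _), Real.exp_log Real.pi_pos,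
      two_mul (η 0), Real.exp_add (η 0 + η 0), Real.exp_add (η 0) (η 0), Real.exp_neg (η 0)]
    have := Real.exp_pos (η 0)
    have := Real.pi_pos
    field_simp
  rw [e1, Complex.cpow_def_of_ne_zero hpi, ← hl, show (1 / 2 * 2 : ℂ) = 1 by norm_num, one_mul,
    ← Complex.exp_add, hf]
  simp only
  rw [← Complex.exp_add, Fin.sum_univ_two]
  push_cast
  ring_nf

theorem sum_natCast_sub (m : ℕ) :
    ∑ j : Fin (m + 2), ((m : ℂ) + 2 - (j : ℕ)) = (m + 2) * (m + 3) / 2 := by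
  have h := Finset.sum_range_id_mul_two (m + 2)
  have h2 : (∑ i ∈ Finset.range (m + 2), (i : ℂ)) * 2 = (m + 2) * (m + 1) := by
    have := congrArg (Nat.cast : ℕ → ℂ) h
    push_cast [show m + 2 - 1 = m + 1 from rfl] at this
    exact this
  rw [Finset.sum_sub_distrib, Finset.sum_const, Finset.card_univ, Fintype.card_fin, nsmul_eq_mul,
    Fin.sum_univ_eq_sum_range (fun i => (i : ℂ))]
  push_cast
  linear_combination -h2 / 2

/-- It evaluates, by summation by parts, the exponent that `logWhittaker_add_const` produces inside
the recursion. -/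
theorem sum_mul_recursion_shift {k : ℕ} (η τ : Fin (k + 1) → ℝ) :
    ∑ j : Fin k, ((j : ℂ) + 1) * ((η j.succ + (τ j.succ - τ j.castSucc) / 2 : ℝ) : ℂ) =
      ∑ j : Fin (k + 1), (j : ℂ) * (η j : ℂ) +
        ((k + 1) * (τ (Fin.last k) : ℂ) - ∑ j, (τ j : ℂ)) / 2 := by
  have f1 : ∑ j : Fin (k + 1), (j : ℂ) * (η j : ℂ) = ∑ j : Fin k, ((j : ℂ) + 1) * (η j.succ : ℂ) := by
    rw [Fin.sum_univ_succ]
    simp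
  have f2 : ∑ j : Fin (k + 1), (j : ℂ) * (τ j : ℂ) = ∑ j : Fin k, ((j : ℂ) + 1) * (τ j.succ : ℂ) := by
    rw [Fin.sum_univ_succ]
    simp
  have f3 : ∑ j : Fin (k + 1), ((j : ℂ) + 1) * (τ j : ℂ) =
      ∑ j : Fin k, ((j : ℂ) + 1) * (τ j.castSucc : ℂ) + (k + 1) * τ (Fin.last k) := by
    rw [Fin.sum_univ_castSucc]
    simp
  have f4 : ∑ j : Fin (k + 1), ((j : ℂ) + 1) * (τ j : ℂ) =
      ∑ j : Fin (k + 1), (j : ℂ) * (τ j : ℂ) + ∑ j, (τ j : ℂ) := by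
    rw [← Finset.sum_add_distrib]
    exact Finset.sum_congr rfl fun j _ => by ring
  have f5 : ∑ j : Fin k, ((j : ℂ) + 1) *
      ((η j.succ + (τ j.succ - τ j.castSucc) / 2 : ℝ) : ℂ) =
      ∑ j : Fin k, ((j : ℂ) + 1) * (η j.succ : ℂ) +
      (∑ j : Fin k, ((j : ℂ) + 1) * (τ j.succ : ℂ) -
        ∑ j : Fin k, ((j : ℂ) + 1) * (τ j.castSucc : ℂ)) / 2 := by
    rw [← Finset.sum_sub_distrib, Finset.sum_div, ← Finset.sum_add_distrib]
    refine Finset.sum_congr rfl fun j _ => ?_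
    push_cast
    ring
  linear_combination f5 - f1 - f2 / 2 + f3 / 2 - f4 / 2

theorem ofReal_pi_mul_exp_cpow (u : ℝ) (z : ℂ) :
    ((Real.pi * Real.exp u : ℝ) : ℂ) ^ z = Complex.exp (z * (Real.log Real.pi + u)) := by
  rw [show Real.pi * Real.exp u = Real.exp (Real.log Real.pi + u) by
    rw [Real.exp_add, Real.exp_log Real.pi_pos], ofReal_exp_cpow, Complex.ofReal_add]

/-- After `t = e^τ` the integrands coincide pointwise; the twist by `a_1/(n-1)` absorbs the
normalization of `ã`, and what remains is to compare exponents. -/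
theorem whittakerRadial_expPi : ∀ (m : ℕ) (a : Fin (m + 2) → ℂ) (η : Fin (m + 1) → ℝ),
    whittakerRadial m a (expPi η) = logWhittaker (m + 1) a η
  | 0, a, η => whittakerRadial_zero_expPi a η
  | m + 1, a, η => by
      have hpi : (Real.pi : ℂ) ≠ 0 := by simp [Real.pi_ne_zero]
      have hm : (m : ℂ) + 2 ≠ 0 := by exact_mod_cast (by omega : m + 2 ≠ 0)
      rw [whittakerRadial, setIntegral_posOrthant (fun t => whittakerRadial m (tildeParam a)
            (fun j : Fin (m + 1) => expPi η j.succ * Real.sqrt (t j.succ / t j.castSucc))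
          * (∏ j : Fin (m + 2),
              (Real.exp (-(Real.pi * expPi η j) ^ 2 * t j - 1 / t j) : ℂ)
                * ((Real.pi * expPi η j : ℝ) : ℂ)
                    ^ (((m : ℂ) + 2 - ((j : ℕ) : ℂ)) * a 0 / ((m : ℂ) + 2))
                * (t j : ℂ) ^ (((m : ℂ) + 3) * a 0 / (2 * ((m : ℂ) + 2))))
          * ((Real.pi * t (Fin.last (m + 1)) : ℝ) : ℂ) ^ (-(∑ i, a i) / 2)),
        logWhittaker, ← integral_const_mul]
      congr 1
      ext τ
      have harg : (fun j : Fin (m + 1) => expPi η j.succ *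
          Real.sqrt (expPi τ j.succ / expPi τ j.castSucc)) =
          expPi fun j => η j.succ + (τ j.succ - τ j.castSucc) / 2 := by
        ext j
        simp only [expPi]
        rw [← Real.exp_sub, ← Real.exp_half, ← Real.exp_add]
      have htilde : tildeParam a = fun i => Fin.tail a i + a 0 / ((m : ℂ) + 2) := rfl
      have hfac : ∀ j : Fin (m + 2), (Real.exp (-(Real.pi * expPi η j) ^ 2 * expPi τ j -
            1 / expPi τ j) : ℂ) * ((Real.pi * expPi η j : ℝ) : ℂ)
              ^ (((m : ℂ) + 2 - ((j : ℕ) : ℂ)) * a 0 / ((m : ℂ) + 2))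
            * (expPi τ j : ℂ) ^ (((m : ℂ) + 3) * a 0 / (2 * ((m : ℂ) + 2))) =
          Complex.exp ((-(Real.pi ^ 2 * Real.exp (2 * η j + τ j) : ℝ) - (Real.exp (-τ j) : ℂ)) +
            ((m : ℂ) + 2 - (j : ℕ)) * (a 0 / (m + 2) * Real.log Real.pi) +
            (a 0 * η j - a 0 / (m + 2) * ((j : ℕ) * η j)) +
            (m + 3) * (a 0 / (m + 2)) / 2 * τ j) := fun j => by
        have e : -(Real.pi * Real.exp (η j)) ^ 2 * Real.exp (τ j) - 1 / Real.exp (τ j) =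
            -(Real.pi ^ 2 * Real.exp (2 * η j + τ j)) - Real.exp (-τ j) := by
          rw [two_mul, Real.exp_add, Real.exp_add, Real.exp_neg, one_div]
          ring
        simp only [expPi]
        rw [ofReal_pi_mul_exp_cpow, ofReal_exp_cpow, e, Complex.ofReal_exp, ← Complex.exp_add,
          ← Complex.exp_add]
        congr 1
        push_cast
        field_simp
        ring
      rw [harg, whittakerRadial_expPi m, htilde, logWhittaker_add_const]
      simp only [hfac]
      rw [← Complex.exp_sum]
      simp only [expPi]
      rw [ofReal_pi_mul_exp_cpow, Complex.cpow_def_of_ne_zero hpi,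
        ← Complex.ofReal_log Real.pi_pos.le, sum_mul_recursion_shift]
      rw [mul_assoc, mul_assoc, mul_left_comm, mul_left_comm (Complex.exp _) (logWhittaker _ _ _),
        ← Complex.exp_add, ← Complex.exp_add, ← Complex.exp_add]
      congr 2
      have g1 := sum_natCast_sub m
      have g2 : ∑ i, a i = a 0 + ∑ i, Fin.tail a i := Fin.sum_univ_succ a
      have g3 : ∀ x : Fin (m + 2) → ℂ, ∑ j, (x j + a 0 * ((η j + τ j / 2 : ℝ) : ℂ)) = ∑ j, x j +
          a 0 * (∑ j, (η j : ℂ) + (∑ j, (τ j : ℂ)) / 2) := fun x => by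
        rw [Finset.sum_add_distrib, ← Finset.mul_sum, Finset.sum_div, ← Finset.sum_add_distrib]
        push_cast
        rfl
      rw [g3, Finset.sum_add_distrib, Finset.sum_add_distrib, Finset.sum_add_distrib,
        ← Finset.sum_mul, g1, Finset.sum_sub_distrib, Finset.sum_sub_distrib,
        ← Finset.mul_sum, ← Finset.mul_sum, ← Finset.mul_sum, g2]
      push_cast
      field_simp
      ring

theorem mellinIntegrand_eq (m : ℕ) (a : Fin (m + 2) → ℂ) (s : Fin (m + 1) → ℂ)
    (y : Fin (m + 1) → ℝ) : mellinIntegrand m a s y =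
      (whittakerRadial m a y * ∏ j, (y j : ℂ) ^ (s j)) * ∏ j, (y j : ℂ)⁻¹ := by
  simp only [mellinIntegrand, div_eq_mul_inv, Finset.prod_mul_distrib, mul_assoc]

theorem whittakerRadial_mul_prod_cpow_expPi (m : ℕ) (a : Fin (m + 2) → ℂ) (s : Fin (m + 1) → ℂ)
    (η : Fin (m + 1) → ℝ) : whittakerRadial m a (expPi η) * ∏ j, (expPi η j : ℂ) ^ (s j) =
      logWhittaker (m + 1) a η * Complex.exp (∑ j, s j * η j) := by
  rw [whittakerRadial_expPi, Complex.exp_sum]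
  simp only [expPi, ofReal_exp_cpow]

/-! ### The continued Mellin transform and the two formulas -/

theorem isMellinContinuation_mellinBarnes (m : ℕ) (a : Fin (m + 2) → ℂ) :
    IsMellinContinuation m a fun s => (2 ^ (m + 1))⁻¹ * mellinBarnes (m + 1) a s := by
  have hpoles : ∀ s : Fin (m + 1) → ℂ,
      (∀ (j : Fin (m + 1)) (I : Finset (Fin (m + 2))), I.card = (j : ℕ) + 1 →
        0 < (s j + ∑ i ∈ I, a i).re) → ∀ j, ∀ z ∈ poles a j, z.re < (s j).re := by
    rintro s hs j _ ⟨I, hI, n, rfl⟩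
    have h := hs j I hI
    have hn : (0 : ℝ) ≤ n := n.cast_nonneg
    simp only [Complex.add_re, Complex.sub_re, Complex.neg_re, Complex.mul_re, Complex.re_ofNat,
      Complex.natCast_re, Complex.im_ofNat, Complex.natCast_im] at h ⊢
    linarith
  refine ⟨(boundedOff_mellinBarnes a).differentiableOn.const_mul _, fun s hs => ?_, fun s hs => ?_⟩
  · refine ((integrableOn_posOrthant fun y => whittakerRadial m a y * ∏ j, (y j : ℂ) ^ (s j)).mpr
      ?_).congr_fun_ae (Eventually.of_forall fun y => (mellinIntegrand_eq m a s y).symm)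
    simp only [whittakerRadial_mul_prod_cpow_expPi]
    exact (integral_logWhittaker a s (hpoles s hs)).1
  · simp only [mellinIntegrand_eq]
    rw [setIntegral_posOrthant fun y => whittakerRadial m a y * ∏ j, (y j : ℂ) ^ (s j)]
    simp only [whittakerRadial_mul_prod_cpow_expPi]
    exact (integral_logWhittaker a s (hpoles s hs)).2.symm

theorem isMellinContinuation_U (m : ℕ) (a : Fin (m + 2) → ℂ) :
    IsMellinContinuation m a (U m a) :=
  Classical.epsilon_spec ⟨_, isMellinContinuation_mellinBarnes m a⟩

/-- Restriction to the diagonal line `s + (t, …, t)`: for large `Re t` it lies in the tube of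
convergence, and only countably many `t` are exceptional. -/
theorem IsMellinContinuation.eq {m : ℕ} {a : Fin (m + 2) → ℂ} {F G : (Fin (m + 1) → ℂ) → ℂ}
    (hF : IsMellinContinuation m a F) (hG : IsMellinContinuation m a G) {s : Fin (m + 1) → ℂ}
    (hs : ∀ j, s j ∉ leftPoles m a j) : F s = G s := by
  obtain ⟨D, hD⟩ := (Set.finite_range fun r : Fin (m + 1) × Finset (Fin (m + 2)) =>
    -(s r.1 + ∑ i ∈ r.2, a i).re).bddAbove
  obtain ⟨hB, hBc⟩ := isClosed_and_countable_iUnion_preimage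
    (T := fun j : Fin (m + 1) => leftPoles m a j) (fun j => (isLeftSet_poles a j).stripFinite)
    (f := fun j t => s j + t) (fun j => by fun_prop) fun j => add_right_injective _
  have hdiff : ∀ H : (Fin (m + 1) → ℂ) → ℂ, IsMellinContinuation m a H →
      DifferentiableOn ℂ (fun t => H fun j => s j + t)
        (⋃ j, (fun t => s j + t) ⁻¹' leftPoles m a j)ᶜ := fun H hH =>
    hH.differentiableOn.comp (f := fun (t : ℂ) (j : Fin (m + 1)) => s j + t)
      (differentiable_pi.mpr fun j => by fun_prop).differentiableOn fun t ht j hj =>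
        ht (Set.mem_iUnion.mpr ⟨j, hj⟩)
  have h := eq_of_eq_of_le_re hB hBc (hdiff F hF) (hdiff G hG) (r := D + 1) (t := 0)
    (fun t ht => ?_) fun h0 => ?_
  · simpa using h
  · have hpos : ∀ (j : Fin (m + 1)) (I : Finset (Fin (m + 2))), I.card = (j : ℕ) + 1 →
        0 < (s j + t + ∑ i ∈ I, a i).re := fun j I _ => by
      have h1 : -(s j + ∑ i ∈ I, a i).re ≤ D := hD ⟨(j, I), rfl⟩
      simp only [Complex.add_re] at h1 ⊢
      linarith
    rw [hF.eq_integral _ hpos, hG.eq_integral _ hpos]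
  · obtain ⟨j, hj⟩ := Set.mem_iUnion.mp h0
    exact hs j (by simpa using hj)

theorem U_eq {m : ℕ} {a : Fin (m + 2) → ℂ} {s : Fin (m + 1) → ℂ}
    (hs : ∀ j, s j ∉ leftPoles m a j) : U m a s = (2 ^ (m + 1))⁻¹ * mellinBarnes (m + 1) a s :=
  (isMellinContinuation_U m a).eq (isMellinContinuation_mellinBarnes m a) hs

/-- The winding limits `πi` and `-πi` exclude each other. So the existence of the contours already
keeps the parameters away from the poles. -/
theorem IsBarnesContour.notMem_left {γ : ℝ → ℂ} {L R : Set ℂ} (h : IsBarnesContour γ L R) {w : ℂ}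
    (hw : w ∈ R) : w ∉ L := fun hL => by
  have h1 := tendsto_nhds_unique (h.left w hL).2 (h.right w hw).2
  have h2 := congrArg Complex.im h1
  have h3 := Real.pi_pos
  simp at h2
  linarith

theorem mem_rightPoles_self (c : ℂ) : c ∈ rightPoles c := ⟨0, by simp⟩

section

variable {m : ℕ} {a : Fin (m + 2) → ℂ} {σ : ℂ} {p p' : Fin (m + 1) → ℂ} {γ : Fin (m + 1) → ℝ → ℂ}

theorem contourIntegral_barnesIntegrand (hγ : ∀ j, IsBarnesContour (γ j) (leftPoles m a j)
      (rightPoles (p j) ∪ rightPoles (p' j + σ))) :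
    Integrable (contourIntegrand γ (barnesIntegrand m a σ p p')) ∧
      contourIntegral γ (barnesIntegrand m a σ p p') = (2 ^ (m + 1))⁻¹ *
        barnesInt (poles a) (mellinBarnes (m + 1) a) p fun j => p' j + σ := by
  obtain ⟨h1, h2⟩ := (boundedOff_mellinBarnes a).barnesInt_eq_contourIntegral
    (P := p) (Q := fun j => p' j + σ) (isLeftSet_poles a) fun j => (hγ j).separates
  have h3 : contourIntegrand γ (barnesIntegrand m a σ p p') = fun t => (2 ^ (m + 1))⁻¹ *
      contourIntegrand γ (fun w => mellinBarnes (m + 1) a w *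
        barnesKernel p (fun j => p' j + σ) w) t := by
    ext t
    have hq : ∀ j, γ j (t j) ∉ leftPoles m a j := fun j hj => ((hγ j).left _ hj).1 ⟨t j, rfl⟩
    simp only [contourIntegrand, barnesIntegrand, U_eq hq, barnesKernel, sub_add_eq_add_sub]
    ring
  refine ⟨h3 ▸ h1.const_mul _, ?_⟩
  rw [h2, contourIntegral, h3, integral_const_mul, contourIntegral]

/-- The convention `p_n = -|a|` of (2) for `-a` turns into the convention `p_0 = 0` of (1). -/
theorem extend_neg_revShift {k : ℕ} (a : Fin (k + 1) → ℂ) (p : Fin k → ℂ) (i : Fin (k + 1)) :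
    extend (-a) (revShift (∑ i, a i) p) i = (Fin.cons 0 p : Fin (k + 1) → ℂ) i.rev + ∑ i, a i := by
  refine Fin.lastCases ?_ (fun j => ?_) i
  · simp
  · simp [revShift, Fin.rev_castSucc]

theorem eq_div_mul_of_mul_mul_inv_eq {u G P X c : ℂ} (hG : G ≠ 0) (hP : P ≠ 0) {N : ℂ}
    (h : u * P * G⁻¹ = c * X) : N * u = G / P * c * (N * X) := by
  field_simp at h ⊢
  linear_combination N * h

theorem U_eq_contourIntegral_nextP (hγ : ∀ j, IsBarnesContour (γ j) (leftPoles m a j)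
      (rightPoles (p j) ∪ rightPoles (nextP a p j + σ))) (h0 : ∀ k : ℕ, p 0 + σ ≠ -2 * (k : ℂ)) :
    U m a p = Complex.Gammaℝ (p 0 + σ) / (∏ i, Complex.Gammaℝ (σ - a i)) *
      (1 / (4 * (Real.pi : ℂ) * Complex.I) ^ (m + 1)) *
        contourIntegral γ (barnesIntegrand m a σ p (nextP a p)) := by
  have hp : ∀ j, p j ∉ poles a j := fun j =>
    (hγ j).notMem_left (Or.inl (mem_rightPoles_self _))
  have hp' : ∀ j : Fin (m + 1), extend a p j.succ + σ ∉ poles a j := fun j =>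
    (hγ j).notMem_left (Or.inr (mem_rightPoles_self _))
  -- Otherwise `p_n + σ = σ - |a|` would be a left pole for the last variable, with index set the
  -- complement of `{i}`.
  have hσ : ∀ i, ∀ n : ℕ, σ - a i ≠ -(2 * n) := fun i n h => by
    refine hp' (Fin.last m) ?_
    rw [Fin.succ_last, extend_last]
    refine ⟨{i}ᶜ, by rw [Finset.card_compl]; simp, n, ?_⟩
    have := Finset.sum_add_sum_compl {i} a
    rw [Finset.sum_singleton] at this
    linear_combination h + this
  have hid := barnesIdentity a σ p hp hp' hσ
  have e0 : extend a p 0 = p 0 := extend_castSucc a p 0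
  rw [BarnesIdentity, e0] at hid
  rw [U_eq hp, (contourIntegral_barnesIntegrand hγ).2, one_div]
  -- `Γ_ℝ` has the default value `0` at its poles and no other zeros, so avoiding the poles is what
  -- permits clearing the denominators.
  refine eq_div_mul_of_mul_mul_inv_eq (fun h => ?_) (Finset.prod_ne_zero_iff.mpr fun i _ h => ?_) hid
  · obtain ⟨n, hn⟩ := Complex.Gammaℝ_eq_zero_iff.mp h
    exact h0 n (by rw [hn]; ring)
  · obtain ⟨n, hn⟩ := Complex.Gammaℝ_eq_zero_iff.mp h
    exact hσ i n hn

theorem U_eq_contourIntegral_prevP (hγ : ∀ j, IsBarnesContour (γ j) (leftPoles m a j)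
      (rightPoles (p j) ∪ rightPoles (prevP p j + σ)))
    (h0 : ∀ k : ℕ, p (Fin.last m) + σ + ∑ i, a i ≠ -2 * (k : ℂ)) :
    U m a p = Complex.Gammaℝ (p (Fin.last m) + σ + ∑ i, a i) / (∏ i, Complex.Gammaℝ (σ + a i)) *
      (1 / (4 * (Real.pi : ℂ) * Complex.I) ^ (m + 1)) *
        contourIntegral γ (barnesIntegrand m a σ p (prevP p)) := by
  have hp : ∀ j, p j ∉ poles a j := fun j =>
    (hγ j).notMem_left (Or.inl (mem_rightPoles_self _))
  have hp' : ∀ j, prevP p j + σ ∉ poles a j := fun j =>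
    (hγ j).notMem_left (Or.inr (mem_rightPoles_self _))
  -- Otherwise `p_0 + σ = σ` would be a left pole for the first variable, with index set `{i}`.
  have hσ : ∀ i, ∀ n : ℕ, σ + a i ≠ -(2 * n) := fun i n h => by
    refine hp' 0 ⟨{i}, by simp, n, ?_⟩
    have : prevP p 0 = 0 := rfl
    rw [this, Finset.sum_singleton]
    linear_combination h
  have hQ : (fun j : Fin (m + 1) => extend (-a) (revShift (∑ i, a i) p) j.succ + σ) =
      revShift (∑ i, a i) fun j => prevP p j + σ := by
    ext j
    rw [extend_neg_revShift, Fin.rev_succ, revShift, prevP]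
    ring
  have hneg : ∀ (s : Fin (m + 1) → ℂ), (∀ j, s j ∉ poles a j) →
      ∀ j, revShift (∑ i, a i) s j ∉ poles (-a) j := fun s hs j hj =>
    hs _ (by simpa [revShift] using poles_neg a j _ hj)
  -- The identity behind (2) at the reversed and translated point for `-a`; both sides are then
  -- carried back to `a` by the symmetry.
  have hid := barnesIdentity (-a) σ (revShift (∑ i, a i) p) (hneg p hp)
    (fun j => by rw [congrFun hQ j]; exact hneg _ hp' j)
    fun i n => by rw [Pi.neg_apply, sub_neg_eq_add]; exact hσ i n
  have e0 : extend (-a) (revShift (∑ i, a i) p) 0 + σ = p (Fin.last m) + σ + ∑ i, a i := by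
    rw [extend_neg_revShift, Fin.rev_zero, ← Fin.succ_last, Fin.cons_succ]
    ring
  obtain ⟨d, -, hd⟩ := exists_re_lt_of_poles a
  rw [BarnesIdentity, hQ, e0, mellinBarnes_neg a p hp, barnesInt_revShift
    (boundedOff_mellinBarnes a) (isLeftSet_poles a) (boundedOff_mellinBarnes (-a))
    (isLeftSet_poles (-a)) (poles_neg a) (mellinBarnes_neg a) hd hp hp'] at hid
  simp only [Pi.neg_apply, sub_neg_eq_add] at hid
  rw [U_eq hp, (contourIntegral_barnesIntegrand hγ).2, one_div]
  refine eq_div_mul_of_mul_mul_inv_eq (fun h => ?_) (Finset.prod_ne_zero_iff.mpr fun i _ h => ?_) hid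
  · obtain ⟨n, hn⟩ := Complex.Gammaℝ_eq_zero_iff.mp h
    exact h0 n (by rw [hn]; ring)
  · obtain ⟨n, hn⟩ := Complex.Gammaℝ_eq_zero_iff.mp h
    exact hσ i n hn

end

end GLWhittaker

end

theorem proposition1p7 (m : ℕ) (a : Fin (m + 2) → ℂ) :
    GLWhittaker.IsMellinContinuation m a (GLWhittaker.U m a) ∧
    (∀ (σ : ℂ) (p : Fin (m + 1) → ℂ) (γ : Fin (m + 1) → ℝ → ℂ),
      (∀ j, GLWhittaker.IsBarnesContour (γ j) (GLWhittaker.leftPoles m a j)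
        (GLWhittaker.rightPoles (p j) ∪ GLWhittaker.rightPoles (GLWhittaker.prevP p j + σ))) →
      (∀ k : ℕ, p (Fin.last m) + σ + ∑ i, a i ≠ -2 * (k : ℂ)) →
      Integrable (GLWhittaker.contourIntegrand γ
        (GLWhittaker.barnesIntegrand m a σ p (GLWhittaker.prevP p))) ∧
      GLWhittaker.U m a p =
        Complex.Gammaℝ (p (Fin.last m) + σ + ∑ i, a i) / (∏ i, Complex.Gammaℝ (σ + a i))
          * (1 / (4 * (Real.pi : ℂ) * Complex.I) ^ (m + 1))
          * GLWhittaker.contourIntegral γ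
              (GLWhittaker.barnesIntegrand m a σ p (GLWhittaker.prevP p))) ∧
    (∀ (σ : ℂ) (p : Fin (m + 1) → ℂ) (γ : Fin (m + 1) → ℝ → ℂ),
      (∀ j, GLWhittaker.IsBarnesContour (γ j) (GLWhittaker.leftPoles m a j)
        (GLWhittaker.rightPoles (p j) ∪ GLWhittaker.rightPoles (GLWhittaker.nextP a p j + σ))) →
      (∀ k : ℕ, p 0 + σ ≠ -2 * (k : ℂ)) →
      Integrable (GLWhittaker.contourIntegrand γ
        (GLWhittaker.barnesIntegrand m a σ p (GLWhittaker.nextP a p))) ∧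
      GLWhittaker.U m a p =
        Complex.Gammaℝ (p 0 + σ) / (∏ i, Complex.Gammaℝ (σ - a i))
          * (1 / (4 * (Real.pi : ℂ) * Complex.I) ^ (m + 1))
          * GLWhittaker.contourIntegral γ
              (GLWhittaker.barnesIntegrand m a σ p (GLWhittaker.nextP a p))) := by
  refine ⟨GLWhittaker.isMellinContinuation_U m a, fun σ p γ hγ h0 => ?_, fun σ p γ hγ h0 => ?_⟩
  · exact ⟨(GLWhittaker.contourIntegral_barnesIntegrand hγ).1,
      GLWhittaker.U_eq_contourIntegral_prevP hγ h0⟩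
  · exact ⟨(GLWhittaker.contourIntegral_barnesIntegrand hγ).1,
      GLWhittaker.U_eq_contourIntegral_nextP hγ h0⟩
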